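/- Let $n\ge 1$, let $\Omega\subset\mathbb{RP}^n$ be a properly convex domain (a nonempty open set that is contained, bounded and convex in some affine chart), with Hilbert metric $d_\Omega(x,y)=\frac12\left|\log\frac{|ay|\,|bx|}{|ax|\,|by|}\right|$, where $a,b$ are the points in which the line through $x,y$ meets $\partial\Omega$, in the order $a,x,y,b$. Let $\Gamma$ be a discrete subgroup of $\mathrm{PSL}(n+1,\mathbb R)$ that preserves $\Omega$ and acts cocompactly on it. Let $S\Omega$ be the unit tangent bundle of $\Omega$ for the Finsler norm of $d_\Omega$, let $SM=S\Omega/\Gamma$ (the unit tangent bundle of $M=\Omega/\Gamma$), and let $\phi^t$ be the geodesic flow on $SM$, which moves unit tangent vectors along projective lines at unit Hilbert speed. Then $SM$ is compact and metrizable, and there is a real number $h$ such that: (1) for every $x\in\Omega$, the critical exponent of $\Gamma$ is $h$: $$\delta_\Gamma=\limsup_{t\to\infty}\tfrac1t\log\#\{\gamma\in\Gamma\mid d_\Omega(x,\gamma x)\le t\}=h;$$ (2) for every uniform volume on $\Omega$, that is, every Borel measure $\mathrm{vol}$ for which the volumes of the unit balls $B_\Omega(x,1)$, $x\in\Omega$,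 are bounded above and below by positive constants, and for every $x\in\Omega$, the following limit exists and the volume entropy is $h$: $$h_{vol}(\Omega)=\lim_{r\to\infty}\tfrac1r\log \mathrm{vol}(B_\Omega(x,r))=h;$$ (3) for every metric $d$ inducing the topology of $SM$, the topological entropy of the geodesic flow is $h$: $$h_{top}(\phi)=\lim_{\delta\to0}\ \liminf_{t\to\infty}\tfrac1t\log S(t,\delta)=\lim_{\delta\to0}\ \limsup_{t\to\infty}\tfrac1t\log S(t,\delta)=h,$$ where $S(t,\delta)$ is the least cardinality of a set that is $\delta$-dense in $SM$ for the Bowen metric $d_t(u,v)=\max_{0\le s\le t}d(\phi^su,\phi^sv)$. In particular $\delta_\Gamma=h_{vol}(\Omega)=h_{top}(\phi)$. -/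

import Mathlib

open Filter Topology MeasureTheory
open scoped LinearAlgebra.Projectivization Pointwise ENNReal NNReal

noncomputable section

namespace HilbertGeometry

/-! ### Real projective space and properly convex domains -/

/-- Real projective space `ℝℙⁿ`, the lines through the origin of `ℝⁿ⁺¹`. -/
abbrev RP (n : ℕ) : Type := ℙ ℝ (Fin (n + 1) → ℝ)

/-- `PSL(n+1, ℝ)`; Mathlib provides its action on `ℝℙⁿ` and its quotient topology. -/
abbrev PSL (n : ℕ) : Type := Matrix.ProjectiveSpecialLinearGroup (Fin (n + 1)) ℝ

/-- `SL(n+1, ℝ)`. -/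
abbrev SL (n : ℕ) : Type := Matrix.SpecialLinearGroup (Fin (n + 1)) ℝ

/-- `ℝℙⁿ` carries the quotient topology of `ℝⁿ⁺¹ ∖ {0}`. -/
instance instTopologicalSpaceRP (n : ℕ) : TopologicalSpace (RP n) :=
  TopologicalSpace.coinduced (Projectivization.mk' ℝ) inferInstance

/-- Borel σ-algebra of `ℝℙⁿ`. -/
instance instMeasurableSpaceRP (n : ℕ) : MeasurableSpace (RP n) := borel (RP n)

/-- The punctured cone in `ℝⁿ⁺¹` over a subset of `ℝℙⁿ`. -/
def coneOver {n : ℕ} (Ω : Set (RP n)) : Set (Fin (n + 1) → ℝ) :=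
  {w | ∃ hw : w ≠ 0, Projectivization.mk ℝ w hw ∈ Ω}

/-- A linear form `f` determines the affine chart `{[w] | f w ≠ 0}` of `ℝℙⁿ`, identified with the
affine hyperplane `{f = 1}` of `ℝⁿ⁺¹`. This is the part of `Ω` in this chart. -/
def affinePart {n : ℕ} (f : (Fin (n + 1) → ℝ) →ₗ[ℝ] ℝ) (Ω : Set (RP n)) :
    Set (Fin (n + 1) → ℝ) :=
  {x | f x = 1 ∧ x ∈ coneOver Ω}

/-- A properly convex domain of `ℝℙⁿ`: a nonempty open set which is contained, bounded and convex in
some affine chart. One such chart is part of the data. -/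
structure ProperlyConvexDomain (n : ℕ) where
  carrier : Set (RP n)
  chart : (Fin (n + 1) → ℝ) →ₗ[ℝ] ℝ
  nonempty : carrier.Nonempty
  isOpen : IsOpen carrier
  chart_ne_zero : ∀ w ∈ coneOver carrier, chart w ≠ 0
  isBounded : Bornology.IsBounded (affinePart chart carrier)
  convex : Convex ℝ (affinePart chart carrier)

variable {n : ℕ}

/-- The domain seen in its affine chart. -/
def ProperlyConvexDomain.body (Ω : ProperlyConvexDomain n) : Set (Fin (n + 1) → ℝ) :=
  affinePart Ω.chart Ω.carrier

/-- The coordinates of a point of `ℝℙⁿ` in the affine chart: its representative in `{f = 1}`. -/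
def ProperlyConvexDomain.coord (Ω : ProperlyConvexDomain n) (p : RP n) : Fin (n + 1) → ℝ :=
  (Ω.chart p.rep)⁻¹ • p.rep

/-- `Aut(Ω) = {g ∈ PSL(n+1, ℝ) | g Ω = Ω}`. -/
def ProperlyConvexDomain.Aut (Ω : ProperlyConvexDomain n) : Subgroup (PSL n) :=
  MulAction.stabilizer (PSL n) Ω.carrier

/-- `Γ` divides `Ω`: it is a discrete subgroup of `PSL(n+1, ℝ)` that preserves `Ω` and acts
cocompactly on it. -/
structure Divides (Γ : Subgroup (PSL n)) (Ω : ProperlyConvexDomain n) : Prop where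
  le_aut : Γ ≤ Ω.Aut
  discrete : DiscreteTopology Γ
  cocompact : ∃ K : Set (RP n), IsCompact K ∧ K ⊆ Ω.carrier ∧
    Ω.carrier ⊆ ⋃ γ ∈ Γ, γ • K

/-! ### The Hilbert metric -/

/-- For a subset `D` of a vector space, the supremum of the `t` with `x + t v ∈ D`. -/
def exitTime (D : Set (Fin (n + 1) → ℝ)) (x v : Fin (n + 1) → ℝ) : ℝ :=
  sSup {t : ℝ | x + t • v ∈ D}

/-- `v⁺`: for a point `x` of a bounded convex set `D` and a direction `v`, the point where the ray
from `x` in direction `v` meets the boundary of `D`. -/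
def exitPoint (D : Set (Fin (n + 1) → ℝ)) (x v : Fin (n + 1) → ℝ) : Fin (n + 1) → ℝ :=
  x + exitTime D x v • v

/-- Hilbert distance `½ |log [a,x,y,b]|` of two points of the affine chart, where `a`, `b` are the
boundary points of the line `xy` and `[a,x,y,b] = (|ay| |bx|) / (|ax| |by|)`. The ratios of lengths
along a line do not depend on the norm, and for `x = y` the value is `0`. -/
def affineHilbertDist (D : Set (Fin (n + 1) → ℝ)) (x y : Fin (n + 1) → ℝ) : ℝ :=
  let a := exitPoint D x (x - y)
  let b := exitPoint D y (y - x)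
  1 / 2 * |Real.log ((dist a y / dist a x) * (dist b x / dist b y))|

/-- The Hilbert distance `d_Ω` of points of `Ω`. -/
def ProperlyConvexDomain.hilbertDist (Ω : ProperlyConvexDomain n) (p q : RP n) : ℝ :=
  affineHilbertDist Ω.body (Ω.coord p) (Ω.coord q)

/-- The open metric ball `B_Ω(p, r)`. -/
def ProperlyConvexDomain.ball (Ω : ProperlyConvexDomain n) (p : RP n) (r : ℝ) : Set (RP n) :=
  {q ∈ Ω.carrier | Ω.hilbertDist p q < r}

/-! ### The critical exponent and the volume entropy -/

/-- `N_Γ(t) = #{γ ∈ Γ | d_Ω(p, γ p) ≤ t}`. -/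
def orbitCount (Ω : ProperlyConvexDomain n) (Γ : Subgroup (PSL n)) (p : RP n) (t : ℝ) : ℕ∞ :=
  Set.encard {γ : PSL n | γ ∈ Γ ∧ Ω.hilbertDist p (γ • p) ≤ t}

/-- The critical exponent `δ_Γ = limsup_{t → ∞} (1/t) log N_Γ(t)`, computed at the point `p`. -/
def criticalExponent (Ω : ProperlyConvexDomain n) (Γ : Subgroup (PSL n)) (p : RP n) : EReal :=
  limsup (fun t : ℝ => ENNReal.log (orbitCount Ω Γ p t : ℝ≥0∞) / (t : EReal)) atTop

/-- A uniform volume on `Ω`: the volumes of unit balls are bounded above and below by positive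
constants. -/
def IsUniformVolume (Ω : ProperlyConvexDomain n) (vol : Measure (RP n)) : Prop :=
  ∃ c C : ℝ≥0, 0 < c ∧ ∀ p ∈ Ω.carrier, (c : ℝ≥0∞) ≤ vol (Ω.ball p 1) ∧ vol (Ω.ball p 1) ≤ C

/-- `h = lim_{r → ∞} (1/r) log vol(B_Ω(p, r))`, the limit existing for every `p ∈ Ω`. -/
def HasVolumeEntropy (Ω : ProperlyConvexDomain n) (vol : Measure (RP n)) (h : EReal) : Prop :=
  ∀ p ∈ Ω.carrier,
    Tendsto (fun r : ℝ => ENNReal.log (vol (Ω.ball p r)) / (r : EReal)) atTop (𝓝 h)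

/-! ### Topological entropy of a flow -/

/-- The Bowen distance `d_t(u, v) = max_{0 ≤ s ≤ t} d(φˢ u, φˢ v)`. -/
def bowenDist {X : Type*} [MetricSpace X] (φ : ℝ → X → X) (t : ℝ) (u v : X) : ℝ :=
  sSup ((fun s => dist (φ s u) (φ s v)) '' Set.Icc 0 t)

/-- `S(t, δ)`: the minimal cardinality of a finite `(t, δ)`-spanning set (`⊤` if there is none). -/
def spanningNumber {X : Type*} [MetricSpace X] (φ : ℝ → X → X) (t δ : ℝ) : ℕ∞ :=
  ⨅ (E : Finset X) (_ : ∀ v : X, ∃ u ∈ E, bowenDist φ t u v < δ), (E.card : ℕ∞)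

/-- The flow `φ` on the metric space `X` has topological entropy
`h = lim_{δ → 0} lim_{t → ∞} (1/t) log S(t, δ)`. For fixed `δ` the inner limit is taken
both as a lower and as an upper limit. -/
def HasMetricEntropy {X : Type*} [MetricSpace X] (φ : ℝ → X → X) (h : EReal) : Prop :=
  Tendsto (fun δ : ℝ => liminf (fun t : ℝ =>
    ENNReal.log (spanningNumber φ t δ : ℝ≥0∞) / (t : EReal)) atTop) (𝓝[>] 0) (𝓝 h) ∧
  Tendsto (fun δ : ℝ => limsup (fun t : ℝ =>
    ENNReal.log (spanningNumber φ t δ : ℝ≥0∞) / (t : EReal)) atTop) (𝓝[>] 0) (𝓝 h)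

/-- The flow `φ` on the compact metrizable space `X` has topological entropy `h`, computed with any
metric that induces the topology. -/
def HasTopologicalEntropy {X : Type*} [τ : TopologicalSpace X] (φ : ℝ → X → X) (h : EReal) :
    Prop :=
  CompactSpace X ∧ TopologicalSpace.MetrizableSpace X ∧
  ∀ m : MetricSpace X, m.toPseudoMetricSpace.toUniformSpace.toTopologicalSpace = τ →
    HasMetricEntropy φ h

/-! ### The unit tangent bundle and the geodesic flow -/

/-- The Finsler norm of the tangent vector `v` at `x`, in the affine chart; it is the infinitesimal
form of the Hilbert metric. -/
def ProperlyConvexDomain.finsler (Ω : ProperlyConvexDomain n) (x v : Fin (n + 1) → ℝ) : ℝ :=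
  ‖v‖ / 2 * (1 / dist x (exitPoint Ω.body x v) + 1 / dist x (exitPoint Ω.body x (-v)))

/-- The Finsler unit tangent bundle `SΩ` in the affine chart: pairs `(x, v)` of a point and a tangent
vector (an element of `ker f`) of Finsler norm one. It has the subspace topology. -/
def ProperlyConvexDomain.unitTangent (Ω : ProperlyConvexDomain n) :
    Set ((Fin (n + 1) → ℝ) × (Fin (n + 1) → ℝ)) :=
  {p | p.1 ∈ Ω.body ∧ Ω.chart p.2 = 0 ∧ Ω.finsler p.1 p.2 = 1}

/-- The affine parameter `s` such that `x + s v` is the point at signed Hilbert distance `t` from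
`x` on the line through `x` with direction `v` (see `affineHilbertDist_geodesicParam`). -/
def ProperlyConvexDomain.geodesicParam (Ω : ProperlyConvexDomain n) (x v : Fin (n + 1) → ℝ)
    (t : ℝ) : ℝ :=
  (Real.exp (2 * t) - 1) /
    (1 / exitTime Ω.body x (-v) + Real.exp (2 * t) / exitTime Ω.body x v)

/-- `ℓ_v(t)`, the oriented projective line of `(x, v)` parameterized at unit Hilbert speed. -/
def ProperlyConvexDomain.geodesicLine (Ω : ProperlyConvexDomain n) (x v : Fin (n + 1) → ℝ)
    (t : ℝ) : Fin (n + 1) → ℝ :=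
  x + Ω.geodesicParam x v t • v

/-- The projective transformation `[g]` in the affine chart. -/
def ProperlyConvexDomain.chartMap (Ω : ProperlyConvexDomain n) (g : SL n)
    (x : Fin (n + 1) → ℝ) : Fin (n + 1) → ℝ :=
  (Ω.chart (g • x))⁻¹ • (g • x)

/-- `(y, w)` is the image of the tangent vector `(x, v)` under the derivative of an element of `Γ`. -/
def tangentRel (Ω : ProperlyConvexDomain n) (Γ : Subgroup (PSL n))
    (p q : (Fin (n + 1) → ℝ) × (Fin (n + 1) → ℝ)) : Prop :=
  ∃ g : SL n, (g : PSL n) ∈ Γ ∧ q.1 = Ω.chartMap g p.1 ∧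
    q.2 = lineDeriv ℝ (Ω.chartMap g) p.1 p.2


section Lemmas

variable (Ω : ProperlyConvexDomain n) {x v y w : Fin (n + 1) → ℝ}

lemma smul_mem_coneOver {S : Set (RP n)} {c : ℝ} (hc : c ≠ 0) (hw : w ∈ coneOver S) :
    c • w ∈ coneOver S := by
  obtain ⟨h0, h⟩ := hw
  refine ⟨smul_ne_zero hc h0, ?_⟩
  have : Projectivization.mk ℝ (c • w) (smul_ne_zero hc h0) = Projectivization.mk ℝ w h0 :=
    (Projectivization.mk_eq_mk_iff' ℝ _ _ _ _).2 ⟨c, rfl⟩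
  rwa [this]

lemma isOpen_coneOver {S : Set (RP n)} (hS : IsOpen S) : IsOpen (coneOver S) := by
  have h1 : IsOpen ((Projectivization.mk' ℝ : {v : Fin (n + 1) → ℝ // v ≠ 0} → RP n) ⁻¹' S) :=
    isOpen_coinduced.1 hS
  have h2 : coneOver S = Subtype.val ''
      ((Projectivization.mk' ℝ : {v : Fin (n + 1) → ℝ // v ≠ 0} → RP n) ⁻¹' S) := by
    ext u
    constructor
    · rintro ⟨h0, h⟩
      exact ⟨⟨u, h0⟩, h, rfl⟩
    · rintro ⟨⟨u, h0⟩, h, rfl⟩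
      exact ⟨h0, h⟩
  rw [h2]
  exact (isOpen_ne (x := (0 : Fin (n + 1) → ℝ))).isOpenMap_subtype_val _ h1

lemma mem_body_iff_of_cone (hw : w ∈ coneOver Ω.carrier) :
    (Ω.chart w)⁻¹ • w ∈ Ω.body := by
  have h := Ω.chart_ne_zero w hw
  exact ⟨by simp [h], smul_mem_coneOver (inv_ne_zero h) hw⟩

/-- A line through a point of the domain meets the domain in an open interval. -/
lemma line_mem_iff (hx : x ∈ Ω.body) (hv : Ω.chart v = 0) (hv0 : v ≠ 0) :
    0 < exitTime Ω.body x v ∧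
      ∀ t : ℝ, x + t • v ∈ Ω.body ↔
        -exitTime Ω.body x (-v) < t ∧ t < exitTime Ω.body x v := by
  set I : Set ℝ := {t : ℝ | x + t • v ∈ Ω.body} with hI
  have hchart : ∀ t : ℝ, Ω.chart (x + t • v) = 1 := by
    intro t; simp [hv, hx.1]
  have hopen : IsOpen I := by
    have : I = (fun t : ℝ => x + t • v) ⁻¹' coneOver Ω.carrier := by
      ext t
      exact ⟨fun h => h.2, fun h => ⟨hchart t, h⟩⟩
    rw [this]
    exact (isOpen_coneOver Ω.isOpen).preimage (by fun_prop)
  have h0 : (0 : ℝ) ∈ I := by simpa [hI] using hx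
  have hconv : Convex ℝ I := by
    have : I = (AffineMap.lineMap x (x + v) : ℝ →ᵃ[ℝ] (Fin (n + 1) → ℝ)) ⁻¹' Ω.body := by
      ext t
      simp [hI, AffineMap.lineMap_apply, add_comm]
    rw [this]
    exact Convex.affine_preimage _ Ω.convex
  obtain ⟨R, hR⟩ := Ω.isBounded.exists_norm_le
  have hvn : 0 < ‖v‖ := norm_pos_iff.2 hv0
  have hbd : ∀ t ∈ I, |t| ≤ (R + ‖x‖) / ‖v‖ := by
    intro t ht
    rw [le_div_iff₀ hvn, ← Real.norm_eq_abs, ← norm_smul]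
    have := hR _ ht
    calc ‖t • v‖ = ‖(x + t • v) - x‖ := by simp
      _ ≤ ‖x + t • v‖ + ‖x‖ := norm_sub_le _ _
      _ ≤ R + ‖x‖ := by linarith
  have hba : BddAbove I := ⟨_, fun t ht => (le_abs_self t).trans (hbd t ht)⟩
  have hbb : BddBelow I := ⟨-((R + ‖x‖) / ‖v‖), fun t ht => by
    have := neg_abs_le t
    linarith [hbd t ht]⟩
  have hT : exitTime Ω.body x v = sSup I := rfl
  have hT' : -exitTime Ω.body x (-v) = sInf I := by
    have : {t : ℝ | x + t • (-v) ∈ Ω.body} = -I := by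
      ext t; simp [hI]
    rw [exitTime, this, Real.sInf_def]
  have hIoo : I = Set.Ioo (sInf I) (sSup I) := by
    apply Set.Subset.antisymm
    · intro t ht
      constructor
      · obtain ⟨l, hl, hlI⟩ := exists_Ioc_subset_of_mem_nhds (hopen.mem_nhds ht) ⟨t - 1, by linarith⟩
        have := csInf_le hbb (hlI ⟨(by linarith : l < (l + t) / 2), by linarith⟩)
        linarith
      · obtain ⟨l, hl, hlI⟩ := exists_Ico_subset_of_mem_nhds (hopen.mem_nhds ht) ⟨t + 1, by linarith⟩
        have := le_csSup hba (hlI ⟨(by linarith : t ≤ (l + t) / 2), by linarith⟩)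
        linarith
    · rintro t ⟨h1, h2⟩
      obtain ⟨a, ha, hat⟩ := exists_lt_of_csInf_lt ⟨0, h0⟩ h1
      obtain ⟨b, hb, htb⟩ := exists_lt_of_lt_csSup ⟨0, h0⟩ h2
      exact hconv.ordConnected.out ha hb ⟨hat.le, htb.le⟩
  rw [hT, hT']
  refine ⟨?_, fun t => ?_⟩
  · rw [hIoo] at h0
    exact h0.2
  · change t ∈ I ↔ _
    conv_lhs => rw [hIoo]
    rfl

lemma exitTime_pos (hx : x ∈ Ω.body) (hv : Ω.chart v = 0) (hv0 : v ≠ 0) :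
    0 < exitTime Ω.body x v := (line_mem_iff Ω hx hv hv0).1

lemma exitTime_neg_pos (hx : x ∈ Ω.body) (hv : Ω.chart v = 0) (hv0 : v ≠ 0) :
    0 < exitTime Ω.body x (-v) :=
  exitTime_pos Ω hx (by simp [hv]) (by simpa using hv0)

lemma exitTime_smul (D : Set (Fin (n + 1) → ℝ)) {c : ℝ} (hc : 0 < c) :
    exitTime D x (c • v) = c⁻¹ * exitTime D x v := by
  have : {t : ℝ | x + t • c • v ∈ D} = c⁻¹ • {t : ℝ | x + t • v ∈ D} := by
    ext t
    rw [Set.mem_smul_set_iff_inv_smul_mem₀ (inv_ne_zero hc.ne')]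
    simp [smul_smul, mul_comm]
  rw [exitTime, this, Real.sSup_smul_of_nonneg (inv_nonneg.2 hc.le)]
  rfl

/-- The intervals cut out by a line, seen from another of its points. -/
lemma exitTime_add (hx : x ∈ Ω.body) (hv : Ω.chart v = 0) (hv0 : v ≠ 0) {s : ℝ}
    (hs : x + s • v ∈ Ω.body) :
    exitTime Ω.body (x + s • v) v = exitTime Ω.body x v - s ∧
      exitTime Ω.body (x + s • v) (-v) = exitTime Ω.body x (-v) + s := by
  have h1 := (line_mem_iff Ω hx hv hv0).2
  have hsI := (h1 s).1 hs
  constructor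
  · have : {t : ℝ | x + s • v + t • v ∈ Ω.body} =
        Set.Ioo (-exitTime Ω.body x (-v) - s) (exitTime Ω.body x v - s) := by
      ext t
      rw [Set.mem_ofPred_eq, add_assoc, ← add_smul, h1, Set.mem_Ioo]
      constructor <;> rintro ⟨a, b⟩ <;> constructor <;> linarith
    rw [exitTime, this, csSup_Ioo (by linarith)]
  · have : {t : ℝ | x + s • v + t • (-v) ∈ Ω.body} =
        Set.Ioo (s - exitTime Ω.body x v) (exitTime Ω.body x (-v) + s) := by
      ext t
      have : x + s • v + t • (-v) = x + (s - t) • v := by module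
      rw [Set.mem_ofPred_eq, this, h1, Set.mem_Ioo]
      constructor <;> rintro ⟨a, b⟩ <;> constructor <;> linarith
    rw [exitTime, this, csSup_Ioo (by linarith)]

lemma finsler_eq (hx : x ∈ Ω.body) (hv : Ω.chart v = 0) (hv0 : v ≠ 0) :
    Ω.finsler x v = 1 / 2 * (1 / exitTime Ω.body x v + 1 / exitTime Ω.body x (-v)) := by
  have h1 := exitTime_pos Ω hx hv hv0
  have h2 := exitTime_neg_pos Ω hx hv hv0
  have hvn : 0 < ‖v‖ := norm_pos_iff.2 hv0
  have hd : ∀ (T : ℝ) (u : Fin (n + 1) → ℝ), 0 < T → dist x (x + T • u) = T * ‖u‖ := by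
    intro T u hT
    rw [dist_eq_norm, sub_add_cancel_left, norm_neg, norm_smul, Real.norm_of_nonneg hT.le]
  rw [ProperlyConvexDomain.finsler, exitPoint, exitPoint, hd _ _ h1, hd _ _ h2, norm_neg]
  field_simp

lemma ne_zero_of_mem_unitTangent (h : (x, v) ∈ Ω.unitTangent) : v ≠ 0 := by
  rintro rfl
  have := h.2.2
  simp [ProperlyConvexDomain.finsler] at this

lemma finsler_pos (hx : x ∈ Ω.body) (hv : Ω.chart v = 0) (hv0 : v ≠ 0) :
    0 < Ω.finsler x v := by
  rw [finsler_eq Ω hx hv hv0]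
  have h1 := exitTime_pos Ω hx hv hv0
  have h2 := exitTime_neg_pos Ω hx hv hv0
  positivity

lemma finsler_smul (hx : x ∈ Ω.body) (hv : Ω.chart v = 0) (hv0 : v ≠ 0) {c : ℝ} (hc : 0 < c) :
    Ω.finsler x (c • v) = c * Ω.finsler x v := by
  rw [finsler_eq Ω hx hv hv0, finsler_eq Ω hx (by simp [hv]) (smul_ne_zero hc.ne' hv0),
    ← smul_neg, exitTime_smul _ hc, exitTime_smul _ hc]
  have h1 := exitTime_pos Ω hx hv hv0
  have h2 := exitTime_neg_pos Ω hx hv hv0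
  field_simp

lemma geodesicParam_mem (hx : x ∈ Ω.body) (hv : Ω.chart v = 0) (hv0 : v ≠ 0) (t : ℝ) :
    -exitTime Ω.body x (-v) < Ω.geodesicParam x v t ∧
      Ω.geodesicParam x v t < exitTime Ω.body x v := by
  have h1 := exitTime_pos Ω hx hv hv0
  have h2 := exitTime_neg_pos Ω hx hv hv0
  rw [ProperlyConvexDomain.geodesicParam]
  set a := exitTime Ω.body x v
  set b := exitTime Ω.body x (-v)
  have hE := Real.exp_pos (2 * t)
  set E := Real.exp (2 * t)
  have hp : 0 < 1 / b + E / a := by positivity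
  constructor
  · rw [lt_div_iff₀ hp]
    have : -b * (1 / b + E / a) = -1 - b * E / a := by field_simp; ring
    have : 0 < b * E / a := by positivity
    linarith
  · rw [div_lt_iff₀ hp]
    have : a * (1 / b + E / a) = a / b + E := by field_simp
    have : 0 < a / b := by positivity
    linarith

lemma geodesicLine_mem (hx : x ∈ Ω.body) (hv : Ω.chart v = 0) (hv0 : v ≠ 0) (t : ℝ) :
    Ω.geodesicLine x v t ∈ Ω.body :=
  ((line_mem_iff Ω hx hv hv0).2 _).2 (geodesicParam_mem Ω hx hv hv0 t)

lemma affineHilbertDist_line (hx : x ∈ Ω.body) (hv : Ω.chart v = 0) (hv0 : v ≠ 0) {s : ℝ}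
    (hs0 : 0 < s) (hs : s < exitTime Ω.body x v) :
    affineHilbertDist Ω.body x (x + s • v) = 1 / 2 * Real.log
      ((exitTime Ω.body x (-v) + s) / exitTime Ω.body x (-v) *
        (exitTime Ω.body x v / (exitTime Ω.body x v - s))) := by
  have h1 := exitTime_pos Ω hx hv hv0
  have h2 := exitTime_neg_pos Ω hx hv hv0
  have hmem : x + s • v ∈ Ω.body := ((line_mem_iff Ω hx hv hv0).2 s).2 ⟨by linarith, hs⟩
  have hadd := (exitTime_add Ω hx hv hv0 hmem).1
  have hvn : 0 < ‖v‖ := norm_pos_iff.2 hv0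
  have ha : exitPoint Ω.body x (x - (x + s • v)) = x - exitTime Ω.body x (-v) • v := by
    have : x - (x + s • v) = s • (-v) := by module
    rw [this, exitPoint, exitTime_smul _ hs0, smul_smul]
    have : s⁻¹ * exitTime Ω.body x (-v) * s = exitTime Ω.body x (-v) := by field_simp
    rw [this]
    module
  have hb : exitPoint Ω.body (x + s • v) (x + s • v - x) = x + exitTime Ω.body x v • v := by
    have : x + s • v - x = s • v := by module
    rw [this, exitPoint, exitTime_smul _ hs0, smul_smul, hadd]
    have : s⁻¹ * (exitTime Ω.body x v - s) * s = exitTime Ω.body x v - s := by field_simp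
    rw [this]
    module
  simp only [affineHilbertDist]
  rw [ha, hb]
  set a := exitTime Ω.body x v
  set b := exitTime Ω.body x (-v)
  have hd : ∀ (p q : Fin (n + 1) → ℝ) (T : ℝ), 0 < T → p - q = T • v → dist p q = T * ‖v‖ := by
    intro p q T hT h
    rw [dist_eq_norm, h, norm_smul, Real.norm_of_nonneg hT.le]
  have e1 : dist (x - b • v) (x + s • v) = (b + s) * ‖v‖ := by
    rw [dist_comm]; exact hd _ _ _ (by linarith) (by module)
  have e2 : dist (x - b • v) x = b * ‖v‖ := by
    rw [dist_comm]; exact hd _ _ _ h2 (by module)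
  have e3 : dist (x + a • v) x = a * ‖v‖ := hd _ _ _ h1 (by module)
  have e4 : dist (x + a • v) (x + s • v) = (a - s) * ‖v‖ := hd _ _ _ (by linarith) (by module)
  rw [e1, e2, e3, e4, mul_div_mul_right _ _ hvn.ne', mul_div_mul_right _ _ hvn.ne']
  rw [abs_of_nonneg]
  apply Real.log_nonneg
  have i1 : 1 ≤ (b + s) / b := by rw [le_div_iff₀ h2]; linarith
  have i2 : 1 ≤ a / (a - s) := by rw [le_div_iff₀ (by linarith)]; linarith
  nlinarith

/-- The parameterization `geodesicLine` has unit Hilbert speed. -/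
theorem affineHilbertDist_geodesicParam (hx : x ∈ Ω.body) (hv : Ω.chart v = 0) (hv0 : v ≠ 0)
    (t : ℝ) :
    affineHilbertDist Ω.body x (Ω.geodesicLine x v t) = |t| ∧
      (0 < t ↔ 0 < Ω.geodesicParam x v t) := by
  have key : ∀ (u : Fin (n + 1) → ℝ), Ω.chart u = 0 → u ≠ 0 → ∀ τ : ℝ, 0 < τ →
      0 < Ω.geodesicParam x u τ ∧ affineHilbertDist Ω.body x (Ω.geodesicLine x u τ) = τ := by
    intro u hu hu0 τ hτ
    have h1 := exitTime_pos Ω hx hu hu0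
    have h2 := exitTime_neg_pos Ω hx hu hu0
    have hE : 1 < Real.exp (2 * τ) := Real.one_lt_exp_iff.2 (by linarith)
    have hpos : 0 < Ω.geodesicParam x u τ := by
      rw [ProperlyConvexDomain.geodesicParam]
      apply div_pos <;> [linarith; positivity]
    refine ⟨hpos, ?_⟩
    have hlt := (geodesicParam_mem Ω hx hu hu0 τ).2
    rw [ProperlyConvexDomain.geodesicLine, affineHilbertDist_line Ω hx hu hu0 hpos hlt]
    have hval : ((exitTime Ω.body x (-u) + Ω.geodesicParam x u τ) / exitTime Ω.body x (-u) *
        (exitTime Ω.body x u / (exitTime Ω.body x u - Ω.geodesicParam x u τ)))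
          = Real.exp (2 * τ) := by
      have hlt' : exitTime Ω.body x u - Ω.geodesicParam x u τ ≠ 0 := by linarith
      rw [ProperlyConvexDomain.geodesicParam] at hlt' ⊢
      set a := exitTime Ω.body x u
      set b := exitTime Ω.body x (-u)
      set E := Real.exp (2 * τ)
      have hden : 0 < 1 / b + E / a := by positivity
      rw [div_mul_div_comm, div_eq_iff (mul_ne_zero h2.ne' hlt')]
      have hden' : a + b * E ≠ 0 := by positivity
      field_simp
      ring
    rw [hval, Real.log_exp]
    ring
  have hneg : Ω.geodesicLine x v t = Ω.geodesicLine x (-v) (-t) ∧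
      Ω.geodesicParam x (-v) (-t) = -Ω.geodesicParam x v t := by
    have h1 := exitTime_pos Ω hx hv hv0
    have h2 := exitTime_neg_pos Ω hx hv hv0
    have : Ω.geodesicParam x (-v) (-t) = -Ω.geodesicParam x v t := by
      simp only [ProperlyConvexDomain.geodesicParam, neg_neg]
      rw [show 2 * -t = -(2 * t) by ring, Real.exp_neg]
      have hE := Real.exp_pos (2 * t)
      set a := exitTime Ω.body x v
      set b := exitTime Ω.body x (-v)
      set E := Real.exp (2 * t)
      have hden : 0 < 1 / b + E / a := by positivity
      have hden' : 0 < 1 / a + E⁻¹ / b := by positivity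
      rw [← neg_div, div_eq_div_iff hden'.ne' hden.ne']
      field_simp
      ring
    refine ⟨?_, this⟩
    rw [ProperlyConvexDomain.geodesicLine, ProperlyConvexDomain.geodesicLine, this]
    module
  rcases lt_trichotomy t 0 with ht | ht | ht
  · have := key (-v) (by simp [hv]) (by simpa using hv0) (-t) (by linarith)
    rw [hneg.1, this.2, abs_of_neg ht]
    refine ⟨rfl, ?_⟩
    rw [hneg.2] at this
    constructor <;> intro h <;> linarith [this.1]
  · subst ht
    simp [ProperlyConvexDomain.geodesicLine, ProperlyConvexDomain.geodesicParam,
      affineHilbertDist, exitPoint]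
  · have := key v hv hv0 t ht
    rw [this.2, abs_of_pos ht]
    exact ⟨rfl, by simp [ht, this.1]⟩

variable {Ω}

lemma smul_mem_coneOver_of_aut {g : SL n} (hg : (g : PSL n) ∈ Ω.Aut)
    (hw : w ∈ coneOver Ω.carrier) : g • w ∈ coneOver Ω.carrier := by
  obtain ⟨h0, h⟩ := hw
  refine ⟨(smul_ne_zero_iff_ne g).2 h0, ?_⟩
  have h2 : (g : PSL n) • Ω.carrier = Ω.carrier := hg
  have h3 : (g : PSL n) • Projectivization.mk ℝ w h0 ∈ (g : PSL n) • Ω.carrier :=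
    Set.smul_mem_smul_set h
  rw [h2] at h3
  exact h3

lemma chart_smul_ne_zero {g : SL n} (hg : (g : PSL n) ∈ Ω.Aut) (hx : x ∈ Ω.body) :
    Ω.chart (g • x) ≠ 0 :=
  Ω.chart_ne_zero _ (smul_mem_coneOver_of_aut hg hx.2)

lemma chartMap_mem {g : SL n} (hg : (g : PSL n) ∈ Ω.Aut) (hx : x ∈ Ω.body) :
    Ω.chartMap g x ∈ Ω.body :=
  mem_body_iff_of_cone Ω (smul_mem_coneOver_of_aut hg hx.2)

lemma chartMap_mul {g h : SL n} (hx : Ω.chart (h • x) ≠ 0) :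
    Ω.chartMap g (Ω.chartMap h x) = Ω.chartMap (g * h) x := by
  simp only [ProperlyConvexDomain.chartMap]
  rw [smul_comm g, ← mul_smul, map_smul, smul_eq_mul, mul_inv, inv_inv, smul_smul, mul_right_comm,
    mul_inv_cancel₀ hx, one_mul]

lemma chartMap_one (hx : Ω.chart x = 1) : Ω.chartMap 1 x = x := by
  simp [ProperlyConvexDomain.chartMap, hx]

lemma smul_line (g : SL n) (x v : Fin (n + 1) → ℝ) (s : ℝ) :
    g • (x + s • v) = g • x + s • (g • v) := by
  rw [smul_add, smul_comm]

lemma smul_real (g : SL n) (c : ℝ) (u : Fin (n + 1) → ℝ) : g • (c • u) = c • (g • u) :=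
  smul_comm g c u

lemma chart_smul_line (g : SL n) (x v : Fin (n + 1) → ℝ) (s : ℝ) :
    Ω.chart (g • (x + s • v)) = Ω.chart (g • x) + s * Ω.chart (g • v) := by
  rw [smul_line, map_add, LinearMap.map_smul, smul_eq_mul]

/-- The derivative of a projective transformation in the affine chart. -/
lemma hasLineDerivAt_chartMap {g : SL n} (hx : Ω.chart (g • x) ≠ 0) (v : Fin (n + 1) → ℝ) :
    HasLineDerivAt ℝ (Ω.chartMap g) ((Ω.chart (g • x))⁻¹ • (g • v) -
      (Ω.chart (g • v) / Ω.chart (g • x)) • Ω.chartMap g x) x v := by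
  have h1 : HasDerivAt (fun t : ℝ => Ω.chart (g • x) + t * Ω.chart (g • v))
      (Ω.chart (g • v)) 0 := by
    simpa using ((hasDerivAt_id (0 : ℝ)).mul_const (Ω.chart (g • v))).const_add (Ω.chart (g • x))
  have h2 : HasDerivAt (fun t : ℝ => g • x + t • (g • v)) (g • v) 0 := by
    simpa using ((hasDerivAt_id (0 : ℝ)).smul_const (g • v)).const_add (g • x)
  have h3 := (h1.inv (by simpa using hx)).smul h2
  have h4 : (fun t : ℝ => Ω.chartMap g (x + t • v)) = fun t : ℝ =>
      (Ω.chart (g • x) + t * Ω.chart (g • v))⁻¹ • (g • x + t • (g • v)) := by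
    ext1 t
    rw [ProperlyConvexDomain.chartMap, chart_smul_line, smul_line]
  rw [HasLineDerivAt, h4]
  refine h3.congr_deriv ?_
  simp only [ProperlyConvexDomain.chartMap, zero_mul, add_zero, zero_smul, smul_smul,
    Pi.inv_apply]
  rw [sub_eq_add_neg, ← neg_smul]
  congr 2
  field_simp

lemma lineDeriv_chartMap {g : SL n} (hx : Ω.chart (g • x) ≠ 0) (v : Fin (n + 1) → ℝ) :
    lineDeriv ℝ (Ω.chartMap g) x v = (Ω.chart (g • x))⁻¹ • (g • v) -
      (Ω.chart (g • v) / Ω.chart (g • x)) • Ω.chartMap g x :=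
  (hasLineDerivAt_chartMap hx v).lineDeriv

lemma chart_lineDeriv {g : SL n} (hx : Ω.chart (g • x) ≠ 0) (v : Fin (n + 1) → ℝ) :
    Ω.chart (lineDeriv ℝ (Ω.chartMap g) x v) = 0 := by
  rw [lineDeriv_chartMap hx]
  simp [ProperlyConvexDomain.chartMap, hx]
  field_simp
  simp

lemma lineDeriv_mul {g h : SL n} (hx : Ω.chart (h • x) ≠ 0) (hgx : Ω.chart ((g * h) • x) ≠ 0)
    (v : Fin (n + 1) → ℝ) :
    lineDeriv ℝ (Ω.chartMap g) (Ω.chartMap h x) (lineDeriv ℝ (Ω.chartMap h) x v) =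
      lineDeriv ℝ (Ω.chartMap (g * h)) x v := by
  have hgx' : Ω.chart (g • Ω.chartMap h x) ≠ 0 := by
    simp only [ProperlyConvexDomain.chartMap]
    rw [smul_comm, ← mul_smul]
    simp [hx, hgx]
  rw [lineDeriv_chartMap hgx, lineDeriv_chartMap hgx', chartMap_mul hx, lineDeriv_chartMap hx]
  have e1 : g • Ω.chartMap h x = (Ω.chart (h • x))⁻¹ • ((g * h) • x) := by
    rw [ProperlyConvexDomain.chartMap, smul_comm, ← mul_smul]
  have e2 : g • ((Ω.chart (h • x))⁻¹ • (h • v) -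
      (Ω.chart (h • v) / Ω.chart (h • x)) • Ω.chartMap h x) =
      (Ω.chart (h • x))⁻¹ • ((g * h) • v) -
        (Ω.chart (h • v) / Ω.chart (h • x)) • (Ω.chart (h • x))⁻¹ • ((g * h) • x) := by
    rw [smul_sub, smul_real, smul_real, e1, ← mul_smul]
  rw [e2, e1]
  have e3 : Ω.chartMap (g * h) x = (Ω.chart ((g * h) • x))⁻¹ • ((g * h) • x) := rfl
  rw [e3]
  simp only [map_sub, map_smul, smul_eq_mul]
  set A := Ω.chart (h • x)
  set B := Ω.chart ((g * h) • x)
  set C := Ω.chart ((g * h) • v)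
  set D := Ω.chart (h • v)
  simp only [smul_sub, smul_smul]
  rw [sub_sub, ← add_smul]
  congr 2
  · field_simp
  · field_simp
    ring

lemma tangentRel_refl {Γ : Subgroup (PSL n)}
    {p : (Fin (n + 1) → ℝ) × (Fin (n + 1) → ℝ)} (hp : p ∈ Ω.unitTangent) : tangentRel Ω Γ p p := by
  have h1 : Ω.chart p.1 = 1 := hp.1.1
  refine ⟨1, one_mem Γ, (chartMap_one h1).symm, ?_⟩
  rw [lineDeriv_chartMap (by simp [h1])]
  simp [h1, hp.2.1]

lemma tangentRel_symm {Γ : Subgroup (PSL n)} {p q : (Fin (n + 1) → ℝ) × (Fin (n + 1) → ℝ)}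
    (hp : p ∈ Ω.unitTangent) (hq : q ∈ Ω.unitTangent) (h : tangentRel Ω Γ p q) :
    tangentRel Ω Γ q p := by
  obtain ⟨g, hg, h1, h2⟩ := h
  have hx1 : Ω.chart p.1 = 1 := hp.1.1
  have hgx : Ω.chart (g • p.1) ≠ 0 := by
    intro h0
    have := hq.1.1
    rw [h1] at this
    simp [ProperlyConvexDomain.chartMap, h0] at this
  refine ⟨g⁻¹, inv_mem hg, ?_, ?_⟩
  · rw [h1, chartMap_mul hgx, inv_mul_cancel, chartMap_one hx1]
  · rw [h1, h2, lineDeriv_mul hgx (by simp [hx1]), inv_mul_cancel,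
      lineDeriv_chartMap (by simp [hx1])]
    simp [hx1, hp.2.1]

lemma tangentRel_trans {Γ : Subgroup (PSL n)} {p q r : (Fin (n + 1) → ℝ) × (Fin (n + 1) → ℝ)}
    (hq : q ∈ Ω.unitTangent) (hr : r ∈ Ω.unitTangent)
    (h : tangentRel Ω Γ p q) (h' : tangentRel Ω Γ q r) : tangentRel Ω Γ p r := by
  obtain ⟨g, hg, h1, h2⟩ := h
  obtain ⟨k, hk, h3, h4⟩ := h'
  have aux : ∀ (k : SL n) (u : Fin (n + 1) → ℝ), Ω.chart (Ω.chartMap k u) = 1 →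
      Ω.chart (k • u) ≠ 0 := by
    intro k u hu h0
    simp [ProperlyConvexDomain.chartMap, h0] at hu
  have hgx : Ω.chart (g • p.1) ≠ 0 := aux _ _ (h1 ▸ hq.1.1)
  rw [h1, chartMap_mul hgx] at h3
  have hkx : Ω.chart ((k * g) • p.1) ≠ 0 := aux _ _ (h3 ▸ hr.1.1)
  exact ⟨k * g, mul_mem hk hg, h3, by rw [h4, h1, h2, lineDeriv_mul hgx hkx]⟩

/-- Projective transformations map lines to lines, by a fractional linear change of parameter. -/
lemma chartMap_line {g : SL n} (hg : (g : PSL n) ∈ Ω.Aut) (hx : x ∈ Ω.body) (hv : Ω.chart v = 0)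
    (hv0 : v ≠ 0) {s : ℝ} (hs : x + s • v ∈ Ω.body) :
    0 < 1 + s * (Ω.chart (g • v) / Ω.chart (g • x)) ∧
    Ω.chartMap g (x + s • v) = Ω.chartMap g x +
      (s / (1 + s * (Ω.chart (g • v) / Ω.chart (g • x)))) • lineDeriv ℝ (Ω.chartMap g) x v := by
  have hgx := chart_smul_ne_zero hg hx
  have hgs : ∀ t : ℝ, Ω.chart (g • (x + t • v)) =
      Ω.chart (g • x) * (1 + t * (Ω.chart (g • v) / Ω.chart (g • x))) := by
    intro t
    rw [chart_smul_line]
    field_simp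
  set m := Ω.chart (g • v) / Ω.chart (g • x) with hm
  have hpos : 0 < 1 + s * m := by
    by_contra hle
    have hsm : s * m ≤ -1 := by linarith
    have hm0 : m ≠ 0 := by rintro h; rw [h] at hsm; linarith
    have hl := (line_mem_iff Ω hx hv hv0).2
    have hI := (hl s).1 hs
    have hbp := exitTime_neg_pos Ω hx hv hv0
    have hap := exitTime_pos Ω hx hv hv0
    have hmem : x + (-m⁻¹) • v ∈ Ω.body := by
      rw [hl]
      rcases lt_or_gt_of_ne hm0 with h | h
      · have h1 : 0 < -m⁻¹ := by simpa using h
        have h2 : -m⁻¹ ≤ s := by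
          have : (-m⁻¹) * (-m) ≤ s * (-m) := by
            rw [neg_mul_neg, inv_mul_cancel₀ hm0]; linarith
          exact le_of_mul_le_mul_right this (by linarith)
        constructor <;> linarith
      · have h1 : -m⁻¹ < 0 := by simpa using h
        have h2 : s ≤ -m⁻¹ := by
          have : s * m ≤ (-m⁻¹) * m := by
            rw [neg_mul, inv_mul_cancel₀ hm0]; linarith
          exact le_of_mul_le_mul_right this h
        constructor <;> linarith
    have := chart_smul_ne_zero hg hmem
    rw [hgs, neg_mul, inv_mul_cancel₀ hm0] at this
    simp at this
  refine ⟨hpos, ?_⟩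
  rw [lineDeriv_chartMap hgx, ← hm]
  rw [ProperlyConvexDomain.chartMap, hgs, smul_line, ProperlyConvexDomain.chartMap]
  simp only [smul_sub, smul_add, smul_smul]
  rw [add_sub_assoc', add_sub_right_comm, ← sub_smul]
  congr 2
  · field_simp
    ring
  · field_simp

lemma lineDeriv_ne_zero {g : SL n} (hg : (g : PSL n) ∈ Ω.Aut) (hx : x ∈ Ω.body)
    (hv : Ω.chart v = 0) (hv0 : v ≠ 0) : lineDeriv ℝ (Ω.chartMap g) x v ≠ 0 := by
  have hgx := chart_smul_ne_zero hg hx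
  intro h0
  have h1 := lineDeriv_mul (g := g⁻¹) hgx (by simp [hx.1]) v
  rw [h0, inv_mul_cancel, lineDeriv_zero, lineDeriv_chartMap (by simp [hx.1])] at h1
  simp [hv, hx.1] at h1
  exact hv0 h1.symm

lemma exitTime_lineDeriv_le {g : SL n} (hg : (g : PSL n) ∈ Ω.Aut) (hx : x ∈ Ω.body)
    (hv : Ω.chart v = 0) (hv0 : v ≠ 0) :
    1 / exitTime Ω.body (Ω.chartMap g x) (lineDeriv ℝ (Ω.chartMap g) x v) ≤
      1 / exitTime Ω.body x v + Ω.chart (g • v) / Ω.chart (g • x) := by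
  have hgx := chart_smul_ne_zero hg hx
  have hx' := chartMap_mem hg hx
  have hv' := chart_lineDeriv hgx v
  have hv0' := lineDeriv_ne_zero hg hx hv hv0
  have ha := exitTime_pos Ω hx hv hv0
  have hb := exitTime_neg_pos Ω hx hv hv0
  have ha' := exitTime_pos Ω hx' hv' hv0'
  have hl := (line_mem_iff Ω hx hv hv0).2
  have hl' := (line_mem_iff Ω hx' hv' hv0').2
  have hcl := fun (s : ℝ) (hs : x + s • v ∈ Ω.body) => chartMap_line hg hx hv hv0 hs
  have hmm := fun (s : ℝ) (hs : x + s • v ∈ Ω.body) => chartMap_mem hg hs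
  set m := Ω.chart (g • v) / Ω.chart (g • x)
  set v' := lineDeriv ℝ (Ω.chartMap g) x v
  set x' := Ω.chartMap g x
  set a := exitTime Ω.body x v
  set a' := exitTime Ω.body x' v'
  by_contra hlt
  push Not at hlt
  have hd : 0 < 1 / a' - m := by
    have : 0 < 1 / a := by positivity
    linarith
  set s := 1 / (1 / a' - m) with hs
  have hs0 : 0 < s := by positivity
  have hsa : s < a := by
    rw [hs, div_lt_iff₀ hd]
    have : a * (1 / a) = 1 := by field_simp
    nlinarith
  have hmem : x + s • v ∈ Ω.body := (hl s).2 ⟨by linarith, hsa⟩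
  obtain ⟨h1, h2⟩ := hcl s hmem
  have h3 := hmm s hmem
  rw [h2, hl'] at h3
  have h4 := h3.2
  rw [div_lt_iff₀ h1] at h4
  have h5 : s * (1 / a' - m) = 1 := by rw [hs]; exact one_div_mul_cancel hd.ne'
  have h6 : a' * (1 + s * m) = a' * (s / a') := by
    congr 1
    linear_combination -h5
  rw [h6] at h4
  have : a' * (s / a') = s := by field_simp
  linarith

lemma exitTime_lineDeriv {g : SL n} (hg : (g : PSL n) ∈ Ω.Aut) (hx : x ∈ Ω.body)
    (hv : Ω.chart v = 0) (hv0 : v ≠ 0) :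
    1 / exitTime Ω.body (Ω.chartMap g x) (lineDeriv ℝ (Ω.chartMap g) x v) =
      1 / exitTime Ω.body x v + Ω.chart (g • v) / Ω.chart (g • x) := by
  have hgx := chart_smul_ne_zero hg hx
  apply le_antisymm (exitTime_lineDeriv_le hg hx hv hv0)
  have h := exitTime_lineDeriv_le (g := g⁻¹) (inv_mem hg) (chartMap_mem hg hx)
    (chart_lineDeriv hgx v) (lineDeriv_ne_zero hg hx hv hv0)
  rw [lineDeriv_mul hgx (by simp [hx.1]), chartMap_mul hgx, inv_mul_cancel, chartMap_one hx.1,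
    lineDeriv_chartMap (g := 1) (by simp [hx.1])] at h
  have e1 : g⁻¹ • Ω.chartMap g x = (Ω.chart (g • x))⁻¹ • x := by
    rw [ProperlyConvexDomain.chartMap, smul_comm, inv_smul_smul]
  have e2 : Ω.chart (g⁻¹ • lineDeriv ℝ (Ω.chartMap g) x v) /
      Ω.chart (g⁻¹ • Ω.chartMap g x) = -(Ω.chart (g • v) / Ω.chart (g • x)) := by
    rw [lineDeriv_chartMap hgx, smul_sub, smul_real, smul_real, e1, inv_smul_smul]
    simp only [map_sub, map_smul, smul_eq_mul, hv, hx.1]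
    field_simp
    ring
  rw [e2] at h
  simp only [one_smul, hx.1, hv, inv_one, zero_div, zero_smul, sub_zero] at h
  linarith

lemma exitTime_neg_lineDeriv {g : SL n} (hg : (g : PSL n) ∈ Ω.Aut) (hx : x ∈ Ω.body)
    (hv : Ω.chart v = 0) (hv0 : v ≠ 0) :
    1 / exitTime Ω.body (Ω.chartMap g x) (-lineDeriv ℝ (Ω.chartMap g) x v) =
      1 / exitTime Ω.body x (-v) - Ω.chart (g • v) / Ω.chart (g • x) := by
  have h := exitTime_lineDeriv hg hx (v := -v) (by simp [hv]) (by simpa using hv0)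
  have : lineDeriv ℝ (Ω.chartMap g) x (-v) = -lineDeriv ℝ (Ω.chartMap g) x v := lineDeriv_neg
  rw [this, smul_neg, map_neg, neg_div] at h
  linarith

/-- Automorphisms of the domain preserve the Finsler norm. -/
lemma finsler_lineDeriv {g : SL n} (hg : (g : PSL n) ∈ Ω.Aut) (hx : x ∈ Ω.body)
    (hv : Ω.chart v = 0) (hv0 : v ≠ 0) :
    Ω.finsler (Ω.chartMap g x) (lineDeriv ℝ (Ω.chartMap g) x v) = Ω.finsler x v := by
  rw [finsler_eq Ω hx hv hv0, finsler_eq Ω (chartMap_mem hg hx)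
    (chart_lineDeriv (chart_smul_ne_zero hg hx) v) (lineDeriv_ne_zero hg hx hv hv0),
    exitTime_lineDeriv hg hx hv hv0, exitTime_neg_lineDeriv hg hx hv hv0]
  ring

/-- Automorphisms of the domain map unit speed lines to unit speed lines. -/
lemma geodesicLine_equivariant {g : SL n} (hg : (g : PSL n) ∈ Ω.Aut) (hx : x ∈ Ω.body)
    (hv : Ω.chart v = 0) (hv0 : v ≠ 0) (t : ℝ) :
    Ω.geodesicLine (Ω.chartMap g x) (lineDeriv ℝ (Ω.chartMap g) x v) t =
      Ω.chartMap g (Ω.geodesicLine x v t) := by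
  obtain ⟨hp, h⟩ := chartMap_line hg hx hv hv0 (geodesicLine_mem Ω hx hv hv0 t)
  have e1 := exitTime_lineDeriv hg hx hv hv0
  have e2 := exitTime_neg_lineDeriv hg hx hv hv0
  have ha := exitTime_pos Ω hx hv hv0
  have hb := exitTime_neg_pos Ω hx hv hv0
  rw [ProperlyConvexDomain.geodesicLine, ProperlyConvexDomain.geodesicLine, h]
  congr 2
  simp only [ProperlyConvexDomain.geodesicParam] at hp ⊢
  rw [div_eq_mul_one_div (Real.exp (2 * t)), e1, e2]
  have hE := Real.exp_pos (2 * t)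
  set m := Ω.chart (g • v) / Ω.chart (g • x)
  set a := exitTime Ω.body x v
  set b := exitTime Ω.body x (-v)
  set E := Real.exp (2 * t)
  have hden : 0 < 1 / b + E / a := by positivity
  have e3 : 1 / b - m + E * (1 / a + m) =
      (1 / b + E / a) * (1 + (E - 1) / (1 / b + E / a) * m) := by
    field_simp
    ring
  rw [e3, div_mul_eq_div_div]

end Lemmas

variable (Ω : ProperlyConvexDomain n) (Γ : Subgroup (PSL n))

/-- The geodesic flow of `SΩ`: `φᵗ(x, v)` is the Finsler unit tangent vector to `ℓ_v` at
`ℓ_v(t)`. -/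
def geodesicFlowDomain (t : ℝ) (p : Ω.unitTangent) : Ω.unitTangent :=
  ⟨(Ω.geodesicLine p.1.1 p.1.2 t,
    (Ω.finsler (Ω.geodesicLine p.1.1 p.1.2 t) p.1.2)⁻¹ • p.1.2), by
    obtain ⟨⟨x, v⟩, hp⟩ := p
    have hv0 := ne_zero_of_mem_unitTangent Ω hp
    have hmem := geodesicLine_mem Ω hp.1 hp.2.1 hv0 t
    have hF := finsler_pos Ω hmem hp.2.1 hv0
    refine ⟨hmem, by simpa using Or.inr hp.2.1, ?_⟩
    change Ω.finsler _ (_ • v) = 1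
    rw [finsler_smul Ω hmem hp.2.1 hv0 (inv_pos.2 hF), inv_mul_cancel₀ hF.ne']⟩

/-- The identification of unit tangent vectors that differ by an element of `Γ`. -/
def unitTangentSetoid : Setoid Ω.unitTangent where
  r p q := tangentRel Ω Γ p q
  iseqv := ⟨fun p => tangentRel_refl p.2, fun {p q} h => tangentRel_symm p.2 q.2 h,
    fun {_ q r} h h' => tangentRel_trans q.2 r.2 h h'⟩

/-- The unit tangent bundle `SM = SΩ / Γ` of the quotient `M = Ω / Γ`. -/
def UnitTangentBundle : Type := Quotient (unitTangentSetoid Ω Γ)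

/-- `SM` carries the quotient topology. -/
instance : TopologicalSpace (UnitTangentBundle Ω Γ) :=
  inferInstanceAs (TopologicalSpace (Quotient (unitTangentSetoid Ω Γ)))

variable {Ω Γ}

lemma geodesicFlowDomain_equivariant (hΓ : Γ ≤ Ω.Aut) (t : ℝ) {p q : Ω.unitTangent}
    (h : tangentRel Ω Γ p q) :
    tangentRel Ω Γ (geodesicFlowDomain Ω t p) (geodesicFlowDomain Ω t q) := by
  obtain ⟨⟨x, v⟩, hp⟩ := p
  obtain ⟨⟨x', v'⟩, hq⟩ := q
  obtain ⟨g, hgΓ, h1, h2⟩ := h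
  have hg := hΓ hgΓ
  simp only at h1 h2
  subst h1 h2
  have hv0 := ne_zero_of_mem_unitTangent Ω hp
  have hx : x ∈ Ω.body := hp.1
  have hv : Ω.chart v = 0 := hp.2.1
  have hy := geodesicLine_mem Ω hx hv hv0 t
  refine ⟨g, hgΓ, geodesicLine_equivariant hg hx hv hv0 t, ?_⟩
  simp only [geodesicFlowDomain]
  rw [geodesicLine_equivariant hg hx hv hv0 t]
  have hgx := chart_smul_ne_zero hg hx
  obtain ⟨hpos, hline⟩ := chartMap_line hg hx hv hv0 hy
  have hgy := chart_smul_ne_zero hg hy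
  have hF := finsler_lineDeriv hg hy hv hv0
  have hgy' : Ω.chart (g • Ω.geodesicLine x v t) = Ω.chart (g • x) *
      (1 + Ω.geodesicParam x v t * (Ω.chart (g • v) / Ω.chart (g • x))) := by
    rw [ProperlyConvexDomain.geodesicLine, chart_smul_line]
    field_simp
  -- the two derivatives are positively proportional
  have hprop : lineDeriv ℝ (Ω.chartMap g) (Ω.geodesicLine x v t) v =
      (((1 + Ω.geodesicParam x v t * (Ω.chart (g • v) / Ω.chart (g • x))) ^ 2)⁻¹) •
        lineDeriv ℝ (Ω.chartMap g) x v := by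
    have hline' : Ω.chartMap g (Ω.geodesicLine x v t) = _ := hline
    rw [lineDeriv_chartMap hgy, hline', hgy', lineDeriv_chartMap hgx]
    rw [ProperlyConvexDomain.chartMap]
    clear hline' hline hF hq hgy hgy'
    set m := Ω.chart (g • v) / Ω.chart (g • x) with hm
    have hm' : Ω.chart (g • v) = m * Ω.chart (g • x) := by rw [hm]; field_simp
    rw [hm']
    set s := Ω.geodesicParam x v t
    set A := Ω.chart (g • x)
    have hk : (1 + s * m) ≠ 0 := hpos.ne'
    clear_value A m s
    generalize g • x = X
    generalize g • v = W
    have hk' : (1 + m * s) ≠ 0 := by rwa [mul_comm]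
    match_scalars <;> field_simp <;> ring_nf
  set c := ((1 + Ω.geodesicParam x v t * (Ω.chart (g • v) / Ω.chart (g • x))) ^ 2)⁻¹
  have hc : 0 < c := by positivity
  rw [hprop, finsler_smul Ω (chartMap_mem hg hy) (chart_lineDeriv hgx v)
    (lineDeriv_ne_zero hg hx hv hv0) hc] at hF
  rw [lineDeriv_smul, hprop, smul_smul, ← hF]
  congr 1
  have hF' := finsler_pos Ω (chartMap_mem hg hy) (chart_lineDeriv hgx v)
    (lineDeriv_ne_zero hg hx hv hv0)
  field_simp

variable (Γ) in
/-- The geodesic flow of `SM`. -/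
def geodesicFlow (hΓ : Γ ≤ Ω.Aut) (t : ℝ) : UnitTangentBundle Ω Γ → UnitTangentBundle Ω Γ :=
  Quotient.map' (s₁ := unitTangentSetoid Ω Γ) (s₂ := unitTangentSetoid Ω Γ)
    (geodesicFlowDomain Ω t) fun _ _ h => geodesicFlowDomain_equivariant hΓ t h

end HilbertGeometry

end

noncomputable section

namespace HilbertGeometry

/-! ### Growth of orbits of cobounded isometric actions -/

/-! All three quantities are compared with the orbit growth N(t) = #{γ ∈ Γ | d(o, γo) ≤ t}. Cutting
a segment from o to γo at distance s and replacing the cut point by an orbit point within c gives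
N(s + t) ≤ N(s + c) N(t + c). Fekete's lemma then makes log N(t) / t converge to some h
(`exists_tendsto_log_orbitGrowth`), and moving the base point only shifts t. This settles the
critical exponent. For the volume, B(o, r) is covered by C · N(r + c) unit balls
(`exists_volume_le`), and it contains N(r - 1) unit balls of bounded multiplicity
(`exists_le_volume`).

Upper bound for the entropy: a vector of SM lifts to a line starting near o. Two lines that are
close at both ends of a time interval are close in between (`LineSystem.dist_le`), so up to ε the
line is determined on [0, t + 1] by an orbit element near its end and two labels from a finite net.
Hence S(t, δ) ≤ C · N(t + c) (`spanningNumber_le`).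

Lower bound: the segment from o to γo projects to an orbit piece shadowed by some z in a spanning
set E. Upstairs the shadowing is recorded by group elements α_j at the times jL. Given α_j there are
at most K choices for α_{j+1}, with K independent of L, so N(t) ≤ |E| · C · K^(t/L + 1)
(`orbitGrowth_le_card`). The loss log K / L disappears as L grows. Neither expansivity nor freeness
of the action is used.

The geometric input comes from the order defined by the cone over Ω: with M(x/y) = inf {c | x < c y}
the Hilbert distance is ½ log M(x/y) M(y/x) (`affineHilbertDist_eq`). This gives the metric axioms,
properness, and the monotone divergence of lines with a common origin (`dist_unitLine_mono`), which
needs no strict convexity of Ω. Orbit counts are finite because automorphisms moving a point by a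
bounded amount have bounded matrix entries (`exists_abs_entry_le_of_dist_le`), while Γ is discrete.
-/

lemma tendsto_div_comp_add {f : ℝ → ℝ} {h : ℝ} (hf : Tendsto (fun t => f t / t) atTop (𝓝 h))
    (c : ℝ) : Tendsto (fun t => f (t + c) / t) atTop (𝓝 h) := by
  have h1 : Tendsto (fun t : ℝ => f (t + c) / (t + c)) atTop (𝓝 h) :=
    hf.comp (tendsto_atTop_add_const_right _ c tendsto_id)
  have h2 : Tendsto (fun t : ℝ => 1 + c / t) atTop (𝓝 (1 + 0)) :=
    tendsto_const_nhds.add (tendsto_const_nhds.div_atTop tendsto_id)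
  have h3 := h1.mul h2
  rw [add_zero, mul_one] at h3
  refine h3.congr' ?_
  filter_upwards [eventually_gt_atTop 0, eventually_gt_atTop (-c)] with t ht htc
  have : t + c ≠ 0 := by linarith
  field_simp

/-- Fekete's lemma for nondecreasing functions of a real variable. -/
lemma exists_tendsto_div_of_subadditive {a : ℝ → ℝ} (hmono : Monotone a) (h0 : ∀ t, 0 ≤ a t)
    (hsub : ∀ s t, 0 ≤ s → 0 ≤ t → a (s + t) ≤ a s + a t) :
    ∃ h : ℝ, Tendsto (fun t => a t / t) atTop (𝓝 h) := by
  have hS : Subadditive (fun k : ℕ => a k) := by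
    intro j k
    simpa using hsub j k (Nat.cast_nonneg _) (Nat.cast_nonneg _)
  have hb : BddBelow (Set.range fun k : ℕ => a k / k) := by
    refine ⟨0, ?_⟩
    rintro _ ⟨k, rfl⟩
    exact div_nonneg (h0 _) (Nat.cast_nonneg _)
  have hlim := hS.tendsto_lim hb
  refine ⟨hS.lim, ?_⟩
  -- Monotonicity squeezes `a t` between its values at the integers around `t`, to which the
  -- discrete lemma applies.
  have hfl : Tendsto (fun t : ℝ => a ⌊t⌋₊ / t) atTop (𝓝 hS.lim) := by
    have h1 := (hlim.comp tendsto_nat_floor_atTop).mul (tendsto_nat_floor_div_atTop (R := ℝ))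
    rw [mul_one] at h1
    refine h1.congr' ?_
    filter_upwards [eventually_ge_atTop 1] with t ht
    have : (0 : ℝ) < ⌊t⌋₊ := Nat.cast_pos.2 (Nat.floor_pos.2 ht)
    simp only [Function.comp]
    field_simp
  have hce : Tendsto (fun t : ℝ => a ⌈t⌉₊ / t) atTop (𝓝 hS.lim) := by
    have h1 := (hlim.comp tendsto_nat_ceil_atTop).mul (tendsto_nat_ceil_div_atTop (R := ℝ))
    rw [mul_one] at h1
    refine h1.congr' ?_
    filter_upwards [eventually_ge_atTop 1] with t ht
    have : (0 : ℝ) < ⌈t⌉₊ := Nat.cast_pos.2 (Nat.ceil_pos.2 (by linarith))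
    simp only [Function.comp]
    field_simp
  refine tendsto_of_tendsto_of_tendsto_of_le_of_le' hfl hce ?_ ?_
  · filter_upwards [eventually_ge_atTop 1] with t ht
    have := hmono (Nat.floor_le (by linarith : 0 ≤ t))
    gcongr
  · filter_upwards [eventually_ge_atTop 1] with t ht
    have := hmono (Nat.le_ceil t)
    gcongr

section Growth

variable (G : Type*) {X : Type*} [Group G] [PseudoMetricSpace X] [MulAction G X]

/-- The number of group elements that move `o` by at most `t`. -/
def orbitGrowth (o : X) (t : ℝ) : ℕ := {g : G | dist o (g • o) ≤ t}.ncard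

/-- A group acts with finite orbit counts and cobounded orbits on a space in which any two points
are joined by a geodesic. -/
structure IsGeometricAction (X : Type*) [PseudoMetricSpace X] [MulAction G X] : Prop where
  finite_orbit : ∀ (o : X) (r : ℝ), {g : G | dist o (g • o) ≤ r}.Finite
  cobounded : ∀ o : X, ∃ c : ℝ, 0 ≤ c ∧ ∀ y : X, ∃ g : G, dist (g • o) y ≤ c
  geodesic : ∀ (x y : X) (t : ℝ), 0 ≤ t → t ≤ dist x y →
    ∃ z : X, dist x z = t ∧ dist z y = dist x y - t

variable {G}

lemma dist_smul_inv_smul [IsIsometricSMul G X] (g k : G) (o : X) : dist o ((g⁻¹ * k) • o) = dist (g • o) (k • o) := by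
  rw [mul_smul, ← dist_smul g o, smul_inv_smul]

namespace IsGeometricAction

variable (hG : IsGeometricAction G X) (o : X)
include hG

lemma orbitGrowth_mono : Monotone (orbitGrowth G o) := fun _ t hst =>
  Set.ncard_le_ncard (fun _ hg => le_trans hg hst) (hG.finite_orbit o t)

lemma one_le_orbitGrowth {t : ℝ} (ht : 0 ≤ t) : 1 ≤ orbitGrowth G o t :=
  (Set.ncard_pos (hG.finite_orbit o t)).2 ⟨1, by simpa using ht⟩

variable [IsIsometricSMul G X]

/-- The number of group elements moving `x` close to `y` is controlled by orbit growth. -/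
lemma ncard_dist_smul_le (o' : X) (r : ℝ) :
    {g : G | dist (g • o) o' ≤ r}.Finite ∧
      {g : G | dist (g • o) o' ≤ r}.ncard ≤ orbitGrowth G o (2 * r) := by
  rcases {g : G | dist (g • o) o' ≤ r}.eq_empty_or_nonempty with h | ⟨k, hk⟩
  · simp [h]
  · have hinj : Set.InjOn (fun g : G => k⁻¹ * g) {g : G | dist (g • o) o' ≤ r} :=
      fun a _ b _ hab => mul_left_cancel hab
    have hmaps : Set.MapsTo (fun g : G => k⁻¹ * g) {g : G | dist (g • o) o' ≤ r}
        {g : G | dist o (g • o) ≤ 2 * r} := by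
      intro g hg
      rw [Set.mem_ofPred_eq] at hg hk ⊢
      rw [dist_smul_inv_smul]
      have := dist_triangle_right (k • o) (g • o) o'
      linarith
    exact ⟨Set.Finite.of_injOn hmaps hinj (hG.finite_orbit o _),
      Set.ncard_le_ncard_of_injOn _ hmaps hinj (hG.finite_orbit o _)⟩

/-- Uniform control over all base points. -/
lemma exists_ncard_dist_smul_le (r : ℝ) :
    ∃ K : ℕ, 0 < K ∧ ∀ x y : X, {g : G | dist (g • x) y ≤ r}.Finite ∧
      {g : G | dist (g • x) y ≤ r}.ncard ≤ K := by
  rcases isEmpty_or_nonempty X with h | ⟨⟨o⟩⟩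
  · exact ⟨1, one_pos, fun x => h.elim x⟩
  obtain ⟨c, hc, hco⟩ := hG.cobounded o
  -- Replacing `x` by an orbit point `k • o` within `c` reduces to the base point `o`. The absolute
  -- value keeps the bound positive for negative `r`.
  refine ⟨orbitGrowth G o (2 * |r + c|), hG.one_le_orbitGrowth o (by positivity), fun x y => ?_⟩
  obtain ⟨k, hk⟩ := hco x
  have hinj : Set.InjOn (fun g : G => g * k) {g : G | dist (g • x) y ≤ r} :=
    fun a _ b _ hab => mul_right_cancel hab
  have hmaps : Set.MapsTo (fun g : G => g * k) {g : G | dist (g • x) y ≤ r}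
      {g : G | dist (g • o) y ≤ |r + c|} := by
    intro g hg
    rw [Set.mem_ofPred_eq] at hg ⊢
    rw [mul_smul]
    have h1 := dist_triangle (g • k • o) (g • x) y
    rw [dist_smul] at h1
    linarith [le_abs_self (r + c)]
  obtain ⟨h1, h2⟩ := hG.ncard_dist_smul_le o y |r + c|
  exact ⟨Set.Finite.of_injOn hmaps hinj h1,
    (Set.ncard_le_ncard_of_injOn _ hmaps hinj h1).trans h2⟩

/-- Cut a geodesic from `o` to `g • o` at distance `s` and pick an orbit point `k • o` within `c` of
the cut. The map `g ↦ (k, k⁻¹ * g)` is injective. -/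
lemma orbitGrowth_add_le {c : ℝ} (hc : ∀ y : X, ∃ g : G, dist (g • o) y ≤ c) {s t : ℝ}
    (hs : 0 ≤ s) (ht : 0 ≤ t) :
    orbitGrowth G o (s + t) ≤ orbitGrowth G o (s + c) * orbitGrowth G o (t + c) := by
  have key : ∀ g : G, dist o (g • o) ≤ s + t →
      ∃ k : G, dist o (k • o) ≤ s + c ∧ dist (k • o) (g • o) ≤ t + c := by
    intro g hg
    -- If the geodesic is shorter than `s`, the cut is its endpoint.
    obtain ⟨z, hz1, hz2⟩ := hG.geodesic o (g • o) (min s (dist o (g • o))) (by positivity)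
      (min_le_right _ _)
    obtain ⟨k, hk⟩ := hc z
    refine ⟨k, ?_, ?_⟩
    · have := dist_triangle_right o (k • o) z
      have := min_le_left s (dist o (g • o))
      linarith
    · have := dist_triangle (k • o) z (g • o)
      rcases min_cases s (dist o (g • o)) with ⟨h, _⟩ | ⟨h, _⟩ <;> rw [h] at hz2 <;> linarith
  choose! k hk1 hk2 using key
  rw [orbitGrowth, orbitGrowth, orbitGrowth, ← Set.ncard_prod]
  refine Set.ncard_le_ncard_of_injOn (fun g => (k g, (k g)⁻¹ * g)) ?_ ?_
    ((hG.finite_orbit o _).prod (hG.finite_orbit o _))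
  · intro g hg
    refine ⟨hk1 g hg, ?_⟩
    change dist o (((k g)⁻¹ * g) • o) ≤ t + c
    rw [dist_smul_inv_smul]
    exact hk2 g hg
  · intro a _ b _ hab
    obtain ⟨h1, h2⟩ := Prod.mk.inj hab
    rw [h1] at h2
    exact mul_left_cancel h2

/-- The exponential growth rate of orbits exists. -/
theorem exists_tendsto_log_orbitGrowth :
    ∃ h : ℝ, Tendsto (fun t => Real.log (orbitGrowth G o t) / t) atTop (𝓝 h) := by
  obtain ⟨c, hc, hco⟩ := hG.cobounded o
  -- The shift by `2 * c` absorbs the defect: `s + t + 2 * c = (s + c) + (t + c)`, and each factor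
  -- gains another `c`. The `max` extends the function monotonically to negative times.
  set a : ℝ → ℝ := fun t => Real.log (orbitGrowth G o (max t 0 + 2 * c)) with ha
  have hone : ∀ t : ℝ, 1 ≤ orbitGrowth G o (max t 0 + 2 * c) := fun t =>
    hG.one_le_orbitGrowth o (by positivity)
  have hmono : Monotone a := by
    intro s t hst
    have h1 := hone s
    apply Real.log_le_log (by exact_mod_cast h1)
    exact_mod_cast hG.orbitGrowth_mono o (by gcongr)
  have h0 : ∀ t, 0 ≤ a t := fun t => Real.log_natCast_nonneg _
  have hsub : ∀ s t, 0 ≤ s → 0 ≤ t → a (s + t) ≤ a s + a t := by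
    intro s t hs ht
    have h1 := hone s
    have h2 := hone t
    have h3 := hone (s + t)
    simp only [ha]
    rw [← Real.log_mul (by positivity) (by positivity)]
    apply Real.log_le_log (by exact_mod_cast h3)
    have := hG.orbitGrowth_add_le o hco (s := s + c) (t := t + c) (by positivity) (by positivity)
    rw [max_eq_left hs, max_eq_left ht, max_eq_left (by positivity)]
    rw [show s + t + 2 * c = s + c + (t + c) by ring, show s + 2 * c = s + c + c by ring,
      show t + 2 * c = t + c + c by ring]
    exact_mod_cast this
  obtain ⟨h, hh⟩ := exists_tendsto_div_of_subadditive hmono h0 hsub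
  refine ⟨h, (tendsto_div_comp_add hh (-(2 * c))).congr' ?_⟩
  filter_upwards [eventually_ge_atTop (2 * c)] with t ht
  simp only [ha]
  rw [max_eq_left (by linarith)]
  simp

/-- Comparison of two base points. -/
lemma orbitGrowth_le_of_dist (o' : X) (t : ℝ) :
    orbitGrowth G o t ≤ orbitGrowth G o' (t + 2 * dist o o') := by
  refine Set.ncard_le_ncard (fun g hg => ?_) (hG.finite_orbit o' _)
  rw [Set.mem_ofPred_eq] at hg ⊢
  have h1 := dist_triangle4 o' o (g • o) (g • o')
  rw [dist_smul, dist_comm o' o] at h1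
  linarith

lemma tendsto_log_orbitGrowth_of_dist {h : ℝ} {o : X}
    (hh : Tendsto (fun t => Real.log (orbitGrowth G o t) / t) atTop (𝓝 h)) (o' : X) :
    Tendsto (fun t => Real.log (orbitGrowth G o' t) / t) atTop (𝓝 h) := by
  have hle : ∀ (x y : X) {t : ℝ}, 0 ≤ t → Real.log (orbitGrowth G x t) ≤
      Real.log (orbitGrowth G y (t + 2 * dist x y)) := by
    intro x y t ht
    have := hG.one_le_orbitGrowth x ht
    apply Real.log_le_log (by exact_mod_cast this)
    exact_mod_cast hG.orbitGrowth_le_of_dist x y t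
  refine tendsto_of_tendsto_of_tendsto_of_le_of_le'
    (tendsto_div_comp_add hh (-(2 * dist o o'))) (tendsto_div_comp_add hh (2 * dist o' o)) ?_ ?_
  · filter_upwards [eventually_gt_atTop 0, eventually_ge_atTop (2 * dist o o')] with t ht ht'
    have := hle o o' (t := t + -(2 * dist o o')) (by linarith)
    rw [neg_add_cancel_right] at this
    gcongr
  · filter_upwards [eventually_gt_atTop 0] with t ht
    have := hle o' o ht.le
    gcongr

end IsGeometricAction

end Growth

/-! ### Spaces of unit speed lines and their quotients -/

section LineSystem

variable (G : Type*) {X U Z : Type*} [Group G] [MetricSpace X] [MulAction G X]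
  [TopologicalSpace U]

/-- A space `U` of unit speed lines in a metric space, closed under reversal, reparameterization and
the group `G`, in which lines with the same origin diverge monotonically. -/
structure LineSystem (l : U → ℝ → X) : Prop where
  dist_eq : ∀ u s t, dist (l u s) (l u t) = |s - t|
  isClosedEmbedding : IsClosedEmbedding fun u => (l u 0, l u 1)
  exists_line : ∀ x y, ∃ u, l u 0 = x ∧ l u (dist x y) = y
  exists_reverse : ∀ u, ∃ v, ∀ s, l v s = l u (-s)
  exists_shift : ∀ u t, ∃ v, ∀ s, l v s = l u (t + s)
  exists_smul : ∀ (g : G) u, ∃ v, ∀ s, l v s = g • l u s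
  continuous : ∀ s, Continuous fun u => l u s
  mono : ∀ u v s t, l u 0 = l v 0 → 0 ≤ s → s ≤ t → dist (l u s) (l v s) ≤ dist (l u t) (l v t)

/-- A flow `φ` on the quotient `q : U → Z` of a space of lines by the group `G`, induced by the
reparameterization of lines. -/
structure IsQuotientFlow [TopologicalSpace Z] (l : U → ℝ → X) (q : U → Z) (φ : ℝ → Z → Z) :
    Prop where
  isQuotientMap : IsQuotientMap q
  eq_iff : ∀ u v, q u = q v ↔ ∃ g : G, ∀ s, l v s = g • l u s
  flow : ∀ t u v, (∀ s, l v s = l u (t + s)) → φ t (q u) = q v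

variable {G} {l : U → ℝ → X}

namespace LineSystem

variable (hl : LineSystem G l)
include hl

lemma eq_of_eq {u v : U} (h0 : l u 0 = l v 0) (h1 : l u 1 = l v 1) : u = v :=
  hl.isClosedEmbedding.injective (Prod.ext h0 h1)

/-- Lines are quasi-convex with respect to each other. -/
lemma dist_le (u v : U) {s t : ℝ} (hs : 0 ≤ s) (hst : s ≤ t) :
    dist (l u s) (l v s) ≤ dist (l u t) (l v t) + 4 * dist (l u 0) (l v 0) := by
  -- The auxiliary line `w` shares its origin with `u` and its end with `v`, so `mono` compares it
  -- with `u` directly and with `v` after reversal.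
  obtain ⟨w, hw0, hw1⟩ := hl.exists_line (l u 0) (l v t)
  set r := dist (l u 0) (l v t) with hr
  have hd := hl.dist_eq
  have hrt : |r - t| ≤ dist (l u 0) (l v 0) := by
    have h1 : dist (l v 0) (l v t) = t := by rw [hd, zero_sub, abs_neg, abs_of_nonneg (by linarith)]
    have h2 := abs_dist_sub_le (l u 0) (l v 0) (l v t)
    rwa [h1] at h2
  have h1 : dist (l u s) (l w s) ≤ dist (l u t) (l v t) + dist (l u 0) (l v 0) := by
    have h2 := hl.mono u w s t hw0.symm hs hst
    have h3 := dist_triangle (l u t) (l v t) (l w t)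
    rw [← hw1, hd w, hw1] at h3
    linarith
  -- `w'` and `v'` run backwards from `l v t`. The lengths `r` and `t` differ by at most the
  -- distance of the origins, and correcting for this produces the constant 4.
  obtain ⟨w1, hw1'⟩ := hl.exists_reverse w
  obtain ⟨w', hw'⟩ := hl.exists_shift w1 (-r)
  obtain ⟨v1, hv1⟩ := hl.exists_reverse v
  obtain ⟨v', hv'⟩ := hl.exists_shift v1 (-t)
  have h2 := hl.mono w' v' (t - s) t (by rw [hw', hv', hw1', hv1]; simpa using hw1)
    (by linarith) (by linarith)
  simp only [hw', hv', hw1', hv1] at h2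
  have e1 : -(-r + (t - s)) = r - t + s := by ring
  have e2 : -(-t + (t - s)) = s := by ring
  have e3 : -(-r + t) = r - t := by ring
  have e4 : -(-t + t) = 0 := by ring
  rw [e1, e2, e3, e4] at h2
  have h3 := dist_triangle (l w (r - t)) (l w 0) (l v 0)
  rw [hd w, hw0, sub_zero] at h3
  have h4 := dist_triangle (l w s) (l w (r - t + s)) (l v s)
  rw [hd w, show s - (r - t + s) = -(r - t) by ring, abs_neg] at h4
  have h5 := dist_triangle (l u s) (l w s) (l v s)
  linarith

lemma secondCountableTopology [ProperSpace X] : SecondCountableTopology U :=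
  hl.isClosedEmbedding.isEmbedding.secondCountableTopology

/-- The position at time 1 lies automatically in the ball of radius `c + 1`, so the set is the
preimage of a product of two balls under a closed embedding. -/
lemma isCompact_setOf_origin_mem [ProperSpace X] (o : X) (c : ℝ) :
    IsCompact {u : U | dist (l u 0) o ≤ c} := by
  have h := hl.isClosedEmbedding.isCompact_preimage
    ((isCompact_closedBall o c).prod (isCompact_closedBall o (c + 1)))
  convert h using 1
  ext u
  have h1 := dist_triangle_left (l u 1) o (l u 0)
  rw [hl.dist_eq] at h1
  norm_num at h1
  simp only [Set.mem_ofPred_eq, Set.mem_preimage, Set.mem_prod, Metric.mem_closedBall]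
  exact ⟨fun h => ⟨h, by linarith⟩, fun h => h.1⟩

variable [IsIsometricSMul G X]

/-- Continuity can be tested on the positions at times 0 and 1, where the map is the isometry `g`.
-/
lemma exists_continuous_smul (g : G) :
    ∃ τ : U → U, Continuous τ ∧ ∀ u s, l (τ u) s = g • l u s := by
  choose τ hτ using hl.exists_smul g
  refine ⟨τ, ?_, hτ⟩
  rw [hl.isClosedEmbedding.isInducing.continuous_iff]
  have : (fun u => (l u 0, l u 1)) ∘ τ = fun u => (g • l u 0, g • l u 1) := by
    ext u <;> simp [hτ]
  rw [this]
  exact ((hl.continuous 0).const_smul g).prodMk ((hl.continuous 1).const_smul g)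

end LineSystem

/-! ### Topology and lifting properties of the quotient of a space of lines. -/

namespace IsQuotientFlow

variable [IsIsometricSMul G X] {q : U → Z} {φ : ℝ → Z → Z}

section Topological

variable [TopologicalSpace Z] (hq : IsQuotientFlow G l q φ) (hl : LineSystem G l)
  (hG : IsGeometricAction G X)
include hq hl

/-- The saturation of an open set is the union of its preimages under the group elements. -/
lemma isOpenQuotientMap : IsOpenQuotientMap q := by
  refine ⟨hq.isQuotientMap.surjective, hq.isQuotientMap.continuous, fun W hW => ?_⟩
  choose τ hτc hτ using fun g : G => hl.exists_continuous_smul g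
  rw [← hq.isQuotientMap.isOpen_preimage]
  have : q ⁻¹' (q '' W) = ⋃ g : G, τ g ⁻¹' W := by
    ext v
    simp only [Set.mem_preimage, Set.mem_image, Set.mem_iUnion]
    constructor
    · rintro ⟨u, hu, huv⟩
      obtain ⟨g, hg⟩ := (hq.eq_iff v u).1 huv.symm
      refine ⟨g, ?_⟩
      rwa [hl.eq_of_eq (u := τ g v) (v := u) (by rw [hτ, hg]) (by rw [hτ, hg])]
    · rintro ⟨g, hg⟩
      exact ⟨_, hg, ((hq.eq_iff v _).2 ⟨g, hτ g v⟩).symm⟩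
  rw [this]
  exact isOpen_iUnion fun g => hW.preimage (hτc g)

lemma exists_origin_near {o : X} {c : ℝ} (hc : ∀ y : X, ∃ g : G, dist (g • o) y ≤ c) (z : Z) :
    ∃ u, q u = z ∧ dist (l u 0) o ≤ c := by
  obtain ⟨u, rfl⟩ := hq.isQuotientMap.surjective z
  obtain ⟨g, hg⟩ := hc (l u 0)
  obtain ⟨v, hv⟩ := hl.exists_smul g⁻¹ u
  refine ⟨v, ((hq.eq_iff u v).2 ⟨_, hv⟩).symm, ?_⟩
  rwa [hv, ← dist_smul g, smul_inv_smul, dist_comm]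

include hG

/-- For an open quotient map this means that the equivalence relation is closed. It is a union of
graphs of group elements, each closed, and locally finite because only finitely many `g` carry the
neighbourhood of one origin into that of another. -/
lemma t2Space : T2Space Z := by
  rw [t2Space_iff_of_isOpenQuotientMap (hq.isOpenQuotientMap hl)]
  have h0 := hl.continuous 0
  have h1 := hl.continuous 1
  have : {p : U × U | q p.1 = q p.2} =
      ⋃ g : G, {p | l p.2 0 = g • l p.1 0 ∧ l p.2 1 = g • l p.1 1} := by
    ext p
    simp only [Set.mem_ofPred_eq, Set.mem_iUnion, hq.eq_iff]
    refine exists_congr fun g => ⟨fun h => ⟨h 0, h 1⟩, fun h => ?_⟩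
    obtain ⟨v, hv⟩ := hl.exists_smul g p.1
    rwa [← hl.eq_of_eq (u := v) (v := p.2) (by rw [hv, h.1]) (by rw [hv, h.2])]
  rw [this]
  refine LocallyFinite.isClosed_iUnion ?_ fun g => ?_
  · intro p
    refine ⟨{p' | dist (l p'.1 0) (l p.1 0) < 1 ∧ dist (l p'.2 0) (l p.2 0) < 1}, ?_, ?_⟩
    · apply IsOpen.mem_nhds
      · apply IsOpen.inter
        · exact isOpen_lt ((h0.comp continuous_fst).dist continuous_const) continuous_const
        · exact isOpen_lt ((h0.comp continuous_snd).dist continuous_const) continuous_const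
      · simp
    · obtain ⟨K, -, hK⟩ := hG.exists_ncard_dist_smul_le 2
      refine (hK (l p.1 0) (l p.2 0)).1.subset ?_
      rintro g ⟨p', ⟨hp', -⟩, h2, h3⟩
      rw [Set.mem_ofPred_eq]
      have h4 := dist_triangle_left (g • l p.1 0) (l p.2 0) (g • l p'.1 0)
      rw [dist_smul, ← hp'] at h4
      linarith
  · apply IsClosed.inter
    · exact isClosed_eq (h0.comp continuous_snd) ((h0.comp continuous_fst).const_smul g)
    · exact isClosed_eq (h1.comp continuous_snd) ((h1.comp continuous_fst).const_smul g)

lemma compactSpace [ProperSpace X] (o : X) : CompactSpace Z := by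
  obtain ⟨c, -, hc⟩ := hG.cobounded o
  rw [← isCompact_univ_iff]
  convert (hl.isCompact_setOf_origin_mem o c).image hq.isQuotientMap.continuous
  refine (Set.eq_univ_of_forall fun z => ?_).symm
  obtain ⟨u, hu, hu'⟩ := hq.exists_origin_near hl hc z
  exact ⟨u, hu', hu⟩

/-- Urysohn: the quotient is compact, Hausdorff and, as an open image of `U`, second countable. -/
lemma metrizableSpace [ProperSpace X] (o : X) : TopologicalSpace.MetrizableSpace Z := by
  have := hq.compactSpace hl hG o
  have := hq.t2Space hl hG
  have := hl.secondCountableTopology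
  have : SecondCountableTopology Z :=
    hq.isQuotientMap.secondCountableTopology (hq.isOpenQuotientMap hl).isOpenMap
  exact TopologicalSpace.metrizableSpace_of_t3_secondCountable Z

end Topological

section Metric

variable [MetricSpace Z] (hq : IsQuotientFlow G l q φ) (hl : LineSystem G l)
  (hG : IsGeometricAction G X) [ProperSpace X]
include hq hl hG

/-- Pairs of lines that are close at times 0 and `L` form an open set, whose image under the open
map `q × q` is a neighbourhood of the diagonal. By compactness it contains a uniform one. -/
lemma exists_lift_near (o : X) (L : ℝ) : ∃ δ > 0, ∀ u v, dist (q u) (q v) < δ →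
    ∃ g : G, dist (g • l u 0) (l v 0) < 1 ∧ dist (g • l u L) (l v L) < 1 := by
  have := hq.compactSpace hl hG o
  have hopen := (hq.isOpenQuotientMap hl).isOpenMap
  set W : Set (U × U) := {p | dist (l p.1 0) (l p.2 0) < 1 ∧ dist (l p.1 L) (l p.2 L) < 1}
  have hW : IsOpen W := by
    apply IsOpen.inter
    · exact isOpen_lt (((hl.continuous 0).comp continuous_fst).dist
        ((hl.continuous 0).comp continuous_snd)) continuous_const
    · exact isOpen_lt (((hl.continuous L).comp continuous_fst).dist
        ((hl.continuous L).comp continuous_snd)) continuous_const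
  have h1 : Prod.map q q '' W ∈ uniformity Z := by
    rw [← nhdsSet_diagonal_eq_uniformity]
    apply ((hopen.prodMap hopen) W hW).mem_nhdsSet.2
    rintro ⟨z, z'⟩ hz
    obtain rfl : z = z' := hz
    obtain ⟨u, rfl⟩ := hq.isQuotientMap.surjective z
    exact ⟨(u, u), by simp [W], rfl⟩
  obtain ⟨δ, hδ, h2⟩ := Metric.mem_uniformity_dist.1 h1
  refine ⟨δ, hδ, fun u v huv => ?_⟩
  obtain ⟨⟨u', v'⟩, ⟨hw0, hwL⟩, he⟩ := h2 huv
  obtain ⟨e1, e2⟩ := Prod.mk.inj he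
  obtain ⟨g, hg⟩ := (hq.eq_iff u u').1 e1.symm
  obtain ⟨k, hk⟩ := (hq.eq_iff v v').1 e2.symm
  refine ⟨k⁻¹ * g, ?_, ?_⟩
  · rw [mul_smul, ← dist_smul k, smul_inv_smul, ← hg, ← hk]
    exact hw0
  · rw [mul_smul, ← dist_smul k, smul_inv_smul, ← hg, ← hk]
    exact hwL

/-- `q` is uniformly continuous near the compact set of lines with origin near `o`, and one group
element moves any pair of lines so that the first of them lies in this set. -/
lemma exists_dist_lt (o : X) {δ : ℝ} (hδ : 0 < δ) : ∃ ε > 0, ∀ u v,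
    dist (l u 0) (l v 0) < ε → dist (l u 1) (l v 1) < ε → dist (q u) (q v) < δ := by
  obtain ⟨c, -, hc⟩ := hG.cobounded o
  -- The metric pulled back from the positions at times 0 and 1.
  let _ : MetricSpace U := hl.isClosedEmbedding.isEmbedding.comapMetricSpace _
  have h := (hl.isCompact_setOf_origin_mem o c).uniformContinuousAt_of_continuousAt q
    (fun _ _ => hq.isQuotientMap.continuous.continuousAt) (Metric.dist_mem_uniformity hδ)
  obtain ⟨ε, hε, h2⟩ := Metric.mem_uniformity_dist.1 h
  refine ⟨ε, hε, fun u v h0 h1 => ?_⟩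
  obtain ⟨g, hg⟩ := hc (l u 0)
  obtain ⟨u', hu'⟩ := hl.exists_smul g⁻¹ u
  obtain ⟨v', hv'⟩ := hl.exists_smul g⁻¹ v
  rw [(hq.eq_iff u u').2 ⟨_, hu'⟩, (hq.eq_iff v v').2 ⟨_, hv'⟩]
  have h3 : dist u' v' < ε := by
    change max (dist (l u' 0) (l v' 0)) (dist (l u' 1) (l v' 1)) < ε
    simp only [hu', hv', dist_smul]
    exact max_lt h0 h1
  refine h2 h3 ?_
  change dist (l u' 0) o ≤ c
  rwa [hu', ← dist_smul g, smul_inv_smul, dist_comm]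

end Metric

end IsQuotientFlow

end LineSystem

/-! ### Entropy of quotient flows -/

section Spanning

variable {Z : Type*} [MetricSpace Z] (φ : ℝ → Z → Z) {t δ : ℝ}

/-- Compactness bounds the distances; over an unbounded set the real supremum would be 0. -/
lemma dist_le_bowenDist [CompactSpace Z] {s : ℝ} (hs : s ∈ Set.Icc 0 t) (z w : Z) :
    dist (φ s z) (φ s w) ≤ bowenDist φ t z w := by
  refine le_csSup ⟨Metric.diam (Set.univ : Set Z), ?_⟩ (Set.mem_image_of_mem _ hs)
  rintro _ ⟨s, -, rfl⟩
  exact Metric.dist_le_diam_of_mem isCompact_univ.isBounded (Set.mem_univ _) (Set.mem_univ _)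

/-- `0 ≤ δ` is needed for `t < 0`, where the supremum is over the empty set and equals 0. -/
lemma bowenDist_le {z w : Z} (hδ : 0 ≤ δ)
    (h : ∀ s ∈ Set.Icc 0 t, dist (φ s z) (φ s w) ≤ δ) : bowenDist φ t z w ≤ δ := by
  refine Real.sSup_le ?_ hδ
  rintro _ ⟨s, hs, rfl⟩
  exact h s hs

lemma spanningNumber_le_card (E : Finset Z) (hE : ∀ v : Z, ∃ u ∈ E, bowenDist φ t u v < δ) :
    spanningNumber φ t δ ≤ E.card := iInf₂_le E hE

lemma exists_card_eq_spanningNumber (h : spanningNumber φ t δ ≠ ⊤) :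
    ∃ E : Finset Z, (∀ v : Z, ∃ u ∈ E, bowenDist φ t u v < δ) ∧
      (E.card : ℕ∞) = spanningNumber φ t δ := by
  rw [spanningNumber, iInf_subtype'] at h ⊢
  have : Nonempty {E : Finset Z // ∀ v : Z, ∃ u ∈ E, bowenDist φ t u v < δ} := by
    by_contra hne
    rw [not_nonempty_iff] at hne
    exact h (iInf_of_empty _)
  obtain ⟨E, hE⟩ := ciInf_mem (fun E : {E : Finset Z // ∀ v : Z, ∃ u ∈ E, bowenDist φ t u v < δ} =>
    (E.1.card : ℕ∞))
  exact ⟨E.1, E.2, hE⟩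

/-- A finite partition into small pieces bounds the spanning number. -/
lemma spanningNumber_le_of_partition [Nonempty Z] {ι : Type*} (I : Finset ι) (κ : Z → ι)
    (hκ : ∀ z, κ z ∈ I) (h : ∀ z w, κ z = κ w → bowenDist φ t z w < δ) :
    spanningNumber φ t δ ≤ I.card := by
  classical
  -- One representative for each label; a label that is not attained only contributes a superfluous
  -- point.
  refine (spanningNumber_le_card φ (I.image (Function.invFun κ)) fun v =>
    ⟨_, Finset.mem_image_of_mem _ (hκ v), h _ _ (Function.invFun_eq ⟨v, rfl⟩)⟩).trans ?_
  exact_mod_cast Finset.card_image_le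

end Spanning

namespace IsQuotientFlow

variable {G X U Z : Type*} [Group G] [MetricSpace X] [MulAction G X] [IsIsometricSMul G X]
  [TopologicalSpace U] {l : U → ℝ → X} [ProperSpace X] [MetricSpace Z] {q : U → Z}
  {φ : ℝ → Z → Z} (hq : IsQuotientFlow G l q φ) (hl : LineSystem G l)
  (hG : IsGeometricAction G X) (o : X)
include hq hl hG

/-- Each vector is lifted to a line with origin near `o` and labelled by a net point near its origin
and a translated net point near its position at time `t + 1`. Equal labels force Bowen distance less
than `δ`, and the labels are counted by orbit growth. -/
lemma spanningNumber_le {δ : ℝ} (hδ : 0 < δ) : ∃ (C : ℕ) (c : ℝ), 0 < C ∧ 0 ≤ c ∧ ∀ t, 0 ≤ t →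
    spanningNumber φ t δ ≤ (C * orbitGrowth G o (t + c) : ℕ) := by
  obtain ⟨ε, hε, hclose⟩ := hq.exists_dist_lt hl hG o (half_pos hδ)
  obtain ⟨c, hc0, hc⟩ := hG.cobounded o
  -- Lines with equal labels are within `2ε/11` at both ends, hence within `2ε/11 + 4 · 2ε/11 < ε`
  -- in between by `LineSystem.dist_le`.
  obtain ⟨P, -, hPf, hP⟩ := (isCompact_closedBall o c).finite_cover_balls
    (show 0 < ε / 11 by positivity)
  have hnet : ∀ x, dist x o ≤ c → ∃ p ∈ P, dist x p < ε / 11 := by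
    intro x hx
    simpa using hP (Metric.mem_closedBall.2 hx)
  have hnet' : ∀ y, ∃ g : G, ∃ p ∈ P, dist (g • o) y ≤ c ∧ dist y (g • p) < ε / 11 := by
    intro y
    obtain ⟨g, hg⟩ := hc y
    obtain ⟨p, hp, hp'⟩ := hnet (g⁻¹ • y) (by rwa [← dist_smul g, smul_inv_smul, dist_comm])
    exact ⟨g, p, hp, hg, by rwa [← dist_smul g, smul_inv_smul] at hp'⟩
  have hPne : 0 < hPf.toFinset.card := by
    obtain ⟨p, hp, -⟩ := hnet o (by simpa using hc0)
    exact Finset.card_pos.2 ⟨p, hPf.mem_toFinset.2 hp⟩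
  obtain ⟨u₀, -⟩ := hl.exists_line o o
  have : Nonempty Z := ⟨q u₀⟩
  -- Closeness in the quotient at time `s` is read off at the times `s` and `s + 1`, so lines are
  -- followed up to `t + 1`. Each end is at most `c` from its orbit point, which gives `1 + 2 * c`.
  refine ⟨hPf.toFinset.card * hPf.toFinset.card, 1 + 2 * c, by positivity, by positivity,
    fun t ht => ?_⟩
  choose u hu huo using hq.exists_origin_near hl hc
  choose p₀ hp₀ hp₀' using fun z => hnet (l (u z) 0) (huo z)
  choose g p₁ hp₁ hg hp₁' using fun z => hnet' (l (u z) (t + 1))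
  have hfin := hG.finite_orbit o (t + (1 + 2 * c))
  refine (spanningNumber_le_of_partition φ
    ((hPf.toFinset ×ˢ hPf.toFinset) ×ˢ hfin.toFinset) (fun z => ((p₀ z, p₁ z), g z)) ?_ ?_).trans ?_
  · intro z
    simp only [Finset.mem_product, Set.Finite.mem_toFinset]
    refine ⟨⟨hp₀ z, hp₁ z⟩, ?_⟩
    rw [Set.mem_ofPred_eq]
    have h1 := dist_triangle4 o (l (u z) 0) (l (u z) (t + 1)) (g z • o)
    rw [hl.dist_eq, dist_comm o (l _ _), dist_comm (l _ _) (g z • o), zero_sub, abs_neg,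
      abs_of_nonneg (by linarith)] at h1
    linarith [huo z, hg z]
  · intro z w hzw
    simp only [Prod.mk.injEq] at hzw
    obtain ⟨⟨e1, e2⟩, e3⟩ := hzw
    have d0 : dist (l (u z) 0) (l (u w) 0) < 2 * (ε / 11) := by
      have h1 := hp₀' z
      rw [e1] at h1
      linarith [dist_triangle_right (l (u z) 0) (l (u w) 0) (p₀ w), hp₀' w]
    have d1 : dist (l (u z) (t + 1)) (l (u w) (t + 1)) < 2 * (ε / 11) := by
      have h1 := hp₁' z
      rw [e2, e3] at h1
      linarith [dist_triangle_right (l (u z) (t + 1)) (l (u w) (t + 1)) (g w • p₁ w), hp₁' w]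
    have d : ∀ s, 0 ≤ s → s ≤ t + 1 → dist (l (u z) s) (l (u w) s) < ε := by
      intro s h0 h1
      have := hl.dist_le (u z) (u w) h0 h1
      linarith
    refine lt_of_le_of_lt (bowenDist_le φ (half_pos hδ).le fun s hs => ?_) (half_lt_self hδ)
    obtain ⟨z', hz'⟩ := hl.exists_shift (u z) s
    obtain ⟨w', hw'⟩ := hl.exists_shift (u w) s
    rw [← hu z, ← hu w, hq.flow s _ _ hz', hq.flow s _ _ hw']
    refine (hclose z' w' ?_ ?_).le
    · rw [hz', hw', add_zero]
      exact d s hs.1 (by linarith [hs.2])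
    · rw [hz', hw']
      exact d (s + 1) (by linarith [hs.1]) (by linarith [hs.2])
  · rw [Finset.card_product, Finset.card_product, orbitGrowth, Set.ncard_eq_toFinset_card _ hfin]

/-- Vectors of a spanning set shadow all geodesics; each shadows few geodesics ending in the orbit. -/
lemma orbitGrowth_le_card : ∃ K : ℕ, 0 < K ∧ ∀ L : ℝ, 0 < L → ∃ (C : ℕ) (δ₀ : ℝ), 0 < C ∧ 0 < δ₀ ∧
    ∀ δ ≤ δ₀, ∀ t, 0 ≤ t → ∀ E : Finset Z, (∀ v : Z, ∃ u ∈ E, bowenDist φ t u v < δ) →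
      orbitGrowth G o t ≤ E.card * C * K ^ (⌊t / L⌋₊ + 1) := by
  classical
  have := hq.compactSpace hl hG o
  obtain ⟨K, hK0, hK⟩ := hG.exists_ncard_dist_smul_le 2
  -- `K` comes from the radius `2 = 1 + 1` and is chosen before `L`. The factor 2 absorbs the `k +
  -- 1` possible end indices through `k + 1 ≤ 2 ^ (k + 1)`.
  refine ⟨2 * K, by positivity, fun L hL => ?_⟩
  -- The radius `L + 1` allows for a last step shorter than `L` and the shadowing error 1; `C` may
  -- depend on `L` since it is used once per line.
  obtain ⟨C, hC0, hC⟩ := hG.exists_ncard_dist_smul_le (L + 1)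
  obtain ⟨δ₀, hδ₀, hlift⟩ := hq.exists_lift_near hl hG o L
  refine ⟨C, δ₀, hC0, hδ₀, fun δ hδ t ht E hE => ?_⟩
  set B : X → X → Finset G := fun x y => (hK x y).1.toFinset with hB
  have hBc : ∀ x y, (B x y).card ≤ K := fun x y => by
    rw [hB, ← Set.ncard_eq_toFinset_card _ (hK x y).1]; exact (hK x y).2
  set B' : X → X → Finset G := fun x y => (hC x y).1.toFinset with hB'
  have hBc' : ∀ x y, (B' x y).card ≤ C := fun x y => by
    rw [hB', ← Set.ncard_eq_toFinset_card _ (hC x y).1]; exact (hC x y).2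
  -- the possible positions after `j` steps of the translates of the line `e` that shadow a line
  let A : U → ℕ → Finset G := fun e j => Nat.rec (B (l e 0) o)
    (fun j S => S.biUnion fun α => B (l e ((j + 1 : ℕ) * L)) (α • l e ((j + 1 : ℕ) * L))) j
  have hA0 : ∀ e, A e 0 = B (l e 0) o := fun e => rfl
  have hAs : ∀ e j, A e (j + 1) = (A e j).biUnion fun α =>
      B (l e ((j + 1 : ℕ) * L)) (α • l e ((j + 1 : ℕ) * L)) := fun e j => rfl
  have hAc : ∀ e j, (A e j).card ≤ K ^ (j + 1) := by
    intro e j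
    induction j with
    | zero => simpa [hA0] using hBc _ _
    | succ j ih =>
      rw [hAs, pow_succ]
      exact (Finset.card_biUnion_le_card_mul _ _ K fun α _ => hBc _ _).trans
        (Nat.mul_le_mul_right _ ih)
  set k := ⌊t / L⌋₊ with hk
  choose e he using hq.isQuotientMap.surjective
  set T : Finset G := E.biUnion fun z => (Finset.range (k + 1)).biUnion fun j =>
    (A (e z) j).biUnion fun α => B' o (α • l (e z) (j * L)) with hT
  have hTc : T.card ≤ E.card * ((k + 1) * (K ^ (k + 1) * C)) := by
    refine Finset.card_biUnion_le_card_mul _ _ _ fun z _ => ?_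
    refine (Finset.card_biUnion_le_card_mul _ _ (K ^ (k + 1) * C) fun j hj => ?_).trans
      (by rw [Finset.card_range])
    refine (Finset.card_biUnion_le_card_mul _ _ C fun α _ => hBc' _ _).trans ?_
    refine Nat.mul_le_mul_right _ ((hAc _ _).trans (Nat.pow_le_pow_right hK0 ?_))
    exact Nat.succ_le_succ (Nat.lt_succ_iff.1 (Finset.mem_range.1 hj))
  have hkL : ∀ j ≤ k, (j : ℝ) * L ≤ t := by
    intro j hj
    rw [← le_div_iff₀ hL]
    exact (Nat.le_floor_iff (by positivity)).1 hj
  have hsub : {g : G | dist o (g • o) ≤ t} ⊆ T := by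
    intro g hg
    rw [Set.mem_ofPred_eq] at hg
    obtain ⟨u, hu0, hu1⟩ := hl.exists_line o (g • o)
    obtain ⟨z, hz, hzu⟩ := hE (q u)
    -- Being close in the quotient at time `jL` yields an element that matches the two lines at both
    -- `jL` and `(j + 1)L`. The overlap of consecutive intervals restricts the next element to at
    -- most `K` choices.
    have key : ∀ j ≤ k, ∃ α : G, dist (α • l (e z) (j * L)) (l u (j * L)) < 1 ∧
        dist (α • l (e z) ((j + 1 : ℕ) * L)) (l u ((j + 1 : ℕ) * L)) < 1 := by
      intro j hj
      obtain ⟨e', he'⟩ := hl.exists_shift (e z) (j * L)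
      obtain ⟨u', hu'⟩ := hl.exists_shift u (j * L)
      have h1 := dist_le_bowenDist φ (t := t) ⟨by positivity, hkL j hj⟩ z (q u)
      have h2 := hq.flow (j * L) (e z) e' he'
      rw [he] at h2
      rw [h2, hq.flow _ _ _ hu'] at h1
      obtain ⟨α, h3, h4⟩ := hlift e' u' (by linarith)
      refine ⟨α, ?_, ?_⟩
      · rwa [he', hu', add_zero] at h3
      · rw [he', hu'] at h4
        push_cast
        rwa [add_one_mul]
    choose! α hα hα' using key
    have hmem : ∀ j ≤ k, α j ∈ A (e z) j := by
      intro j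
      induction j with
      | zero =>
        intro _
        rw [hA0, hB, Set.Finite.mem_toFinset, Set.mem_ofPred_eq]
        have := hα 0 (Nat.zero_le _)
        simp only [Nat.cast_zero, zero_mul, hu0] at this
        linarith
      | succ j ih =>
        intro hj
        rw [hAs, Finset.mem_biUnion]
        refine ⟨α j, ih (by omega), ?_⟩
        rw [hB, Set.Finite.mem_toFinset, Set.mem_ofPred_eq]
        have h1 := hα (j + 1) hj
        have h2 := hα' j (by omega)
        have h3 := dist_triangle_right (α (j + 1) • l (e z) ((j + 1 : ℕ) * L))
          (α j • l (e z) ((j + 1 : ℕ) * L)) (l u ((j + 1 : ℕ) * L))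
        linarith
    -- The segment may be shorter than `t`; the element `g` is recovered from the last multiple of
    -- `L` before its actual length.
    set τ := dist o (g • o)
    set j := ⌊τ / L⌋₊
    have hj : j ≤ k := Nat.floor_mono (by gcongr)
    rw [hT, Finset.mem_coe, Finset.mem_biUnion]
    refine ⟨z, hz, Finset.mem_biUnion.2 ⟨j, Finset.mem_range.2 (by omega),
      Finset.mem_biUnion.2 ⟨α j, hmem j hj, ?_⟩⟩⟩
    rw [hB', Set.Finite.mem_toFinset, Set.mem_ofPred_eq]
    have h1 : (j : ℝ) * L ≤ τ := by
      rw [← le_div_iff₀ hL]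
      exact Nat.floor_le (by positivity)
    have h2 : τ < (j + 1) * L := by
      rw [← div_lt_iff₀ hL]
      exact Nat.lt_floor_add_one _
    have h3 := dist_triangle_right (g • o) (α j • l (e z) (j * L)) (l u (j * L))
    rw [← hu1, hl.dist_eq, abs_of_nonneg (by linarith), hu1] at h3
    linarith [hα j hj]
  calc orbitGrowth G o t ≤ T.card := by
        rw [orbitGrowth, ← Set.ncard_coe_finset]
        exact Set.ncard_le_ncard hsub T.finite_toSet
    _ ≤ E.card * ((k + 1) * (K ^ (k + 1) * C)) := hTc
    _ ≤ E.card * (2 ^ (k + 1) * (K ^ (k + 1) * C)) := by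
        gcongr
        exact Nat.lt_two_pow_self.le
    _ = E.card * C * (2 * K) ^ (k + 1) := by rw [mul_pow]; ring

end IsQuotientFlow

/-! ### Exponential growth rates in the extended reals -/

lemma log_natCast {k : ℕ} (hk : 0 < k) :
    ENNReal.log (((k : ℕ∞) : ℝ≥0∞)) = (Real.log k : EReal) := by
  rw [ENat.toENNReal_coe, ENNReal.log_pos_real (by exact_mod_cast hk.ne') (ENNReal.natCast_ne_top k),
    ENNReal.toReal_natCast]

lemma log_div_le {a b : ℝ≥0∞} {r t : ℝ} (hab : a ≤ b) (ht : 0 < t)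
    (hb : ENNReal.log b = (r : EReal)) :
    ENNReal.log a / (t : EReal) ≤ ((r / t : ℝ) : EReal) := by
  rw [EReal.coe_div, ← hb]
  exact EReal.div_le_div_right_of_nonneg (by exact_mod_cast ht.le) (ENNReal.log_le_log hab)

lemma le_log_div {a b : ℝ≥0∞} {r t : ℝ} (hab : a ≤ b) (ht : 0 < t)
    (ha : ENNReal.log a = (r : EReal)) :
    ((r / t : ℝ) : EReal) ≤ ENNReal.log b / (t : EReal) := by
  rw [EReal.coe_div, ← ha]
  exact EReal.div_le_div_right_of_nonneg (by exact_mod_cast ht.le) (ENNReal.log_le_log hab)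

lemma tendsto_const_add_div {f : ℝ → ℝ} {h : ℝ} (hf : Tendsto (fun t => f t / t) atTop (𝓝 h))
    (a : ℝ) : Tendsto (fun t => (a + f t) / t) atTop (𝓝 h) := by
  have h1 := (tendsto_const_nhds (x := a)).div_atTop (tendsto_id (α := ℝ) (x := atTop))
  have h2 := h1.add hf
  rw [zero_add] at h2
  exact h2.congr fun t => by simp [add_div]

/-! ### Entropy as the growth rate of orbits. -/

namespace IsQuotientFlow

variable {G X U Z : Type*} [Group G] [MetricSpace X] [MulAction G X] [IsIsometricSMul G X]
  [TopologicalSpace U] {l : U → ℝ → X} [ProperSpace X]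

/-- The entropy of a quotient flow equals the exponential growth rate of the orbits. -/
theorem hasMetricEntropy [MetricSpace Z] {q : U → Z} {φ : ℝ → Z → Z}
    (hq : IsQuotientFlow G l q φ) (hl : LineSystem G l) (hG : IsGeometricAction G X) (o : X)
    {h : ℝ} (hh : Tendsto (fun t => Real.log (orbitGrowth G o t) / t) atTop (𝓝 h)) :
    HasMetricEntropy φ (h : EReal) := by
  set lo : ℝ → EReal := fun δ => liminf (fun t : ℝ =>
    ENNReal.log (spanningNumber φ t δ : ℝ≥0∞) / (t : EReal)) atTop with hlo
  set up : ℝ → EReal := fun δ => limsup (fun t : ℝ =>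
    ENNReal.log (spanningNumber φ t δ : ℝ≥0∞) / (t : EReal)) atTop with hup
  have hle : ∀ δ, lo δ ≤ up δ := fun δ => liminf_le_limsup
  have hupper : ∀ δ, 0 < δ → up δ ≤ (h : EReal) := by
    intro δ hδ
    obtain ⟨C, c, hC, hc, hS⟩ := hq.spanningNumber_le hl hG o hδ
    have h1 := (continuous_coe_real_ereal.tendsto h).comp
      (tendsto_const_add_div (tendsto_div_comp_add hh c) (Real.log C))
    rw [hup, ← h1.limsup_eq]
    refine limsup_le_limsup ?_
    filter_upwards [eventually_gt_atTop 0] with t ht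
    have h2 := hG.one_le_orbitGrowth o (t := t + c) (by linarith)
    refine log_div_le (ENat.toENNReal_le.2 (hS t ht.le)) ht ?_
    rw [log_natCast (by positivity), Nat.cast_mul, Real.log_mul (by positivity) (by positivity)]
  have hlower : ∀ r : ℝ, r < h → ∀ᶠ δ in 𝓝[>] (0 : ℝ), (r : EReal) < lo δ := by
    intro r hr
    obtain ⟨K, hK, hKL⟩ := hq.orbitGrowth_le_card hl hG o
    have hlogK : 0 ≤ Real.log K := Real.log_natCast_nonneg _
    -- Chosen so that the loss `log K / L` is less than `h - r`; the summand 1 keeps `L` positive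
    -- when `K = 1`.
    set L := 2 * (Real.log K + 1) / (h - r) with hL
    have hhr : 0 < h - r := by linarith
    have hL0 : 0 < L := by positivity
    obtain ⟨C, δ₀, hC, hδ₀, hcount⟩ := hKL L hL0
    have hrate : r < h - Real.log K / L := by
      have : Real.log K / L < h - r := by
        rw [div_lt_iff₀ hL0, hL, mul_div_cancel₀ _ hhr.ne']
        linarith
      linarith
    filter_upwards [Ioc_mem_nhdsGT hδ₀] with δ hδ
    obtain ⟨C', c', hC', hc', hS⟩ := hq.spanningNumber_le hl hG o hδ.1
    have h1 : Tendsto (fun t : ℝ => (-(Real.log C + Real.log K) + Real.log (orbitGrowth G o t)) / t -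
        Real.log K / L) atTop (𝓝 (h - Real.log K / L)) :=
      (tendsto_const_add_div hh _).sub_const _
    have h2 := (continuous_coe_real_ereal.tendsto _).comp h1
    refine lt_of_lt_of_le (EReal.coe_lt_coe_iff.2 hrate) ?_
    rw [hlo, ← h2.liminf_eq]
    refine liminf_le_liminf ?_
    filter_upwards [eventually_gt_atTop 0] with t ht
    -- The upper estimate shows that the spanning number is finite, so it is attained by a finite
    -- set.
    obtain ⟨E, hE, hEc⟩ := exists_card_eq_spanningNumber φ
      (ne_top_of_le_ne_top (ENat.natCast_ne_top _) (hS t ht.le))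
    have h3 := hG.one_le_orbitGrowth o ht.le
    have h4 := hcount δ hδ.2 t ht.le E hE
    have hEpos : 0 < E.card := by
      rcases Nat.eq_zero_or_pos E.card with h0 | h0
      · rw [h0] at h4
        omega
      · exact h0
    have h5 : Real.log (orbitGrowth G o t) ≤
        Real.log E.card + Real.log C + (⌊t / L⌋₊ + 1) * Real.log K := by
      rw [← Real.log_mul (by positivity) (by positivity)]
      have := Real.log_pow (K : ℝ) (⌊t / L⌋₊ + 1)
      push_cast at this
      rw [← this, ← Real.log_mul (by positivity) (by positivity)]
      apply Real.log_le_log (by positivity)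
      exact_mod_cast h4
    have h6 : (⌊t / L⌋₊ : ℝ) * Real.log K ≤ t / L * Real.log K :=
      mul_le_mul_of_nonneg_right (Nat.floor_le (by positivity)) hlogK
    rw [← hEc]
    have h7 := le_log_div (le_refl _) ht (log_natCast hEpos)
    refine le_trans (EReal.coe_le_coe_iff.2 ?_) h7
    rw [le_div_iff₀ ht, sub_mul, div_mul_cancel₀ _ ht.ne']
    have h8 : Real.log K / L * t = t / L * Real.log K := by ring
    linarith
  have hlow : ∀ a : EReal, a < h → ∀ᶠ δ in 𝓝[>] (0 : ℝ), a < lo δ := by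
    intro a ha
    obtain ⟨r, har, hrh⟩ := EReal.lt_iff_exists_real_btwn.1 ha
    filter_upwards [hlower r (EReal.coe_lt_coe_iff.1 hrh)] with δ hδ
    exact har.trans hδ
  have hpos : ∀ᶠ δ in 𝓝[>] (0 : ℝ), 0 < δ := self_mem_nhdsWithin
  refine ⟨tendsto_order.2 ⟨hlow, fun b hb => ?_⟩,
    tendsto_order.2 ⟨fun a ha => ?_, fun b hb => ?_⟩⟩
  · filter_upwards [hpos] with δ hδ
    exact ((hle δ).trans (hupper δ hδ)).trans_lt hb
  · filter_upwards [hlow a ha] with δ hδ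
    exact hδ.trans_le (hle δ)
  · filter_upwards [hpos] with δ hδ
    exact (hupper δ hδ).trans_lt hb

theorem hasTopologicalEntropy [τ : TopologicalSpace Z] {q : U → Z} {φ : ℝ → Z → Z}
    (hq : IsQuotientFlow G l q φ) (hl : LineSystem G l) (hG : IsGeometricAction G X) (o : X)
    {h : ℝ} (hh : Tendsto (fun t => Real.log (orbitGrowth G o t) / t) atTop (𝓝 h)) :
    HasTopologicalEntropy φ (h : EReal) := by
  refine ⟨hq.compactSpace hl hG o, hq.metrizableSpace hl hG o, fun m hm => ?_⟩
  -- The quotient topology becomes the one induced by `m`, so the metric statement applies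
  -- unchanged.
  subst hm
  exact hq.hasMetricEntropy hl hG o hh

end IsQuotientFlow

variable {n : ℕ}

/-! ### The cone over a properly convex domain and its order -/

/-- The open convex cone over the domain on which the chart is positive. -/
def ProperlyConvexDomain.cone (Ω : ProperlyConvexDomain n) : Set (Fin (n + 1) → ℝ) :=
  {w | 0 < Ω.chart w ∧ w ∈ coneOver Ω.carrier}

/-- The infimum of the `c` such that `w < c y` in the order defined by the cone. -/
def ProperlyConvexDomain.upperRatio (Ω : ProperlyConvexDomain n) (w y : Fin (n + 1) → ℝ) : ℝ :=
  sInf {c : ℝ | c • y - w ∈ Ω.cone}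

namespace ProperlyConvexDomain

variable (Ω : ProperlyConvexDomain n) {x y z w v : Fin (n + 1) → ℝ}

lemma mem_cone_iff : w ∈ Ω.cone ↔ 0 < Ω.chart w ∧ (Ω.chart w)⁻¹ • w ∈ Ω.body := by
  refine ⟨fun h => ⟨h.1, mem_body_iff_of_cone Ω h.2⟩, fun h => ⟨h.1, ?_⟩⟩
  have := smul_mem_coneOver h.1.ne' h.2.2
  rwa [smul_inv_smul₀ h.1.ne'] at this

lemma mem_body_iff : x ∈ Ω.body ↔ Ω.chart x = 1 ∧ x ∈ Ω.cone := by
  constructor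
  · intro h
    exact ⟨h.1, by rw [h.1]; exact one_pos, h.2⟩
  · intro h
    exact ⟨h.1, h.2.2⟩

variable {Ω} in
lemma mem_cone_of_mem_body (h : x ∈ Ω.body) : x ∈ Ω.cone := ((mem_body_iff Ω).1 h).2

lemma continuous_chart : Continuous Ω.chart := LinearMap.continuous_of_finiteDimensional _

lemma isOpen_cone : IsOpen Ω.cone :=
  (isOpen_lt continuous_const Ω.continuous_chart).inter (isOpen_coneOver Ω.isOpen)

variable {Ω}

lemma smul_mem_cone {c : ℝ} (hc : 0 < c) (hw : w ∈ Ω.cone) : c • w ∈ Ω.cone :=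
  ⟨by simpa using mul_pos hc hw.1, smul_mem_coneOver hc.ne' hw.2⟩

/-- The normalization of `x + y` is a convex combination of the normalizations of `x` and `y`. -/
lemma add_mem_cone (hx : x ∈ Ω.cone) (hy : y ∈ Ω.cone) : x + y ∈ Ω.cone := by
  have hpos : 0 < Ω.chart (x + y) := by rw [map_add]; exact add_pos hx.1 hy.1
  rw [mem_cone_iff]
  refine ⟨hpos, ?_⟩
  have h := Ω.convex ((mem_cone_iff Ω).1 hx).2 ((mem_cone_iff Ω).1 hy).2
    (a := Ω.chart x / Ω.chart (x + y)) (b := Ω.chart y / Ω.chart (x + y))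
    (div_nonneg hx.1.le hpos.le) (div_nonneg hy.1.le hpos.le)
    (by rw [← add_div, ← map_add, div_self hpos.ne'])
  rwa [smul_smul, smul_smul, div_mul_eq_mul_div, div_mul_eq_mul_div, mul_inv_cancel₀ hx.1.ne',
    mul_inv_cancel₀ hy.1.ne', ← smul_add, one_div] at h

/-- Since `x` is interior, a small part of it can be spent on moving `y` into the cone. -/
lemma add_mem_cone_of_closure (hx : x ∈ Ω.cone) (hy : y ∈ closure Ω.cone) : x + y ∈ Ω.cone := by
  have hU : IsOpen ((fun z => x + (y - z)) ⁻¹' Ω.cone) := Ω.isOpen_cone.preimage (by fun_prop)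
  obtain ⟨z, hz, hzC⟩ := mem_closure_iff.1 hy _ hU (by simpa using hx)
  have := add_mem_cone hz hzC
  rwa [add_assoc, sub_add_cancel] at this

lemma bddBelow_ratio (hy : y ∈ Ω.cone) (w : Fin (n + 1) → ℝ) :
    BddBelow {c : ℝ | c • y - w ∈ Ω.cone} := by
  refine ⟨Ω.chart w / Ω.chart y, fun c hc => ?_⟩
  have := hc.1
  rw [map_sub, map_smul, smul_eq_mul] at this
  rw [div_le_iff₀ hy.1]
  linarith

/-- The cone is open, so `y - ε • w` lies in it for small `ε > 0`; rescale by `ε⁻¹`. -/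
lemma nonempty_ratio (hy : y ∈ Ω.cone) (w : Fin (n + 1) → ℝ) :
    {c : ℝ | c • y - w ∈ Ω.cone}.Nonempty := by
  have hU : IsOpen ((fun ε : ℝ => y - ε • w) ⁻¹' Ω.cone) := Ω.isOpen_cone.preimage (by fun_prop)
  have h0 : (0 : ℝ) ∈ (fun ε : ℝ => y - ε • w) ⁻¹' Ω.cone := by simpa using hy
  obtain ⟨ε, hε, h⟩ := Metric.isOpen_iff.1 hU 0 h0
  have h1 : ε / 2 ∈ Metric.ball (0 : ℝ) ε := by
    rw [mem_ball_zero_iff, Real.norm_of_nonneg (by positivity)]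
    linarith
  refine ⟨(ε / 2)⁻¹, ?_⟩
  have h2 := smul_mem_cone (c := (ε / 2)⁻¹) (by positivity) (h h1)
  rwa [smul_sub, inv_smul_smul₀ (by positivity)] at h2

/-- The admissible `c` form an upward closed set, which is open because the cone is. The infimum is
therefore not attained, and strict inequality is the right condition. -/
lemma upperRatio_lt_iff (hy : y ∈ Ω.cone) {c : ℝ} :
    Ω.upperRatio w y < c ↔ c • y - w ∈ Ω.cone := by
  constructor
  · intro h
    obtain ⟨b, hb, hbc⟩ := exists_lt_of_csInf_lt (nonempty_ratio hy w) h
    have := add_mem_cone (smul_mem_cone (sub_pos.2 hbc) hy) hb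
    convert this using 1
    module
  · intro h
    have hU : IsOpen ((fun c : ℝ => c • y - w) ⁻¹' Ω.cone) := Ω.isOpen_cone.preimage (by fun_prop)
    obtain ⟨ε, hε, hb⟩ := Metric.isOpen_iff.1 hU c h
    have h1 : c - ε / 2 ∈ Metric.ball c ε := by
      rw [Metric.mem_ball, Real.dist_eq, sub_sub_cancel_left, abs_neg, abs_of_pos (by positivity)]
      linarith
    have h2 := csInf_le (bddBelow_ratio hy w) (hb h1)
    change Ω.upperRatio w y ≤ _ at h2
    linarith

/-- The companion of `upperRatio_lt_iff` for the other strict inequality: the closed cone describes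
the values that are at least the infimum. -/
lemma lt_upperRatio_iff (hy : y ∈ Ω.cone) {c : ℝ} :
    c < Ω.upperRatio w y ↔ c • y - w ∉ closure Ω.cone := by
  constructor
  · intro h hcl
    obtain ⟨b, hcb, hb⟩ := exists_between h
    have := add_mem_cone_of_closure (smul_mem_cone (sub_pos.2 hcb) hy) hcl
    have h2 : b • y - w ∈ Ω.cone := by
      convert this using 1
      module
    exact absurd ((upperRatio_lt_iff hy).2 h2) (by linarith)
  · intro h
    by_contra hle
    push Not at hle
    refine h (mem_closure_of_tendsto (f := fun b : ℝ => b • y - w) (b := 𝓝[>] c) ?_ ?_)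
    · exact tendsto_nhdsWithin_of_tendsto_nhds (Continuous.tendsto (by fun_prop) c)
    · filter_upwards [self_mem_nhdsWithin] with b hb
      exact (upperRatio_lt_iff hy).1 (lt_of_le_of_lt hle hb)

/-- Both strict inequalities are open conditions, by openness of the cone and of the complement of
its closure. -/
lemma continuousOn_upperRatio :
    ContinuousOn (fun p : (Fin (n + 1) → ℝ) × (Fin (n + 1) → ℝ) => Ω.upperRatio p.1 p.2)
      {p | p.2 ∈ Ω.cone} := by
  have hopen : IsOpen {p : (Fin (n + 1) → ℝ) × (Fin (n + 1) → ℝ) | p.2 ∈ Ω.cone} :=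
    Ω.isOpen_cone.preimage continuous_snd
  intro p hp
  refine ContinuousAt.continuousWithinAt (tendsto_order.2 ⟨fun c hc => ?_, fun c hc => ?_⟩)
  · have hU : IsOpen ((fun p : (Fin (n + 1) → ℝ) × (Fin (n + 1) → ℝ) => c • p.2 - p.1) ⁻¹'
        (closure Ω.cone)ᶜ) := isClosed_closure.isOpen_compl.preimage (by fun_prop)
    filter_upwards [hopen.mem_nhds hp, hU.mem_nhds ((lt_upperRatio_iff hp).1 hc)] with p' h1 h2
    exact (lt_upperRatio_iff h1).2 h2
  · have hU : IsOpen ((fun p : (Fin (n + 1) → ℝ) × (Fin (n + 1) → ℝ) => c • p.2 - p.1) ⁻¹'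
        Ω.cone) := Ω.isOpen_cone.preimage (by fun_prop)
    filter_upwards [hopen.mem_nhds hp, hU.mem_nhds ((upperRatio_lt_iff hp).1 hc)] with p' h1 h2
    exact (upperRatio_lt_iff h1).2 h2

lemma upperRatio_pos (hx : x ∈ Ω.cone) (hy : y ∈ Ω.cone) : 0 < Ω.upperRatio x y := by
  by_contra hle
  push Not at hle
  rcases hle.lt_or_eq with h | h
  · have h1 := ((upperRatio_lt_iff hy).1 h).1
    simp only [zero_smul, zero_sub, map_neg] at h1
    linarith [hx.1]
  · have h1 : 0 < Ω.chart x / (2 * Ω.chart y) := div_pos hx.1 (by linarith [hy.1])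
    rw [← h] at h1
    have h2 := ((upperRatio_lt_iff hy).1 h1).1
    have h3 := hy.1
    have h4 : Ω.chart x / (2 * Ω.chart y) * Ω.chart y = Ω.chart x / 2 := by field_simp
    rw [map_sub, map_smul, smul_eq_mul, h4] at h2
    linarith [hx.1]

lemma one_le_upperRatio (hx : x ∈ Ω.body) (hy : y ∈ Ω.body) : 1 ≤ Ω.upperRatio x y := by
  by_contra hlt
  push Not at hlt
  have := ((upperRatio_lt_iff (mem_cone_of_mem_body hy)).1 hlt).1
  simp [hx.1, hy.1] at this

lemma upperRatio_self (hx : x ∈ Ω.cone) : Ω.upperRatio x x = 1 := by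
  have key : ∀ c : ℝ, Ω.upperRatio x x < c ↔ 1 < c := by
    intro c
    rw [upperRatio_lt_iff hx]
    have e : c • x - x = (c - 1) • x := by module
    rw [e]
    constructor
    · intro h
      have := h.1
      rw [map_smul, smul_eq_mul] at this
      exact sub_pos.1 (pos_of_mul_pos_left this hx.1.le)
    · intro h
      exact smul_mem_cone (sub_pos.2 h) hx
  exact eq_of_forall_gt_iff key

/-- If `w < a y` and `y < b z` then `w < a b z`. This becomes the triangle inequality of the Hilbert
metric. -/
lemma upperRatio_le_mul (hw : w ∈ Ω.cone) (hy : y ∈ Ω.cone) (hz : z ∈ Ω.cone) :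
    Ω.upperRatio w z ≤ Ω.upperRatio w y * Ω.upperRatio y z := by
  have key : ∀ a b : ℝ, Ω.upperRatio w y < a → Ω.upperRatio y z < b →
      Ω.upperRatio w z < a * b := by
    intro a b ha hb
    have ha0 := (upperRatio_pos hw hy).trans ha
    rw [upperRatio_lt_iff hz]
    have := add_mem_cone (smul_mem_cone ha0 ((upperRatio_lt_iff hz).1 hb))
      ((upperRatio_lt_iff hy).1 ha)
    convert this using 1
    module
  have h1 : Tendsto (fun ε : ℝ => (Ω.upperRatio w y + ε) * (Ω.upperRatio y z + ε)) (𝓝[>] 0)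
      (𝓝 ((Ω.upperRatio w y + 0) * (Ω.upperRatio y z + 0))) :=
    tendsto_nhdsWithin_of_tendsto_nhds (Continuous.tendsto (by fun_prop) 0)
  rw [add_zero, add_zero] at h1
  refine ge_of_tendsto h1 ?_
  filter_upwards [self_mem_nhdsWithin] with ε hε
  rw [Set.mem_Ioi] at hε
  exact (key _ _ (by linarith) (by linarith)).le

lemma upperRatio_smul_smul {a b : ℝ} (ha : 0 < a) (hb : 0 < b) (hy : y ∈ Ω.cone) :
    Ω.upperRatio (a • w) (b • y) = a / b * Ω.upperRatio w y := by
  refine eq_of_forall_gt_iff fun c => ?_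
  rw [upperRatio_lt_iff (smul_mem_cone hb hy), ← lt_div_iff₀' (by positivity), upperRatio_lt_iff hy]
  have e : c • b • y - a • w = a • ((c / (a / b)) • y - w) := by
    match_scalars <;> field_simp
  rw [e]
  constructor
  · intro h
    have := smul_mem_cone (inv_pos.2 ha) h
    rwa [inv_smul_smul₀ ha.ne'] at this
  · exact smul_mem_cone ha

/-- The set of times is all of `ℝ` or empty, and both have real supremum 0. With `1 / 0 = 0` this is
the value that extends the gauge formula to `v = 0`. -/
lemma exitTime_zero (x : Fin (n + 1) → ℝ) : exitTime Ω.body x 0 = 0 := by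
  by_cases hx : x ∈ Ω.body <;> simp [exitTime, hx]

/-- The gauge of the domain, seen from one of its points. -/
lemma one_div_exitTime (hx : x ∈ Ω.body) (hv : Ω.chart v = 0) :
    1 / exitTime Ω.body x v = Ω.upperRatio (-v) x := by
  have hxC := mem_cone_of_mem_body hx
  refine eq_of_forall_gt_iff fun c => ?_
  rw [upperRatio_lt_iff hxC, sub_neg_eq_add]
  have hchart : Ω.chart (c • x + v) = c := by simp [hx.1, hv]
  have hiff : c • x + v ∈ Ω.cone ↔ 0 < c ∧ x + c⁻¹ • v ∈ Ω.body := by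
    rw [mem_cone_iff, hchart]
    refine and_congr_right fun hc => ?_
    rw [smul_add, inv_smul_smul₀ hc.ne']
  rw [hiff]
  by_cases hv0 : v = 0
  · subst hv0
    simp [exitTime_zero, hx]
  · have ha := exitTime_pos Ω hx hv hv0
    have hb := exitTime_neg_pos Ω hx hv hv0
    constructor
    · intro h
      have hc : 0 < c := lt_trans (by positivity) h
      refine ⟨hc, ((line_mem_iff Ω hx hv hv0).2 _).2 ⟨?_, ?_⟩⟩
      · have := inv_pos.2 hc
        linarith
      · rwa [one_div, inv_lt_comm₀ ha hc] at h
    · rintro ⟨hc, h⟩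
      rw [one_div, inv_lt_comm₀ ha hc]
      exact (((line_mem_iff Ω hx hv hv0).2 _).1 h).2

/-- The Hilbert distance in terms of the order of the cone. -/
lemma affineHilbertDist_eq (hx : x ∈ Ω.body) (hy : y ∈ Ω.body) :
    affineHilbertDist Ω.body x y = 1 / 2 * Real.log (Ω.upperRatio x y * Ω.upperRatio y x) := by
  by_cases hxy : x = y
  · subst hxy
    rw [upperRatio_self (mem_cone_of_mem_body hx)]
    simp [affineHilbertDist, exitPoint]
  have hv0 : y - x ≠ 0 := sub_ne_zero.2 (Ne.symm hxy)
  have hv : Ω.chart (y - x) = 0 := by rw [map_sub, hx.1, hy.1, sub_self]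
  have hmem : x + (1 : ℝ) • (y - x) ∈ Ω.body := by simpa using hy
  have h1 := (((line_mem_iff Ω hx hv hv0).2 1).1 hmem).2
  have ha := exitTime_pos Ω hx hv hv0
  have hb := exitTime_neg_pos Ω hx hv hv0
  have hd := affineHilbertDist_line Ω hx hv hv0 one_pos h1
  have hadd := (exitTime_add Ω hx hv hv0 hmem).1
  rw [one_smul, add_sub_cancel] at hd hadd
  -- `c q - p = (c - 1) q + (q - p)`, so the order ratio is the gauge of the direction `q - p` at
  -- `q`, shifted by 1.
  have key : ∀ {p q : Fin (n + 1) → ℝ}, p ∈ Ω.body → q ∈ Ω.body →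
      Ω.upperRatio p q = 1 + 1 / exitTime Ω.body q (q - p) := by
    intro p q hp hq
    rw [one_div_exitTime hq (by rw [map_sub, hp.1, hq.1, sub_self])]
    refine eq_of_forall_gt_iff fun c => ?_
    have hqC := mem_cone_of_mem_body hq
    rw [← lt_sub_iff_add_lt', upperRatio_lt_iff hqC, upperRatio_lt_iff hqC]
    have e : c • q - p = (c - 1) • q - -(q - p) := by module
    rw [e]
  rw [hd, key hx hy, key hy hx, hadd, ← neg_sub y x]
  congr 2
  have : exitTime Ω.body x (y - x) - 1 ≠ 0 := by linarith
  field_simp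
  ring

end ProperlyConvexDomain

/-! ### The Hilbert metric as a proper metric space -/

namespace ProperlyConvexDomain

variable {Ω : ProperlyConvexDomain n} {x y z w v : Fin (n + 1) → ℝ}

lemma upperRatio_mul_eq_exp (hx : x ∈ Ω.body) (hy : y ∈ Ω.body) :
    Ω.upperRatio x y * Ω.upperRatio y x = Real.exp (2 * affineHilbertDist Ω.body x y) := by
  rw [affineHilbertDist_eq hx hy, ← mul_assoc, mul_one_div_cancel two_ne_zero, one_mul, Real.exp_log]
  exact mul_pos (upperRatio_pos (mem_cone_of_mem_body hx) (mem_cone_of_mem_body hy))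
    (upperRatio_pos (mem_cone_of_mem_body hy) (mem_cone_of_mem_body hx))

lemma upperRatio_le_exp (hx : x ∈ Ω.body) (hy : y ∈ Ω.body) :
    Ω.upperRatio x y ≤ Real.exp (2 * affineHilbertDist Ω.body x y) := by
  rw [← upperRatio_mul_eq_exp hx hy]
  have h1 := one_le_upperRatio hx hy
  have h2 := one_le_upperRatio hy hx
  nlinarith

lemma affineHilbertDist_comm (hx : x ∈ Ω.body) (hy : y ∈ Ω.body) :
    affineHilbertDist Ω.body x y = affineHilbertDist Ω.body y x := by
  rw [affineHilbertDist_eq hx hy, affineHilbertDist_eq hy hx, mul_comm (Ω.upperRatio x y)]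

lemma affineHilbertDist_triangle (hx : x ∈ Ω.body) (hy : y ∈ Ω.body) (hz : z ∈ Ω.body) :
    affineHilbertDist Ω.body x z ≤ affineHilbertDist Ω.body x y + affineHilbertDist Ω.body y z := by
  have cx := mem_cone_of_mem_body hx
  have cy := mem_cone_of_mem_body hy
  have cz := mem_cone_of_mem_body hz
  rw [affineHilbertDist_eq hx hz, affineHilbertDist_eq hx hy, affineHilbertDist_eq hy hz, ← mul_add]
  have h1 := upperRatio_pos cx cy
  have h2 := upperRatio_pos cy cx
  have h3 := upperRatio_pos cy cz
  have h4 := upperRatio_pos cz cy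
  have h5 := upperRatio_pos cx cz
  have h6 := upperRatio_pos cz cx
  rw [← Real.log_mul (by positivity) (by positivity)]
  refine mul_le_mul_of_nonneg_left (Real.log_le_log (by positivity) ?_) (by norm_num)
  calc Ω.upperRatio x z * Ω.upperRatio z x
      ≤ (Ω.upperRatio x y * Ω.upperRatio y z) * (Ω.upperRatio z y * Ω.upperRatio y x) :=
        mul_le_mul (upperRatio_le_mul cx cy cz) (upperRatio_le_mul cz cy cx) h6.le (by positivity)
    _ = _ := by ring

variable (Ω) in
/-- The Hilbert metric is finer than the metric of the affine chart. -/
lemma exists_norm_sub_le : ∃ R : ℝ, 0 ≤ R ∧ ∀ x ∈ Ω.body, ∀ y ∈ Ω.body,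
    ‖x - y‖ ≤ R * (Real.exp (2 * affineHilbertDist Ω.body x y) - 1) := by
  obtain ⟨R, hR⟩ := Ω.isBounded.exists_norm_le
  obtain ⟨p, hp⟩ := Ω.nonempty
  have hR0 : 0 ≤ R := by
    have : p.rep ∈ coneOver Ω.carrier := ⟨p.rep_nonzero, by rwa [Projectivization.mk_rep]⟩
    exact (norm_nonneg _).trans (hR _ (mem_body_iff_of_cone Ω this))
  refine ⟨2 * R, by positivity, fun x hx y hy => ?_⟩
  set E := Real.exp (2 * affineHilbertDist Ω.body x y)
  have h1 : Tendsto (fun c : ℝ => 2 * R * (c - 1)) (𝓝[>] E) (𝓝 (2 * R * (E - 1))) :=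
    tendsto_nhdsWithin_of_tendsto_nhds (Continuous.tendsto (by fun_prop) E)
  refine ge_of_tendsto h1 ?_
  filter_upwards [self_mem_nhdsWithin] with c hc
  have hE : 1 ≤ E := (one_le_upperRatio hx hy).trans (upperRatio_le_exp hx hy)
  have hc1 : 0 < c - 1 := by rw [Set.mem_Ioi] at hc; linarith
  have h2 : Ω.upperRatio y x < c := by
    have := upperRatio_le_exp hy hx
    rw [affineHilbertDist_comm hy hx] at this
    exact this.trans_lt hc
  have h3 := (upperRatio_lt_iff (mem_cone_of_mem_body hx)).1 h2
  have h4 : Ω.chart (c • x - y) = c - 1 := by simp [hx.1, hy.1]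
  -- The normalization of `c x - y` is a point of the bounded set `body`, and `x - y` is `c - 1`
  -- times its difference from `x`.
  have h5 := ((mem_cone_iff Ω).1 h3).2
  rw [h4] at h5
  have h6 : x - y = (c - 1) • ((c - 1)⁻¹ • (c • x - y) - x) := by
    rw [smul_sub, smul_inv_smul₀ hc1.ne']
    module
  rw [h6, norm_smul, Real.norm_of_nonneg hc1.le, mul_comm (2 * R)]
  gcongr
  have := norm_sub_le ((c - 1)⁻¹ • (c • x - y)) x
  linarith [hR _ h5, hR _ hx]

lemma closure_body_subset : closure Ω.body ⊆ {z | Ω.chart z = 1 ∧ z ∈ closure Ω.cone} := by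
  intro z hz
  refine ⟨?_, closure_mono (fun _ h => mem_cone_of_mem_body h) hz⟩
  exact closure_minimal (fun _ h => h.1) (isClosed_eq Ω.continuous_chart continuous_const) hz

/-- Balls of the Hilbert metric stay in compact subsets of the domain. -/
lemma exists_isCompact_of_dist_le (hx : x ∈ Ω.body) (r : ℝ) : ∃ T ⊆ Ω.body, IsCompact T ∧
    ∀ y ∈ Ω.body, affineHilbertDist Ω.body x y ≤ r → y ∈ T := by
  set E := Real.exp (2 * r)
  have hE : 0 < E := Real.exp_pos _
  -- The compact set is the closure of the domain contracted towards `x`. If `x < (E + 1) y`, then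
  -- `(E + 1) y - x = E z` with `z` in the domain, so `y` lies in it.
  refine ⟨(fun z => (E + 1)⁻¹ • (E • z + x)) '' closure Ω.body, ?_, ?_, ?_⟩
  · rintro _ ⟨z, hz, rfl⟩
    obtain ⟨h1, h2⟩ := closure_body_subset hz
    have h3 : E • z ∈ closure Ω.cone :=
      map_mem_closure (continuous_const_smul E) h2 fun _ h => smul_mem_cone hE h
    have h4 := add_mem_cone_of_closure (mem_cone_of_mem_body hx) h3
    rw [add_comm x] at h4
    have h5 : Ω.chart (E • z + x) = E + 1 := by simp [h1, hx.1]
    rw [mem_cone_iff, h5] at h4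
    exact h4.2
  · exact (Metric.isCompact_of_isClosed_isBounded isClosed_closure Ω.isBounded.closure).image
      (by fun_prop)
  · intro y hy hxy
    have h1 : Ω.upperRatio x y < E + 1 := by
      have h2 := upperRatio_le_exp hx hy
      have h3 : Real.exp (2 * affineHilbertDist Ω.body x y) ≤ E := Real.exp_le_exp.2 (by linarith)
      linarith
    have h2 := (upperRatio_lt_iff (mem_cone_of_mem_body hy)).1 h1
    have h3 : Ω.chart ((E + 1) • y - x) = E := by simp [hx.1, hy.1]
    rw [mem_cone_iff, h3] at h2
    refine ⟨_, subset_closure h2.2, ?_⟩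
    simp only
    rw [smul_inv_smul₀ hE.ne', sub_add_cancel, inv_smul_smul₀ (by positivity)]

/-- The points of the domain, with the Hilbert metric. -/
@[ext]
structure Point (Ω : ProperlyConvexDomain n) where
  val : Fin (n + 1) → ℝ
  mem : val ∈ Ω.body

instance : Dist Ω.Point := ⟨fun x y => affineHilbertDist Ω.body x.1 y.1⟩

lemma Point.dist_def (x y : Ω.Point) : dist x y = affineHilbertDist Ω.body x.1 y.1 := rfl

instance : PseudoMetricSpace Ω.Point where
  dist_self x := by simp [Point.dist_def, affineHilbertDist, exitPoint]
  dist_comm x y := affineHilbertDist_comm x.2 y.2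
  dist_triangle x y z := affineHilbertDist_triangle x.2 y.2 z.2

instance : MetricSpace Ω.Point where
  eq_of_dist_eq_zero {x y} h := by
    obtain ⟨R, -, hR⟩ := Ω.exists_norm_sub_le
    have := hR x.1 x.2 y.1 y.2
    rw [← Point.dist_def, h, mul_zero, Real.exp_zero, sub_self, mul_zero] at this
    exact Point.ext (sub_eq_zero.1 (norm_le_zero_iff.1 this))

lemma continuous_upperRatio {Y : Type*} [TopologicalSpace Y] {f g : Y → Fin (n + 1) → ℝ}
    (hf : Continuous f) (hg : Continuous g) (h : ∀ y, g y ∈ Ω.cone) :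
    Continuous fun y => Ω.upperRatio (f y) (g y) := by
  have h1 := (continuousOn_upperRatio (Ω := Ω)).comp_continuous (hf.prodMk hg)
    fun y => by rw [Set.mem_ofPred_eq]; exact h y
  exact h1

/-- The Hilbert distance is a continuous expression in the chart coordinates. So compactness in the
chart passes to the Hilbert metric. -/
lemma continuous_toPoint {Y : Type*} [TopologicalSpace Y] {f : Y → Fin (n + 1) → ℝ}
    (hf : Continuous f) (h : ∀ y, f y ∈ Ω.body) :
    Continuous fun y => (⟨f y, h y⟩ : Ω.Point) := by
  rw [continuous_iff_continuousAt]
  intro y₀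
  rw [ContinuousAt, tendsto_iff_dist_tendsto_zero]
  have c := fun y => mem_cone_of_mem_body (h y)
  have h1 : Continuous fun y => Ω.upperRatio (f y) (f y₀) :=
    continuous_upperRatio hf continuous_const fun _ => c y₀
  have h2 : Continuous fun y => Ω.upperRatio (f y₀) (f y) :=
    continuous_upperRatio continuous_const hf c
  have h3 : Continuous fun y => dist (⟨f y, h y⟩ : Ω.Point) ⟨f y₀, h y₀⟩ := by
    simp only [Point.dist_def, affineHilbertDist_eq (h _) (h _)]
    exact continuous_const.mul ((h1.mul h2).log fun y =>
      (mul_pos (upperRatio_pos (c _) (c _)) (upperRatio_pos (c _) (c _))).ne')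
  have := h3.tendsto y₀
  rwa [dist_self] at this

instance : ProperSpace Ω.Point := by
  refine ⟨fun x r => ?_⟩
  obtain ⟨T, hT, hTc, h⟩ := exists_isCompact_of_dist_le x.2 r
  have := isCompact_iff_compactSpace.1 hTc
  have h1 : IsCompact (Set.range fun y : T => (⟨y.1, hT y.2⟩ : Ω.Point)) :=
    isCompact_range (continuous_toPoint continuous_subtype_val fun y => hT y.2)
  refine h1.of_isClosed_subset Metric.isClosed_closedBall fun y hy => ?_
  refine ⟨⟨y.1, h y.1 y.2 ?_⟩, rfl⟩
  rwa [Metric.mem_closedBall, dist_comm] at hy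

/-! ### The unit speed lines -/

lemma two_eq_of_unitTangent (h : (x, v) ∈ Ω.unitTangent) :
    1 / exitTime Ω.body x v + 1 / exitTime Ω.body x (-v) = 2 := by
  have h1 : Ω.finsler x v = 1 := h.2.2
  rw [finsler_eq Ω h.1 h.2.1 (ne_zero_of_mem_unitTangent Ω h)] at h1
  linarith

/-- The unit speed line with a given initial vector. -/
def unitLine (u : Ω.unitTangent) (t : ℝ) : Ω.Point :=
  ⟨Ω.geodesicLine u.1.1 u.1.2 t,
    geodesicLine_mem Ω u.2.1 u.2.2.1 (ne_zero_of_mem_unitTangent Ω u.2) t⟩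

lemma geodesicLine_zero (x v : Fin (n + 1) → ℝ) : Ω.geodesicLine x v 0 = x := by
  simp [geodesicLine, geodesicParam]

lemma unitLine_zero (u : Ω.unitTangent) : unitLine u 0 = ⟨u.1.1, u.2.1⟩ :=
  Point.ext (geodesicLine_zero _ _)

/-- The geodesic flow reparameterizes lines. -/
lemma unitLine_geodesicFlowDomain (u : Ω.unitTangent) (s r : ℝ) :
    unitLine (geodesicFlowDomain Ω s u) r = unitLine u (s + r) := by
  obtain ⟨⟨x, v⟩, hu⟩ := u
  have hx : x ∈ Ω.body := hu.1
  have hv : Ω.chart v = 0 := hu.2.1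
  have hv0 := ne_zero_of_mem_unitTangent Ω hu
  apply Point.ext
  have hy := geodesicLine_mem Ω hx hv hv0 s
  change Ω.geodesicLine (Ω.geodesicLine x v s)
    ((Ω.finsler (Ω.geodesicLine x v s) v)⁻¹ • v) r = Ω.geodesicLine x v (s + r)
  have hc := inv_pos.2 (finsler_pos Ω hy hv hv0)
  set c := (Ω.finsler (Ω.geodesicLine x v s) v)⁻¹
  -- Only `c > 0` matters: rescaling the direction divides the exit times and leaves the line
  -- unchanged.
  clear_value c
  have hadd := exitTime_add Ω hx hv hv0 hy
  have ha := exitTime_pos Ω hx hv hv0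
  have hb := exitTime_neg_pos Ω hx hv hv0
  simp only [geodesicLine, geodesicParam] at hadd ⊢
  rw [← smul_neg, exitTime_smul _ hc, exitTime_smul _ hc, hadd.1, hadd.2, add_assoc, smul_smul,
    ← add_smul, mul_add 2 s r, Real.exp_add]
  congr 2
  set a := exitTime Ω.body x v
  set b := exitTime Ω.body x (-v)
  have hs := Real.exp_pos (2 * s)
  have hr := Real.exp_pos (2 * r)
  set S := Real.exp (2 * s)
  set R := Real.exp (2 * r)
  -- The two exit times seen from the point at time `s`, in closed form.
  have e1 : a - (S - 1) / (1 / b + S / a) = a * (a + b) / (a + S * b) := by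
    field_simp
    ring
  have e2 : b + (S - 1) / (1 / b + S / a) = S * b * (a + b) / (a + S * b) := by
    field_simp
    ring
  rw [e1, e2]
  have h1 : a + S * R * b ≠ 0 := by positivity
  have h2 : a + R * S * b ≠ 0 := by positivity
  field_simp
  ring

lemma dist_unitLine_zero (u : Ω.unitTangent) (t : ℝ) :
    dist (unitLine u 0) (unitLine u t) = |t| := by
  rw [Point.dist_def, unitLine_zero]
  exact (affineHilbertDist_geodesicParam Ω u.2.1 u.2.2.1 (ne_zero_of_mem_unitTangent Ω u.2) t).1

/-- The flow moves the point at time `s` to the origin, which reduces to distances from the origin.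
-/
lemma dist_unitLine (u : Ω.unitTangent) (s t : ℝ) :
    dist (unitLine u s) (unitLine u t) = |s - t| := by
  have h := dist_unitLine_zero (geodesicFlowDomain Ω s u) (t - s)
  rwa [unitLine_geodesicFlowDomain, unitLine_geodesicFlowDomain, add_zero, add_sub_cancel,
    abs_sub_comm] at h

lemma exists_unitTangent_smul (hx : x ∈ Ω.body) (hv : Ω.chart v = 0) (hv0 : v ≠ 0) :
    (x, (Ω.finsler x v)⁻¹ • v) ∈ Ω.unitTangent := by
  have hF := finsler_pos Ω hx hv hv0
  refine ⟨hx, by simp [hv], ?_⟩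
  change Ω.finsler x (_ • v) = 1
  rw [finsler_smul Ω hx hv hv0 (inv_pos.2 hF), inv_mul_cancel₀ hF.ne']

variable (Ω) in
lemma exists_chart_eq_zero (hn : 0 < n) : ∃ v, Ω.chart v = 0 ∧ v ≠ 0 := by
  have h : LinearMap.ker Ω.chart ≠ ⊥ := by
    apply LinearMap.ker_ne_bot_of_finrank_lt
    simp [hn]
  obtain ⟨v, hv, hv0⟩ := Submodule.exists_mem_ne_zero_of_ne_bot h
  exact ⟨v, hv, hv0⟩

lemma exists_unitLine (hn : 0 < n) (x y : Ω.Point) :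
    ∃ u : Ω.unitTangent, unitLine u 0 = x ∧ unitLine u (dist x y) = y := by
  by_cases hxy : x = y
  · subst hxy
    obtain ⟨v, hv, hv0⟩ := Ω.exists_chart_eq_zero hn
    refine ⟨⟨_, exists_unitTangent_smul x.2 hv hv0⟩, ?_⟩
    rw [dist_self, unitLine_zero]
    exact ⟨rfl, rfl⟩
  · have hw0 : y.1 - x.1 ≠ 0 := sub_ne_zero.2 fun h => hxy (Point.ext h.symm)
    have hw : Ω.chart (y.1 - x.1) = 0 := by rw [map_sub, x.2.1, y.2.1, sub_self]
    have hu := exists_unitTangent_smul x.2 hw hw0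
    have hF := finsler_pos Ω x.2 hw hw0
    set F := Ω.finsler x.1 (y.1 - x.1)
    set v := F⁻¹ • (y.1 - x.1) with hv
    have hy : x.1 + F • v = y.1 := by rw [hv, smul_inv_smul₀ hF.ne', add_sub_cancel]
    have hv0 := ne_zero_of_mem_unitTangent Ω hu
    have ha := exitTime_pos Ω hu.1 hu.2.1 hv0
    have hb := exitTime_neg_pos Ω hu.1 hu.2.1 hv0
    have hFa := (((line_mem_iff Ω hu.1 hu.2.1 hv0).2 F).1 (hy ▸ y.2)).2
    simp only at ha hb hFa
    set a := exitTime Ω.body x.1 v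
    set b := exitTime Ω.body x.1 (-v)
    have hFa' : 0 < 1 - F / a := by rw [sub_pos, div_lt_one ha]; exact hFa
    have hE1 : 1 < (1 + F / b) / (1 - F / a) := by
      rw [one_lt_div hFa']
      have : 0 < F / b := by positivity
      have : 0 < F / a := by positivity
      linarith
    -- The solution of `geodesicParam x v t = F`, namely `e^{2t} = (1 + F/b) / (1 - F/a)`.
    set t := 1 / 2 * Real.log ((1 + F / b) / (1 - F / a)) with ht
    have ht0 : 0 < t := by have := Real.log_pos hE1; positivity
    have hE : Real.exp (2 * t) = (1 + F / b) / (1 - F / a) := by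
      rw [ht, ← mul_assoc, mul_one_div_cancel two_ne_zero, one_mul, Real.exp_log (by linarith)]
    have hline : unitLine ⟨(x.1, v), hu⟩ t = y := by
      apply Point.ext
      change x.1 + Ω.geodesicParam x.1 v t • v = y.1
      rw [← hy, geodesicParam, hE]
      congr 2
      change _ / (1 / b + _ / a) = F
      have : a - F ≠ 0 := by linarith
      rw [div_eq_iff (by positivity)]
      field_simp
      ring
    have hzero : unitLine ⟨(x.1, v), hu⟩ 0 = x := unitLine_zero _
    refine ⟨⟨(x.1, v), hu⟩, hzero, ?_⟩
    have hd := dist_unitLine_zero ⟨(x.1, v), hu⟩ t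
    rw [hzero, hline, abs_of_pos ht0] at hd
    rw [hd, hline]

lemma exists_reverse_unitLine (u : Ω.unitTangent) :
    ∃ v : Ω.unitTangent, ∀ s, unitLine v s = unitLine u (-s) := by
  obtain ⟨⟨x, v⟩, hu⟩ := u
  have hx : x ∈ Ω.body := hu.1
  have hv : Ω.chart v = 0 := hu.2.1
  have hv0 := ne_zero_of_mem_unitTangent Ω hu
  have ha := exitTime_pos Ω hx hv hv0
  have hb := exitTime_neg_pos Ω hx hv hv0
  have hu' : (x, -v) ∈ Ω.unitTangent := by
    refine ⟨hx, by simp [hv], ?_⟩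
    change Ω.finsler x (-v) = 1
    rw [finsler_eq Ω hx (by simp [hv]) (by simpa using hv0), neg_neg, add_comm,
      two_eq_of_unitTangent hu]
    norm_num
  refine ⟨⟨_, hu'⟩, fun s => Point.ext ?_⟩
  change x + Ω.geodesicParam x (-v) s • (-v) = x + Ω.geodesicParam x v (-s) • v
  rw [smul_neg, ← neg_smul]
  congr 2
  simp only [geodesicParam, neg_neg]
  rw [show 2 * -s = -(2 * s) by ring, Real.exp_neg]
  have hE := Real.exp_pos (2 * s)
  set a := exitTime Ω.body x v
  set b := exitTime Ω.body x (-v)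
  set E := Real.exp (2 * s)
  have h1 : 0 < 1 / a + E / b := by positivity
  have h2 : 0 < 1 / b + E⁻¹ / a := by positivity
  rw [← neg_div, div_eq_div_iff h1.ne' h2.ne']
  field_simp
  ring

lemma continuous_upperRatio_unitTangent :
    Continuous (fun u : Ω.unitTangent => Ω.upperRatio u.1.2 u.1.1) ∧
      Continuous (fun u : Ω.unitTangent => Ω.upperRatio (-u.1.2) u.1.1) := by
  have h1 : Continuous fun u : Ω.unitTangent => u.1.1 := by fun_prop
  have h2 : Continuous fun u : Ω.unitTangent => u.1.2 := by fun_prop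
  exact ⟨continuous_upperRatio h2 h1 fun u => mem_cone_of_mem_body u.2.1,
    continuous_upperRatio h2.neg h1 fun u => mem_cone_of_mem_body u.2.1⟩

/-- Exit times enter only through their reciprocals, which are order ratios and hence continuous. -/
lemma continuous_unitLine (t : ℝ) : Continuous fun u : Ω.unitTangent => unitLine u t := by
  refine continuous_toPoint ?_ _
  have h1 : Continuous fun u : Ω.unitTangent => u.1.1 := by fun_prop
  have h2 : Continuous fun u : Ω.unitTangent => u.1.2 := by fun_prop
  have h3 : ∀ u : Ω.unitTangent, Ω.geodesicParam u.1.1 u.1.2 t = (Real.exp (2 * t) - 1) /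
      (Ω.upperRatio u.1.2 u.1.1 + Real.exp (2 * t) * Ω.upperRatio (-u.1.2) u.1.1) := by
    intro u
    rw [geodesicParam, one_div_exitTime u.2.1 (by simpa using u.2.2.1), div_eq_mul_one_div (Real.exp _),
      one_div_exitTime u.2.1 u.2.2.1, neg_neg]
  simp only [geodesicLine, h3]
  have h4 : Continuous fun u : Ω.unitTangent =>
      Ω.upperRatio u.1.2 u.1.1 + Real.exp (2 * t) * Ω.upperRatio (-u.1.2) u.1.1 :=
    continuous_upperRatio_unitTangent.1.add
      (continuous_const.mul continuous_upperRatio_unitTangent.2)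
  have h5 : Continuous fun u : Ω.unitTangent => (Real.exp (2 * t) - 1) /
      (Ω.upperRatio u.1.2 u.1.1 + Real.exp (2 * t) * Ω.upperRatio (-u.1.2) u.1.1) := by
    refine continuous_const.div h4 fun u => ?_
    have hv0 := ne_zero_of_mem_unitTangent Ω u.2
    have ha := exitTime_pos Ω u.2.1 u.2.2.1 hv0
    have hb := exitTime_neg_pos Ω u.2.1 u.2.2.1 hv0
    have e1 := one_div_exitTime u.2.1 u.2.2.1
    have e2 := one_div_exitTime u.2.1 (v := -u.1.2) (by simpa using u.2.2.1)
    rw [neg_neg] at e2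
    rw [← e1, ← e2]
    positivity
  exact h1.add (h5.smul h2)

end ProperlyConvexDomain

namespace ProperlyConvexDomain

variable {Ω : ProperlyConvexDomain n} {x y z w v : Fin (n + 1) → ℝ}

/-! ### Divergence of lines with the same origin -/

/-- For a point `x` of the domain and a nonzero tangent vector `v`, the vector in question
represents, up to a positive factor, the boundary point of the ray from `x` in direction `v`. -/
lemma boundary_notMem_cone (hx : x ∈ Ω.cone) (v : Fin (n + 1) → ℝ) :
    Ω.upperRatio (-v) x • x + v ∉ Ω.cone := by
  intro h
  rw [← sub_neg_eq_add, ← upperRatio_lt_iff hx] at h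
  exact lt_irrefl _ h

lemma boundary_mem_closure (hx : x ∈ Ω.cone) (v : Fin (n + 1) → ℝ) :
    Ω.upperRatio (-v) x • x + v ∈ closure Ω.cone := by
  by_contra h
  rw [← sub_neg_eq_add, ← lt_upperRatio_iff hx] at h
  exact lt_irrefl _ h

/-- Along rays from a common origin to boundary points, the order ratio increases. -/
lemma upperRatio_ray_mono {b b' : Fin (n + 1) → ℝ} (hx : x ∈ Ω.cone) (hb : b ∈ closure Ω.cone)
    (hbc : b' ∈ closure Ω.cone) (hb' : b' ∉ Ω.cone) {k k' : ℝ} (hk : 0 ≤ k) (hkk' : k ≤ k') :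
    Ω.upperRatio (x + k • b) (x + k • b') ≤ Ω.upperRatio (x + k' • b) (x + k' • b') := by
  have hmem : ∀ (c : Fin (n + 1) → ℝ), c ∈ closure Ω.cone → ∀ r : ℝ, 0 ≤ r → x + r • c ∈ Ω.cone := by
    intro c hc r hr
    rcases hr.eq_or_lt with h | h
    · rw [← h, zero_smul, add_zero]
      exact hx
    · exact add_mem_cone_of_closure hx
        (map_mem_closure (continuous_const_smul r) hc fun _ hz => smul_mem_cone h hz)
  rcases hkk'.eq_or_lt with rfl | hlt
  · exact le_rfl
  have hk' : 0 < k' := hk.trans_lt hlt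
  have hY := hmem b' hbc k hk
  have hY' := hmem b' hbc k' hk'.le
  have hX' := hmem b hb k' hk'.le
  refine le_of_forall_gt fun c hc => ?_
  have hc0 : 0 < c := (upperRatio_pos hX' hY').trans hc
  have h1 := (upperRatio_lt_iff hY').1 hc
  -- If `c ≤ 1`, adding `k' b` and `(1 - c) x` to the element `h1` puts a positive multiple of `b'`
  -- in the cone.
  have hc1 : 1 < c := by
    by_contra hle
    push Not at hle
    apply hb'
    have hb0 : k' • b ∈ closure Ω.cone :=
      map_mem_closure (continuous_const_smul k') hb fun _ hz => smul_mem_cone hk' hz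
    have h2 := add_mem_cone_of_closure h1 hb0
    have h3 : (c * k') • b' ∈ Ω.cone := by
      rcases hle.eq_or_lt with rfl | hlt1
      · convert h2 using 1
        module
      · convert add_mem_cone h2 (smul_mem_cone (sub_pos.2 hlt1) hx) using 1
        module
    have h4 := smul_mem_cone (inv_pos.2 (mul_pos hc0 hk')) h3
    rwa [inv_smul_smul₀ (mul_pos hc0 hk').ne'] at h4
  rw [upperRatio_lt_iff hY]
  have hr : 0 < (c - 1) * (1 - k / k') :=
    mul_pos (by linarith) (by rw [sub_pos, div_lt_one hk']; exact hlt)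
  have h5 := smul_mem_cone hr hx
  -- The difference at `k` is a combination of the difference at `k'` and of `x`, with coefficients
  -- nonnegative and positive because `k < k'` and `c > 1`.
  have e : c • (x + k • b') - (x + k • b) =
      (k / k') • (c • (x + k' • b') - (x + k' • b)) + ((c - 1) * (1 - k / k')) • x := by
    match_scalars <;> field_simp
    ring
  rw [e]
  rcases hk.eq_or_lt with h | h
  · rw [← h, zero_div, zero_smul, zero_add]
    rwa [← h, zero_div] at h5
  · exact add_mem_cone (smul_mem_cone (by positivity) h1) h5

/-- The unit speed lines in homogeneous coordinates. -/
lemma geodesicLine_eq_smul (hu : (x, v) ∈ Ω.unitTangent) {t : ℝ} (ht : 0 ≤ t) :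
    ∃ r : ℝ, 0 < r ∧ Ω.geodesicLine x v t =
      r • (x + ((Real.exp (2 * t) - 1) / 2) • (Ω.upperRatio (-v) x • x + v)) := by
  have hv0 := ne_zero_of_mem_unitTangent Ω hu
  have ha := exitTime_pos Ω hu.1 hu.2.1 hv0
  have hb := exitTime_neg_pos Ω hu.1 hu.2.1 hv0
  have h2 := two_eq_of_unitTangent hu
  rw [← one_div_exitTime hu.1 hu.2.1, geodesicLine, geodesicParam]
  simp only at ha hb ⊢
  set a := exitTime Ω.body x v
  set b := exitTime Ω.body x (-v)
  have hE : 1 ≤ Real.exp (2 * t) := Real.one_le_exp (by linarith)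
  set E := Real.exp (2 * t)
  have hE0 : 0 ≤ E - 1 := by linarith
  -- Unit Finsler norm means `1/a + 1/b = 2`. This makes the coefficient of the boundary point
  -- depend on `t` alone, so that different lines with one origin can be compared.
  have hden : 1 / b + E / a = 2 + (E - 1) / a := by
    have : E / a = (E - 1) / a + 1 / a := by ring
    linarith
  have hpos : 0 < 2 + (E - 1) / a := by positivity
  refine ⟨2 / (2 + (E - 1) / a), by positivity, ?_⟩
  rw [hden]
  have hpos' : 2 * a + (E - 1) ≠ 0 := by positivity
  match_scalars <;> field_simp

/-- At equal times the two points are multiples of `x + k b` and `x + k b'` with the same increasing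
`k`. The scalar factors cancel in the product of the two order ratios, and each ratio grows with `k`
by `upperRatio_ray_mono`. -/
lemma dist_unitLine_mono (u u' : Ω.unitTangent) {s t : ℝ} (h0 : unitLine u 0 = unitLine u' 0)
    (hs : 0 ≤ s) (hst : s ≤ t) :
    dist (unitLine u s) (unitLine u' s) ≤ dist (unitLine u t) (unitLine u' t) := by
  obtain ⟨⟨x, v⟩, hu⟩ := u
  obtain ⟨⟨x', v'⟩, hu'⟩ := u'
  rw [unitLine_zero, unitLine_zero] at h0
  obtain rfl : x = x' := congrArg Point.val h0
  have hxC : x ∈ Ω.cone := mem_cone_of_mem_body hu.1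
  have hb := boundary_mem_closure hxC v
  have hb' := boundary_mem_closure hxC v'
  have hn := boundary_notMem_cone hxC v
  have hn' := boundary_notMem_cone hxC v'
  set b := Ω.upperRatio (-v) x • x + v with hbdef
  set b' := Ω.upperRatio (-v') x • x + v' with hbdef'
  have key : ∀ r, 0 ≤ r → ∃ k, k = (Real.exp (2 * r) - 1) / 2 ∧ x + k • b ∈ Ω.cone ∧
      x + k • b' ∈ Ω.cone ∧ dist (unitLine ⟨(x, v), hu⟩ r) (unitLine ⟨(x, v'), hu'⟩ r) =
        1 / 2 * Real.log (Ω.upperRatio (x + k • b) (x + k • b') *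
          Ω.upperRatio (x + k • b') (x + k • b)) := by
    intro r hr
    obtain ⟨c, hc, he⟩ := geodesicLine_eq_smul hu hr
    obtain ⟨c', hc', he'⟩ := geodesicLine_eq_smul hu' hr
    rw [← hbdef] at he
    rw [← hbdef'] at he'
    have m := (unitLine ⟨(x, v), hu⟩ r).2
    have m' := (unitLine ⟨(x, v'), hu'⟩ r).2
    have hd := affineHilbertDist_eq m m'
    have mC := mem_cone_of_mem_body m
    have mC' := mem_cone_of_mem_body m'
    change Ω.geodesicLine x v r ∈ Ω.cone at mC
    change Ω.geodesicLine x v' r ∈ Ω.cone at mC'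
    change _ = 1 / 2 * Real.log (Ω.upperRatio (Ω.geodesicLine x v r) (Ω.geodesicLine x v' r) *
      Ω.upperRatio (Ω.geodesicLine x v' r) (Ω.geodesicLine x v r)) at hd
    rw [he] at mC hd
    rw [he'] at mC' hd
    set k := (Real.exp (2 * r) - 1) / 2
    have n1 := smul_mem_cone (inv_pos.2 hc) mC
    have n2 := smul_mem_cone (inv_pos.2 hc') mC'
    rw [inv_smul_smul₀ hc.ne'] at n1
    rw [inv_smul_smul₀ hc'.ne'] at n2
    refine ⟨k, rfl, n1, n2, hd.trans ?_⟩
    rw [upperRatio_smul_smul hc hc' n2, upperRatio_smul_smul hc' hc n1]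
    congr 2
    field_simp
  obtain ⟨k, hk, n1, n2, e⟩ := key s hs
  obtain ⟨k', hk', n1', n2', e'⟩ := key t (hs.trans hst)
  rw [e, e']
  have hk0 : 0 ≤ k := by
    have := Real.one_le_exp (show 0 ≤ 2 * s by linarith)
    rw [hk]
    linarith
  have hkk' : k ≤ k' := by
    have := Real.exp_le_exp.2 (show 2 * s ≤ 2 * t by linarith)
    rw [hk, hk']
    linarith
  refine mul_le_mul_of_nonneg_left (Real.log_le_log
    (mul_pos (upperRatio_pos n1 n2) (upperRatio_pos n2 n1)) ?_) (by norm_num)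
  exact mul_le_mul (upperRatio_ray_mono hxC hb hb' hn' hk0 hkk')
    (upperRatio_ray_mono hxC hb' hb hn hk0 hkk') (upperRatio_pos n2 n1).le
    (upperRatio_pos n1' n2').le

/-! ### Properness of the space of unit tangent vectors -/

lemma finsler_eq_upperRatio (hx : x ∈ Ω.body) (hv : Ω.chart v = 0) (hv0 : v ≠ 0) :
    Ω.finsler x v = 1 / 2 * (Ω.upperRatio (-v) x + Ω.upperRatio v x) := by
  rw [finsler_eq Ω hx hv hv0, one_div_exitTime hx hv, one_div_exitTime hx (by simp [hv]), neg_neg]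

/-- It is the image of `T` times the unit sphere of the kernel of the chart under Finsler
normalization. -/
lemma isCompact_unitTangent_over {T : Set (Fin (n + 1) → ℝ)} (hT : IsCompact T) (hTΩ : T ⊆ Ω.body) :
    IsCompact {u : Ω.unitTangent | u.1.1 ∈ T} := by
  rw [Subtype.isCompact_iff]
  set S : Set (Fin (n + 1) → ℝ) := Metric.sphere 0 1 ∩ {v | Ω.chart v = 0} with hS
  have hSc : IsCompact S :=
    (isCompact_sphere 0 1).inter_right (isClosed_eq Ω.continuous_chart continuous_const)
  have hS0 : ∀ v ∈ S, v ≠ 0 := by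
    rintro v hv rfl
    simpa using hv.1
  have hcont : ContinuousOn (fun p : (Fin (n + 1) → ℝ) × (Fin (n + 1) → ℝ) =>
      (p.1, (Ω.finsler p.1 p.2)⁻¹ • p.2)) (T ×ˢ S) := by
    rw [continuousOn_iff_continuous_domRestrict]
    have h1 : Continuous fun p : ↥(T ×ˢ S) => p.1.1 := by fun_prop
    have h2 : Continuous fun p : ↥(T ×ˢ S) => p.1.2 := by fun_prop
    have hp : ∀ p : ↥(T ×ˢ S), p.1.1 ∈ Ω.cone := fun p => mem_cone_of_mem_body (hTΩ p.2.1)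
    have h3 : Continuous fun p : ↥(T ×ˢ S) => Ω.finsler p.1.1 p.1.2 := by
      have h4 : ∀ p : ↥(T ×ˢ S), Ω.finsler p.1.1 p.1.2 =
          1 / 2 * (Ω.upperRatio (-p.1.2) p.1.1 + Ω.upperRatio p.1.2 p.1.1) := fun p =>
        finsler_eq_upperRatio (hTΩ p.2.1) p.2.2.2 (hS0 _ p.2.2)
      simp only [h4]
      exact continuous_const.mul
        ((continuous_upperRatio h2.neg h1 hp).add (continuous_upperRatio h2 h1 hp))
    exact h1.prodMk ((h3.inv₀ fun p =>
      (finsler_pos Ω (hTΩ p.2.1) p.2.2.2 (hS0 _ p.2.2)).ne').smul h2)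
  convert (hT.prod hSc).image_of_continuousOn hcont using 1
  ext p
  constructor
  · rintro ⟨u, hu, rfl⟩
    obtain ⟨⟨x, v⟩, huΩ⟩ := u
    have hv0 := ne_zero_of_mem_unitTangent Ω huΩ
    have hnorm : 0 < ‖v‖ := norm_pos_iff.2 hv0
    refine ⟨(x, ‖v‖⁻¹ • v), ⟨hu, ?_, ?_⟩, ?_⟩
    · rw [mem_sphere_zero_iff_norm, norm_smul, norm_inv, norm_norm, inv_mul_cancel₀ hnorm.ne']
    · rw [Set.mem_ofPred_eq, map_smul, show Ω.chart v = 0 from huΩ.2.1, smul_zero]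
    · have hF : Ω.finsler x v = 1 := huΩ.2.2
      simp only
      rw [finsler_smul Ω huΩ.1 huΩ.2.1 hv0 (inv_pos.2 hnorm), hF, mul_one, inv_inv,
        smul_inv_smul₀ hnorm.ne']
  · rintro ⟨⟨x, v⟩, ⟨hx, hv⟩, rfl⟩
    exact ⟨⟨_, exists_unitTangent_smul (hTΩ hx) hv.2 (hS0 v hv)⟩, hx, rfl⟩

/-- Equal points at time 1 make the vectors positively proportional, and both have Finsler norm one.
-/
lemma unitLine_injective : Function.Injective fun u : Ω.unitTangent => (unitLine u 0, unitLine u 1) := by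
  rintro ⟨⟨x, v⟩, hu⟩ ⟨⟨x', v'⟩, hu'⟩ h
  obtain ⟨h0, h1⟩ := Prod.mk.inj h
  rw [unitLine_zero, unitLine_zero] at h0
  obtain rfl : x = x' := congrArg Point.val h0
  have h2 : x + Ω.geodesicParam x v 1 • v = x + Ω.geodesicParam x v' 1 • v' :=
    congrArg Point.val h1
  have hx : x ∈ Ω.body := hu.1
  have hv : Ω.chart v = 0 := hu.2.1
  have hv' : Ω.chart v' = 0 := hu'.2.1
  have hv0 := ne_zero_of_mem_unitTangent Ω hu
  have hv0' := ne_zero_of_mem_unitTangent Ω hu'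
  have hp := (affineHilbertDist_geodesicParam Ω hx hv hv0 1).2.1 one_pos
  have hp' := (affineHilbertDist_geodesicParam Ω hx hv' hv0' 1).2.1 one_pos
  set p := Ω.geodesicParam x v 1
  set p' := Ω.geodesicParam x v' 1
  have h3 : v = (p⁻¹ * p') • v' := by
    rw [mul_smul, ← add_left_cancel h2, inv_smul_smul₀ hp.ne']
  have hF : Ω.finsler x v = 1 := hu.2.2
  have hF' : Ω.finsler x v' = 1 := hu'.2.2
  rw [h3, finsler_smul Ω hx hv' hv0' (by positivity), hF', mul_one] at hF
  rw [hF, one_smul] at h3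
  subst h3
  rfl

/-- The map is proper: bounded origins lie in a compact part of the domain, over which the unit
tangent vectors form a compact set. -/
lemma isClosedEmbedding_unitLine [Nonempty Ω.Point] :
    IsClosedEmbedding fun u : Ω.unitTangent => (unitLine u 0, unitLine u 1) := by
  have hc : Continuous fun u : Ω.unitTangent => (unitLine u 0, unitLine u 1) :=
    (continuous_unitLine 0).prodMk (continuous_unitLine 1)
  refine IsClosedEmbedding.of_continuous_injective_isClosedMap hc unitLine_injective ?_
  refine (isProperMap_iff_isCompact_preimage.2 ⟨hc, fun K hK => ?_⟩).isClosedMap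
  obtain ⟨o⟩ := ‹Nonempty Ω.Point›
  obtain ⟨r, hr⟩ := (hK.image continuous_fst).isBounded.subset_closedBall o
  obtain ⟨T, hT, hTc, h⟩ := exists_isCompact_of_dist_le o.2 r
  refine (isCompact_unitTangent_over hTc hT).of_isClosed_subset (hK.isClosed.preimage hc) ?_
  intro u hu
  refine h _ u.2.1 ?_
  have h1 : unitLine u 0 ∈ Metric.closedBall o r := hr (Set.mem_image_of_mem Prod.fst hu)
  rw [unitLine_zero, Metric.mem_closedBall, dist_comm] at h1
  exact h1

end ProperlyConvexDomain

namespace ProperlyConvexDomain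

variable {Ω : ProperlyConvexDomain n} {x y z w v : Fin (n + 1) → ℝ}

/-! ### Points of the domain as points of projective space -/

lemma coord_mk (hw : w ≠ 0) : Ω.coord (Projectivization.mk ℝ w hw) = (Ω.chart w)⁻¹ • w := by
  obtain ⟨a, ha⟩ := Projectivization.exists_smul_eq_mk_rep ℝ w hw
  rw [coord, ← ha, Units.smul_def, map_smul, smul_eq_mul, mul_inv, smul_smul, mul_right_comm,
    inv_mul_cancel₀ a.ne_zero, one_mul]

lemma coord_mem_body {p : RP n} (hp : p ∈ Ω.carrier) : Ω.coord p ∈ Ω.body :=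
  mem_body_iff_of_cone Ω ⟨p.rep_nonzero, by rwa [Projectivization.mk_rep]⟩

lemma Point.val_ne_zero (p : Ω.Point) : p.val ≠ 0 := p.mem.2.1

/-- A point of the domain, as a point of projective space. -/
def Point.toRP (p : Ω.Point) : RP n := Projectivization.mk ℝ p.val p.val_ne_zero

lemma Point.toRP_mem (p : Ω.Point) : p.toRP ∈ Ω.carrier := p.mem.2.2

/-- A point of projective space in the domain. -/
def toPoint (q : RP n) (hq : q ∈ Ω.carrier) : Ω.Point := ⟨Ω.coord q, coord_mem_body hq⟩

lemma coord_toRP (p : Ω.Point) : Ω.coord p.toRP = p.val := by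
  rw [Point.toRP, coord_mk, p.mem.1, inv_one, one_smul]

lemma toPoint_toRP (p : Ω.Point) : toPoint p.toRP p.toRP_mem = p := Point.ext (coord_toRP p)

lemma toRP_toPoint {q : RP n} (hq : q ∈ Ω.carrier) : (toPoint q hq).toRP = q := by
  have h : q.rep ∈ coneOver Ω.carrier := ⟨q.rep_nonzero, by rwa [Projectivization.mk_rep]⟩
  conv_rhs => rw [← q.mk_rep]
  exact (Projectivization.mk_eq_mk_iff' ℝ _ _ _ _).2 ⟨_, rfl⟩

lemma hilbertDist_eq_dist {p q : RP n} (hp : p ∈ Ω.carrier) (hq : q ∈ Ω.carrier) :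
    Ω.hilbertDist p q = dist (toPoint p hp) (toPoint q hq) := rfl

lemma smul_mem_carrier {γ : PSL n} (hγ : γ ∈ Ω.Aut) {q : RP n} (hq : q ∈ Ω.carrier) :
    γ • q ∈ Ω.carrier := by
  have h : γ • Ω.carrier = Ω.carrier := hγ
  rw [← h]
  exact Set.smul_mem_smul_set hq

/-- Transported from `ℝℙⁿ`. The acting group is `Ω.Aut`, since a general element of `PSL n` does not
preserve the domain. -/
instance : MulAction Ω.Aut Ω.Point where
  smul γ p := toPoint ((γ : PSL n) • p.toRP) (smul_mem_carrier γ.2 p.toRP_mem)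
  one_smul p := by
    refine (Point.ext ?_ : toPoint _ _ = p)
    change Ω.coord ((1 : PSL n) • p.toRP) = _
    rw [one_smul, coord_toRP]
  mul_smul γ γ' p := by
    refine Point.ext ?_
    change Ω.coord (((γ : PSL n) * (γ' : PSL n)) • p.toRP) =
      Ω.coord ((γ : PSL n) • (toPoint ((γ' : PSL n) • p.toRP) _).toRP)
    rw [toRP_toPoint, mul_smul]

lemma smul_point_def (γ : Ω.Aut) (p : Ω.Point) :
    γ • p = toPoint ((γ : PSL n) • p.toRP) (smul_mem_carrier γ.2 p.toRP_mem) := rfl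

lemma toRP_smul (γ : Ω.Aut) (p : Ω.Point) : (γ • p).toRP = (γ : PSL n) • p.toRP := by
  rw [smul_point_def, toRP_toPoint]

lemma val_smul (g : SL n) (hg : (g : PSL n) ∈ Ω.Aut) (p : Ω.Point) :
    ((⟨(g : PSL n), hg⟩ : Ω.Aut) • p).val = Ω.chartMap g p.val :=
  coord_mk (Ω := Ω) (w := g • p.val) ((smul_ne_zero_iff_ne g).2 p.val_ne_zero)

lemma isOpen_inter_preimage_coord {W : Set (Fin (n + 1) → ℝ)} (hW : IsOpen W) :
    IsOpen (Ω.carrier ∩ Ω.coord ⁻¹' W) := by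
  refine isOpen_coinduced.2 ?_
  have h1 : ContinuousOn (fun w => (Ω.chart w)⁻¹ • w) (coneOver Ω.carrier) :=
    (Ω.continuous_chart.continuousOn.inv₀ Ω.chart_ne_zero).smul continuousOn_id
  have h2 := h1.isOpen_inter_preimage (isOpen_coneOver Ω.isOpen) hW
  convert h2.preimage (continuous_subtype_val (p := fun w : Fin (n + 1) → ℝ => w ≠ 0)) using 1
  ext ⟨w, hw⟩
  simp only [Set.mem_preimage, Set.mem_inter_iff, Projectivization.mk'_eq_mk]
  rw [coord_mk]
  exact and_congr_left fun _ => ⟨fun h => ⟨hw, h⟩, fun h => h.2⟩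

lemma continuous_coord : Continuous fun q : Ω.carrier => Ω.coord q := by
  have : ContinuousOn Ω.coord Ω.carrier :=
    (continuousOn_open_iff Ω.isOpen).2 fun W hW => isOpen_inter_preimage_coord hW
  exact continuousOn_iff_continuous_domRestrict.1 this

lemma continuous_toPoint_carrier : Continuous fun q : Ω.carrier => toPoint q.1 q.2 :=
  continuous_toPoint continuous_coord _

/-- Openness in `ℝℙⁿ` makes the Hilbert balls Borel sets, as the volume estimates require. -/
lemma isOpen_ball {p : RP n} (hp : p ∈ Ω.carrier) (r : ℝ) : IsOpen (Ω.ball p r) := by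
  have h1 : IsOpen {q : Ω.carrier | dist (toPoint p hp) (toPoint q.1 q.2) < r} :=
    isOpen_lt (continuous_const.dist continuous_toPoint_carrier) continuous_const
  convert Ω.isOpen.isOpenMap_subtype_val _ h1 using 1
  ext q
  constructor
  · rintro ⟨hq, h⟩
    exact ⟨⟨q, hq⟩, h, rfl⟩
  · rintro ⟨⟨q, hq⟩, h, rfl⟩
    exact ⟨hq, h⟩

/-! ### The action on lines -/

/-- Unit tangent vectors are moved by the derivatives of automorphisms. -/
lemma lineDeriv_mem_unitTangent {g : SL n} (hg : (g : PSL n) ∈ Ω.Aut) (hu : (x, v) ∈ Ω.unitTangent) :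
    (Ω.chartMap g x, lineDeriv ℝ (Ω.chartMap g) x v) ∈ Ω.unitTangent := by
  have hv0 := ne_zero_of_mem_unitTangent Ω hu
  refine ⟨chartMap_mem hg hu.1, chart_lineDeriv (chart_smul_ne_zero hg hu.1) v, ?_⟩
  have h := finsler_lineDeriv hg hu.1 hu.2.1 hv0
  exact h.trans hu.2.2

lemma unitLine_lineDeriv {g : SL n} (hg : (g : PSL n) ∈ Ω.Aut) (u : Ω.unitTangent) (s : ℝ) :
    unitLine ⟨_, lineDeriv_mem_unitTangent hg u.2⟩ s = (⟨(g : PSL n), hg⟩ : Ω.Aut) • unitLine u s := by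
  apply Point.ext
  rw [val_smul]
  exact geodesicLine_equivariant hg u.2.1 u.2.2.1 (ne_zero_of_mem_unitTangent Ω u.2) s

lemma exists_unitLine_eq_smul (γ : Ω.Aut) (u : Ω.unitTangent) :
    ∃ v : Ω.unitTangent, ∀ s, unitLine v s = γ • unitLine u s := by
  obtain ⟨γ, hγ⟩ := γ
  obtain ⟨g, rfl⟩ := QuotientGroup.mk_surjective γ
  exact ⟨_, unitLine_lineDeriv hγ u⟩

lemma eq_of_unitLine_eq {u v : Ω.unitTangent} (h : ∀ s, unitLine u s = unitLine v s) : u = v :=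
  unitLine_injective (Prod.ext (h 0) (h 1))

/-- A unit vector is determined by its line, so identification by derivatives is the same as
identification of lines by the group. -/
lemma tangentRel_iff {Γ : Subgroup (PSL n)} (hΓ : Γ ≤ Ω.Aut) (u v : Ω.unitTangent) :
    tangentRel Ω Γ u v ↔ ∃ γ : Γ.subgroupOf Ω.Aut, ∀ s, unitLine v s = γ • unitLine u s := by
  constructor
  · rintro ⟨g, hg, h1, h2⟩
    refine ⟨⟨⟨g, hΓ hg⟩, hg⟩, fun s => ?_⟩
    have : v = ⟨_, lineDeriv_mem_unitTangent (hΓ hg) u.2⟩ := Subtype.ext (Prod.ext h1 h2)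
    rw [this]
    exact unitLine_lineDeriv (hΓ hg) u s
  · rintro ⟨⟨⟨γ, hγ'⟩, hγ⟩, h⟩
    obtain ⟨g, rfl⟩ := QuotientGroup.mk_surjective γ
    have : v = ⟨_, lineDeriv_mem_unitTangent hγ' u.2⟩ :=
      eq_of_unitLine_eq fun s => (h s).trans (unitLine_lineDeriv hγ' u s).symm
    subst this
    exact ⟨g, hγ, rfl, rfl⟩

/-- Distances are read off on unit speed lines, which automorphisms map to unit speed lines. -/
lemma isIsometricSMul (hn : 0 < n) (H : Subgroup Ω.Aut) : IsIsometricSMul H Ω.Point := by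
  refine ⟨fun γ => Isometry.of_dist_eq fun p q => ?_⟩
  obtain ⟨u, hu0, hu1⟩ := exists_unitLine hn p q
  obtain ⟨v, hv⟩ := exists_unitLine_eq_smul (γ : Ω.Aut) u
  have h1 : γ • p = unitLine v 0 := by rw [hv, hu0]; rfl
  have h2 : γ • q = unitLine v (dist p q) := by rw [hv, hu1]; rfl
  rw [h1, h2, dist_unitLine, zero_sub, abs_neg, abs_of_nonneg dist_nonneg]

/-! ### Discrete groups act with finite orbit counts -/

lemma chart_smul_real (c : ℝ) (w : Fin (n + 1) → ℝ) : Ω.chart (c • w) = c * Ω.chart w :=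
  Ω.chart.map_smul c w

/-- The form `chart ∘ g` has no zero on the cone, and values of opposite signs would give one at a
positive combination of `x` and `y`. -/
lemma chart_smul_mul_pos {g : SL n} (hg : (g : PSL n) ∈ Ω.Aut) (hx : x ∈ Ω.cone) (hy : y ∈ Ω.cone) :
    0 < Ω.chart (g • x) * Ω.chart (g • y) := by
  have hne : ∀ w ∈ Ω.cone, Ω.chart (g • w) ≠ 0 := fun w hw =>
    Ω.chart_ne_zero _ (smul_mem_coneOver_of_aut hg hw.2)
  by_contra hle
  push Not at hle
  have hlt := hle.lt_of_ne (mul_ne_zero (hne x hx) (hne y hy))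
  have h1 := add_mem_cone (smul_mem_cone (abs_pos.2 (hne y hy)) hx)
    (smul_mem_cone (abs_pos.2 (hne x hx)) hy)
  apply hne _ h1
  rw [smul_add, smul_real, smul_real, map_add, chart_smul_real, chart_smul_real]
  rcases mul_neg_iff.1 hlt with ⟨h2, h3⟩ | ⟨h2, h3⟩
  · rw [abs_of_neg h3, abs_of_pos h2]
    ring
  · rw [abs_of_pos h3, abs_of_neg h2]
    ring

/-- The values of `chart ∘ g` at `y` and at `c • x - y` have the same sign, so the first is at most
their sum in absolute value. -/
lemma abs_chart_smul_le {g : SL n} (hg : (g : PSL n) ∈ Ω.Aut) (hy : y ∈ Ω.cone) {c : ℝ}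
    (hxy : c • x - y ∈ Ω.cone) : |Ω.chart (g • y)| ≤ |c * Ω.chart (g • x)| := by
  have h := chart_smul_mul_pos hg hy hxy
  rw [smul_sub, smul_real, map_sub, chart_smul_real] at h
  rw [← sq_le_sq]
  nlinarith [sq_nonneg (c * Ω.chart (g • x) - Ω.chart (g • y))]

/-- Automorphisms are controlled by their value at one point. -/
lemma exists_abs_entry_le (hx : x ∈ Ω.body) : ∃ C : ℝ, 0 < C ∧ ∀ g : SL n, (g : PSL n) ∈ Ω.Aut →
    ∀ i j, |g.1 i j| ≤ C * |Ω.chart (g • x)| := by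
  obtain ⟨R, hR⟩ := Ω.isBounded.exists_norm_le
  have hR0 : 0 ≤ R := (norm_nonneg _).trans (hR x hx)
  have hxC := mem_cone_of_mem_body hx
  obtain ⟨ε, hε, hball⟩ := Metric.isOpen_iff.1 Ω.isOpen_cone x hxC
  -- Testing `g` on the basis vectors scaled by `ε / 2` turns the bound `3 R s` into `6 R s / ε`;
  -- the summand 1 keeps the constant positive.
  refine ⟨(6 * R + 1) / ε, by positivity, fun g hg i j => ?_⟩
  have hnorm : ∀ y ∈ Ω.cone, ‖g • y‖ ≤ R * |Ω.chart (g • y)| := by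
    intro y hy
    have h1 := smul_mem_coneOver_of_aut hg hy.2
    have h2 := hR _ (mem_body_iff_of_cone Ω h1)
    have h3 := Ω.chart_ne_zero _ h1
    rw [norm_smul, norm_inv, Real.norm_eq_abs, inv_mul_le_iff₀ (abs_pos.2 h3)] at h2
    linarith
  set s := |Ω.chart (g • x)|
  -- `x + w` and `2 x - (x + w) = x - w` both lie in the cone, so the chart value of `g (x + w)` is
  -- at most `2 s` in absolute value.
  have hsmall : ∀ w : Fin (n + 1) → ℝ, ‖w‖ < ε → ‖g • w‖ ≤ 3 * R * s := by
    intro w hw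
    have h1 : x + w ∈ Ω.cone := hball (by simpa using hw)
    have h2 : x - w ∈ Ω.cone := hball (by simpa using hw)
    have h3 : (2 : ℝ) • x - (x + w) ∈ Ω.cone := by
      convert h2 using 1
      module
    have h4 := abs_chart_smul_le hg h1 h3
    rw [abs_mul, abs_two] at h4
    have h5 : ‖g • (x + w)‖ ≤ R * (2 * s) := (hnorm _ h1).trans (by gcongr)
    have h6 := hnorm x hxC
    have h7 := norm_sub_le (g • (x + w)) (g • x)
    rw [smul_add, add_sub_cancel_left] at h7
    rw [smul_add] at h5
    linarith
  have hw := hsmall ((ε / 2) • Pi.single j 1) (by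
    rw [norm_smul, Real.norm_of_nonneg (by positivity), Pi.norm_single, norm_one]
    linarith)
  rw [smul_real, norm_smul, Real.norm_of_nonneg (by positivity)] at hw
  have he : (g • (Pi.single j 1 : Fin (n + 1) → ℝ)) i = g.1 i j := by
    rw [Matrix.SpecialLinearGroup.smul_def, Matrix.smul_eq_mulVec, Matrix.mulVec_single_one]
    rfl
  have h8 := norm_le_pi_norm (g • (Pi.single j 1 : Fin (n + 1) → ℝ)) i
  rw [he, Real.norm_eq_abs] at h8
  have hs : 0 ≤ s := abs_nonneg _
  rw [div_mul_eq_mul_div, le_div_iff₀ hε]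
  nlinarith

/-- A small chart value would make all entries small, contradicting determinant 1 through `1 ≤ (n +
1)! (C s)^(n + 1)`. -/
lemma exists_le_abs_chart_smul (hx : x ∈ Ω.body) : ∃ c : ℝ, 0 < c ∧ ∀ g : SL n,
    (g : PSL n) ∈ Ω.Aut → c ≤ |Ω.chart (g • x)| := by
  obtain ⟨C, hC, hCg⟩ := exists_abs_entry_le hx
  set F : ℝ := ((n + 1).factorial : ℝ) with hF
  have hF1 : 1 ≤ F := by
    rw [hF]
    exact_mod_cast Nat.succ_le_of_lt (Nat.factorial_pos _)
  refine ⟨(C * F)⁻¹, by positivity, fun g hg => ?_⟩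
  by_contra hlt
  push Not at hlt
  set s := |Ω.chart (g • x)|
  have hs : 0 ≤ s := abs_nonneg _
  have h1 := Matrix.det_le (abv := AbsoluteValue.abs) (hCg g hg)
  rw [show Matrix.det g.1 = 1 from g.2] at h1
  simp only [AbsoluteValue.abs_apply, abs_one, Fintype.card_fin, nsmul_eq_mul] at h1
  have h2 : C * s < F⁻¹ := by
    rw [mul_inv] at hlt
    calc C * s < C * (C⁻¹ * F⁻¹) := by gcongr
      _ = F⁻¹ := mul_inv_cancel_left₀ hC.ne' _
  have h3 : (C * s) ^ (n + 1) ≤ C * s :=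
    pow_le_of_le_one (by positivity) (h2.le.trans (inv_le_one_of_one_le₀ hF1)) (by omega)
  have h4 : F * (C * s) ^ (n + 1) < 1 := by
    calc F * (C * s) ^ (n + 1) ≤ F * (C * s) := by gcongr
      _ < F * F⁻¹ := by gcongr
      _ = 1 := mul_inv_cancel₀ (by positivity)
  linarith

/-- Automorphisms that move a point by a bounded amount have bounded entries. -/
lemma exists_abs_entry_le_of_dist_le (hx : x ∈ Ω.body) (r : ℝ) : ∃ B : ℝ, ∀ g : SL n,
    (g : PSL n) ∈ Ω.Aut → affineHilbertDist Ω.body x (Ω.chartMap g x) ≤ r →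
      ∀ i j, |g.1 i j| ≤ B := by
  obtain ⟨C, hC, hCg⟩ := exists_abs_entry_le hx
  obtain ⟨c, hc, hcg⟩ := exists_le_abs_chart_smul hx
  refine ⟨C * ((Real.exp (2 * r) + 1) / c), fun g hg hd i j => (hCg g hg i j).trans ?_⟩
  gcongr
  have hgx := chart_smul_ne_zero hg hx
  have hk := chartMap_mem hg hx
  have h1 : Ω.upperRatio x (Ω.chartMap g x) < Real.exp (2 * r) + 1 := by
    have h2 := upperRatio_le_exp hx hk
    have h3 := Real.exp_le_exp.2 (show 2 * affineHilbertDist Ω.body x (Ω.chartMap g x) ≤ 2 * r by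
      linarith)
    linarith
  have h2 := (upperRatio_lt_iff (mem_cone_of_mem_body hk)).1 h1
  -- The lower bound is applied to `g⁻¹`, which sends the image of `x` to `x` divided by the chart
  -- value of `g x`. Thus it turns into an upper bound for that value.
  have hg' : ((g⁻¹ : SL n) : PSL n) ∈ Ω.Aut := inv_mem hg
  have h3 := abs_chart_smul_le hg' (mem_cone_of_mem_body hx) h2
  have e : g⁻¹ • Ω.chartMap g x = (Ω.chart (g • x))⁻¹ • x := by
    rw [chartMap, smul_comm, inv_smul_smul]
  rw [e, chart_smul_real, hx.1, mul_one, abs_mul, abs_inv,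
    abs_of_pos (show 0 < Real.exp (2 * r) + 1 by positivity)] at h3
  have h4 := (hcg _ hg').trans h3
  rw [← div_eq_mul_inv, le_div_iff₀ (abs_pos.2 hgx)] at h4
  rw [le_div_iff₀ hc]
  linarith

end ProperlyConvexDomain

lemma isCompact_setOf_entry_le (B : ℝ) : IsCompact {g : SL n | ∀ i j, |g.1 i j| ≤ B} := by
  have h : IsCompact (Set.univ.pi fun _ : Fin (n + 1) => Set.univ.pi fun _ : Fin (n + 1) =>
      Set.Icc (-B) B) := isCompact_univ_pi fun _ => isCompact_univ_pi fun _ => isCompact_Icc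
  have h2 := (Matrix.SpecialLinearGroup.isClosedEmbedding_val (n := Fin (n + 1))
    (R := ℝ)).isCompact_preimage h
  have e : {g : SL n | ∀ i j, |g.1 i j| ≤ B} = (fun g : SL n => g.1) ⁻¹'
      (Set.univ.pi fun _ : Fin (n + 1) => Set.univ.pi fun _ : Fin (n + 1) => Set.Icc (-B) B) := by
    ext g
    exact ⟨fun h i _ j _ => abs_le.1 (h i j), fun h i j => abs_le.2 (h i trivial j trivial)⟩
  rw [e]
  exact h2

/-- The quotient by the closed center is regular Hausdorff; this is what makes discrete subgroups
closed. -/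
instance : T2Space (PSL n) := by
  have h : IsClosed (Subgroup.center (SL n) : Set (SL n)) := by
    have h1 : (Subgroup.center (SL n) : Set (SL n)) = Set.centralizer Set.univ :=
      (Set.centralizer_univ _).symm
    rw [h1]
    exact Set.isClosed_centralizer _
  have : T3Space (PSL n) := QuotientGroup.instT3Space _
  infer_instance

/-- Discrete groups of automorphisms have finite orbit counts. -/
lemma Divides.finite_orbit {Γ : Subgroup (PSL n)} {Ω : ProperlyConvexDomain n} (hΓ : Divides Γ Ω)
    (o : Ω.Point) (r : ℝ) : {γ : Γ.subgroupOf Ω.Aut | dist o (γ • o) ≤ r}.Finite := by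
  obtain ⟨B, hB⟩ := ProperlyConvexDomain.exists_abs_entry_le_of_dist_le o.mem r
  have := hΓ.discrete
  have hcl : IsClosed (Γ : Set (PSL n)) := Subgroup.isClosed_of_discrete
  -- A closed discrete group meets the compact image of the matrices with bounded entries in a
  -- finite set.
  have hQ : IsCompact ((Γ : Set (PSL n)) ∩
      ((QuotientGroup.mk : SL n → PSL n) '' {g : SL n | ∀ i j, |g.1 i j| ≤ B})) :=
    ((isCompact_setOf_entry_le B).image continuous_quot_mk).inter_left hcl
  have hdisc : IsDiscrete (Γ : Set (PSL n)) := ⟨hΓ.discrete⟩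
  have hfin := hQ.finite (hdisc.mono Set.inter_subset_left)
  refine Set.Finite.of_injOn (f := fun γ : Γ.subgroupOf Ω.Aut => ((γ : Ω.Aut) : PSL n)) ?_ ?_ hfin
  · rintro ⟨⟨γ, hγ'⟩, hγ⟩ h
    refine ⟨hγ, ?_⟩
    obtain ⟨g, rfl⟩ := QuotientGroup.mk_surjective γ
    refine ⟨g, hB g hγ' ?_, rfl⟩
    have h1 : dist o ((⟨(g : PSL n), hγ'⟩ : Ω.Aut) • o) ≤ r := h
    rwa [ProperlyConvexDomain.Point.dist_def, ProperlyConvexDomain.val_smul] at h1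
  · intro a _ b _ hab
    exact Subtype.ext (Subtype.ext hab)

/-- A compact set with dense enough translates in `ℝℙⁿ` is also bounded for the Hilbert metric,
because the passage from the domain to `Point` is continuous. -/
lemma Divides.cobounded {Γ : Subgroup (PSL n)} {Ω : ProperlyConvexDomain n} (hΓ : Divides Γ Ω)
    (hn : 0 < n) (o : Ω.Point) :
    ∃ c : ℝ, 0 ≤ c ∧ ∀ y : Ω.Point, ∃ γ : Γ.subgroupOf Ω.Aut, dist (γ • o) y ≤ c := by
  have := ProperlyConvexDomain.isIsometricSMul hn (Γ.subgroupOf Ω.Aut)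
  obtain ⟨K, hK, hKΩ, hcov⟩ := hΓ.cocompact
  have hK' : IsCompact (Subtype.val ⁻¹' K : Set Ω.carrier) := by
    rw [Subtype.isCompact_iff, Subtype.image_preimage_coe, Set.inter_eq_right.2 hKΩ]
    exact hK
  obtain ⟨c, hc⟩ := (hK'.image
    ProperlyConvexDomain.continuous_toPoint_carrier).isBounded.subset_closedBall o
  refine ⟨max c 0, le_max_right _ _, fun y => ?_⟩
  have hy := hcov y.toRP_mem
  simp only [Set.mem_iUnion] at hy
  obtain ⟨γ, hγ, q, hq, hqy⟩ := hy
  set γ' : Γ.subgroupOf Ω.Aut := ⟨⟨γ, hΓ.le_aut hγ⟩, hγ⟩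
  refine ⟨γ', ?_⟩
  have h1 := hc (Set.mem_image_of_mem _ (show (⟨q, hKΩ hq⟩ : Ω.carrier) ∈ _ from hq))
  have h2 : γ' • ProperlyConvexDomain.toPoint q (hKΩ hq) = y := by
    apply ProperlyConvexDomain.Point.ext
    rw [← ProperlyConvexDomain.coord_toRP, ← ProperlyConvexDomain.coord_toRP y]
    change Ω.coord ((γ' : Ω.Aut) • ProperlyConvexDomain.toPoint q (hKΩ hq)).toRP = _
    rw [ProperlyConvexDomain.toRP_smul, ProperlyConvexDomain.toRP_toPoint, ← hqy]
  rw [← h2, dist_smul, dist_comm]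
  exact le_trans h1 (le_max_left _ _)

variable {Ω : ProperlyConvexDomain n} {Γ : Subgroup (PSL n)}

open ProperlyConvexDomain

/-! ### The geometry of a divided domain -/

lemma Divides.isGeometricAction (hΓ : Divides Γ Ω) (hn : 0 < n) :
    IsGeometricAction (Γ.subgroupOf Ω.Aut) Ω.Point where
  finite_orbit := hΓ.finite_orbit
  cobounded := hΓ.cobounded hn
  geodesic x y t h0 ht := by
    obtain ⟨u, hu0, hu1⟩ := exists_unitLine hn x y
    refine ⟨unitLine u t, ?_, ?_⟩
    · rw [← hu0, dist_unitLine_zero, abs_of_nonneg h0]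
    · conv_lhs => rw [← hu1]
      rw [dist_unitLine, abs_sub_comm, abs_of_nonneg (by linarith)]

lemma lineSystem_unitLine [Nonempty Ω.Point] (hn : 0 < n) (H : Subgroup Ω.Aut) :
    LineSystem H (unitLine (Ω := Ω)) where
  dist_eq := dist_unitLine
  isClosedEmbedding := isClosedEmbedding_unitLine
  exists_line := exists_unitLine hn
  exists_reverse := exists_reverse_unitLine
  exists_shift u t := ⟨_, unitLine_geodesicFlowDomain u t⟩
  exists_smul g u := exists_unitLine_eq_smul (g : Ω.Aut) u
  continuous := continuous_unitLine
  mono u v _ _ h h0 h1 := dist_unitLine_mono u v h h0 h1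

lemma isQuotientFlow_geodesicFlow (hΓ : Γ ≤ Ω.Aut) :
    IsQuotientFlow (Γ.subgroupOf Ω.Aut) (unitLine (Ω := Ω))
      (Quotient.mk (unitTangentSetoid Ω Γ) : _ → UnitTangentBundle Ω Γ) (geodesicFlow Γ hΓ) where
  isQuotientMap := isQuotientMap_quotient_mk'
  eq_iff u v := by
    rw [← tangentRel_iff hΓ]
    exact Quotient.eq
  flow t u v h := by
    have : v = geodesicFlowDomain Ω t u :=
      eq_of_unitLine_eq fun s => (h s).trans (unitLine_geodesicFlowDomain u t s).symm
    rw [this]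
    rfl

/-! ### The critical exponent -/

lemma orbitCount_eq (hΓ : Divides Γ Ω) {p : RP n} (hp : p ∈ Ω.carrier) (t : ℝ) :
    orbitCount Ω Γ p t = orbitGrowth (Γ.subgroupOf Ω.Aut) (toPoint p hp) t := by
  have hinj : Function.Injective fun γ : Γ.subgroupOf Ω.Aut => ((γ : Ω.Aut) : PSL n) :=
    fun a b hab => Subtype.ext (Subtype.ext hab)
  rw [orbitGrowth, Set.Finite.cast_ncard_eq (hΓ.finite_orbit _ _), ← hinj.encard_image, orbitCount]
  congr 1
  have key : ∀ γ : Γ.subgroupOf Ω.Aut, dist (toPoint p hp) (γ • toPoint p hp) =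
      Ω.hilbertDist p (((γ : Ω.Aut) : PSL n) • p) := by
    intro γ
    rw [hilbertDist_eq_dist hp (smul_mem_carrier γ.1.2 hp)]
    congr 1
    change toPoint (((γ : Ω.Aut) : PSL n) • (toPoint p hp).toRP) _ = _
    simp only [toRP_toPoint]
  ext γ
  constructor
  · rintro ⟨hγ, h⟩
    exact ⟨⟨⟨γ, hΓ.le_aut hγ⟩, hγ⟩, (key _).trans_le h, rfl⟩
  · rintro ⟨γ, h, rfl⟩
    exact ⟨γ.2, (key γ).symm.trans_le h⟩

lemma criticalExponent_eq (hΓ : Divides Γ Ω) (hn : 0 < n) {p : RP n} (hp : p ∈ Ω.carrier) {h : ℝ}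
    (hh : Tendsto (fun t => Real.log (orbitGrowth (Γ.subgroupOf Ω.Aut) (toPoint p hp) t) / t)
      atTop (𝓝 h)) : criticalExponent Ω Γ p = (h : EReal) := by
  have h1 := (continuous_coe_real_ereal.tendsto h).comp hh
  refine Tendsto.limsup_eq (h1.congr' ?_)
  filter_upwards [eventually_ge_atTop 0] with t ht
  have h2 := (hΓ.isGeometricAction hn).one_le_orbitGrowth (toPoint p hp) ht
  rw [orbitCount_eq hΓ hp, log_natCast (by omega), Function.comp, EReal.coe_div]

/-! ### The volume entropy -/

lemma log_mul_natCast {a : ℝ≥0} (ha : 0 < a) {k : ℕ} (hk : 0 < k) :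
    ENNReal.log ((a : ℝ≥0∞) * k) = ((Real.log a + Real.log k : ℝ) : EReal) := by
  have h1 : (a : ℝ≥0∞) ≠ 0 := ENNReal.coe_ne_zero.2 ha.ne'
  have h2 : (k : ℝ≥0∞) ≠ 0 := by exact_mod_cast hk.ne'
  rw [ENNReal.log_pos_real (mul_ne_zero h1 h2)
    (ENNReal.mul_ne_top ENNReal.coe_ne_top (ENNReal.natCast_ne_top k)), ENNReal.toReal_mul,
    ENNReal.coe_toReal, ENNReal.toReal_natCast, Real.log_mul (by exact_mod_cast ha.ne')
    (by exact_mod_cast hk.ne')]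

/-- Measurable sets that cover each point at most `K` times. -/
lemma sum_measure_le_of_multiplicity {α ι : Type*} [MeasurableSpace α] (μ : Measure α)
    (F : Finset ι) (A : ι → Set α) (B : Set α) (K : ℕ) (hA : ∀ i ∈ F, MeasurableSet (A i))
    (hB : MeasurableSet B) (hAB : ∀ i ∈ F, A i ⊆ B)
    (hK : ∀ x, ∃ S : Finset ι, S.card ≤ K ∧ ∀ i ∈ F, x ∈ A i → i ∈ S) :
    ∑ i ∈ F, μ (A i) ≤ K * μ B := by
  classical
  calc ∑ i ∈ F, μ (A i) = ∑ i ∈ F, ∫⁻ x, (A i).indicator 1 x ∂μ :=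
        Finset.sum_congr rfl fun i hi => (lintegral_indicator_one (hA i hi)).symm
    _ = ∫⁻ x, ∑ i ∈ F, (A i).indicator 1 x ∂μ :=
        (lintegral_finsetSum F fun i hi => measurable_one.indicator (hA i hi)).symm
    _ ≤ ∫⁻ x, B.indicator (fun _ => (K : ℝ≥0∞)) x ∂μ := by
        refine lintegral_mono fun x => ?_
        simp only [Set.indicator_apply, Pi.one_apply]
        rw [Finset.sum_ite, Finset.sum_const_zero, add_zero, Finset.sum_const, nsmul_eq_mul, mul_one]
        split_ifs with hx
        · obtain ⟨S, hS, hFS⟩ := hK x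
          have : (F.filter fun i => x ∈ A i).card ≤ K := (Finset.card_le_card fun i hi =>
            hFS i (Finset.mem_filter.1 hi).1 (Finset.mem_filter.1 hi).2).trans hS
          exact_mod_cast this
        · rw [Finset.filter_eq_empty_iff.2 fun i hi hxi => hx (hAB i hi hxi)]
          simp
    _ = K * μ B := lintegral_indicator_const hB _

instance : BorelSpace (RP n) := ⟨rfl⟩

lemma mem_ball_iff {p q : RP n} (hp : p ∈ Ω.carrier) {r : ℝ} :
    q ∈ Ω.ball p r ↔ ∃ hq : q ∈ Ω.carrier, dist (toPoint p hp) (toPoint q hq) < r :=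
  ⟨fun h => ⟨h.1, h.2⟩, fun ⟨hq, h⟩ => ⟨hq, h⟩⟩

lemma mem_ball_toRP {x : Ω.Point} {q : RP n} {r : ℝ} :
    q ∈ Ω.ball x.toRP r ↔ ∃ hq : q ∈ Ω.carrier, dist x (toPoint q hq) < r := by
  rw [mem_ball_iff x.toRP_mem, toPoint_toRP]

/-- The ball is covered by unit balls around translates of a finite net of a compact ball; only
elements moving `o` by at most `r + c` are needed. -/
lemma exists_volume_le (hΓ : Divides Γ Ω) (hn : 0 < n) {vol : Measure (RP n)} {C : ℝ≥0}
    (hC : ∀ p ∈ Ω.carrier, vol (Ω.ball p 1) ≤ C) (o : Ω.Point) : ∃ (A : ℕ) (c : ℝ), 0 < A ∧ 0 ≤ c ∧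
      ∀ r, vol (Ω.ball o.toRP r) ≤
        ((C * A : ℝ≥0) : ℝ≥0∞) * orbitGrowth (Γ.subgroupOf Ω.Aut) o (r + c) := by
  classical
  have := isIsometricSMul hn (Γ.subgroupOf Ω.Aut)
  obtain ⟨c, hc0, hc⟩ := hΓ.cobounded hn o
  obtain ⟨P, -, hPf, hP⟩ := (isCompact_closedBall o c).finite_cover_balls one_pos
  have hPne : 0 < hPf.toFinset.card := by
    obtain ⟨p, hp, -⟩ := Set.mem_iUnion₂.1 (hP (Metric.mem_closedBall_self hc0))
    exact Finset.card_pos.2 ⟨p, hPf.mem_toFinset.2 hp⟩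
  refine ⟨hPf.toFinset.card, c, hPne, hc0, fun r => ?_⟩
  have hfin := hΓ.finite_orbit o (r + c)
  have hsub : Ω.ball o.toRP r ⊆
      ⋃ g ∈ hfin.toFinset ×ˢ hPf.toFinset, Ω.ball (g.1 • g.2 : Ω.Point).toRP 1 := by
    intro q hq
    obtain ⟨hqΩ, hd⟩ := mem_ball_toRP.1 hq
    obtain ⟨γ, hγ⟩ := hc (toPoint q hqΩ)
    have h1 : γ⁻¹ • toPoint q hqΩ ∈ Metric.closedBall o c := by
      rwa [Metric.mem_closedBall, ← dist_smul γ, smul_inv_smul, dist_comm]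
    obtain ⟨x, hx, hxd⟩ := Set.mem_iUnion₂.1 (hP h1)
    refine Set.mem_iUnion₂.2 ⟨(γ, x), ?_, ?_⟩
    · rw [Finset.mem_product, Set.Finite.mem_toFinset, Set.Finite.mem_toFinset]
      refine ⟨?_, hx⟩
      rw [Set.mem_ofPred_eq]
      have := dist_triangle_right o (γ • o) (toPoint q hqΩ)
      linarith
    · refine mem_ball_toRP.2 ⟨hqΩ, ?_⟩
      rw [Metric.mem_ball, ← dist_smul γ, smul_inv_smul, dist_comm] at hxd
      exact hxd
  calc vol (Ω.ball o.toRP r)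
      ≤ ∑ g ∈ hfin.toFinset ×ˢ hPf.toFinset, vol (Ω.ball (g.1 • g.2 : Ω.Point).toRP 1) :=
        (measure_mono hsub).trans (measure_biUnion_finset_le _ _)
    _ ≤ ∑ g ∈ hfin.toFinset ×ˢ hPf.toFinset, (C : ℝ≥0∞) :=
        Finset.sum_le_sum fun g _ => hC _ (Point.toRP_mem _)
    _ = _ := by
        rw [Finset.sum_const, Finset.card_product, orbitGrowth, Set.ncard_eq_toFinset_card _ hfin,
          nsmul_eq_mul]
        push_cast
        ring

/-- Unit balls around the orbit points within `r - 1` lie in the ball of radius `r`. Counted with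
group elements, each point lies in at most `K` of them, which also accounts for stabilizers. -/
lemma exists_le_volume (hΓ : Divides Γ Ω) (hn : 0 < n) {vol : Measure (RP n)} {c : ℝ≥0}
    (hc : ∀ p ∈ Ω.carrier, c ≤ vol (Ω.ball p 1)) (o : Ω.Point) : ∃ K : ℕ, 0 < K ∧
      ∀ r, (c : ℝ≥0∞) * orbitGrowth (Γ.subgroupOf Ω.Aut) o (r - 1) ≤ K * vol (Ω.ball o.toRP r) := by
  have := isIsometricSMul hn (Γ.subgroupOf Ω.Aut)
  obtain ⟨K, hK0, hK⟩ := (hΓ.isGeometricAction hn).exists_ncard_dist_smul_le 1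
  refine ⟨K, hK0, fun r => ?_⟩
  have hfin := hΓ.finite_orbit o (r - 1)
  calc (c : ℝ≥0∞) * orbitGrowth (Γ.subgroupOf Ω.Aut) o (r - 1)
      = ∑ γ ∈ hfin.toFinset, (c : ℝ≥0∞) := by
        rw [Finset.sum_const, orbitGrowth, Set.ncard_eq_toFinset_card _ hfin, nsmul_eq_mul, mul_comm]
    _ ≤ ∑ γ ∈ hfin.toFinset, vol (Ω.ball (γ • o).toRP 1) :=
        Finset.sum_le_sum fun γ _ => hc _ (Point.toRP_mem _)
    _ ≤ K * vol (Ω.ball o.toRP r) := by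
        refine sum_measure_le_of_multiplicity vol _ _ _ K
          (fun γ _ => (isOpen_ball (Point.toRP_mem _) _).measurableSet)
          (isOpen_ball (Point.toRP_mem _) _).measurableSet ?_ ?_
        · intro γ hγ q hq
          obtain ⟨hqΩ, hd⟩ := mem_ball_toRP.1 hq
          rw [Set.Finite.mem_toFinset, Set.mem_ofPred_eq] at hγ
          refine mem_ball_toRP.2 ⟨hqΩ, ?_⟩
          have := dist_triangle o (γ • o) (toPoint q hqΩ)
          linarith
        · intro q
          by_cases hqΩ : q ∈ Ω.carrier
          · obtain ⟨h1, h2⟩ := hK o (toPoint q hqΩ)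
            refine ⟨h1.toFinset, by rwa [← Set.ncard_eq_toFinset_card _ h1], fun γ _ hq => ?_⟩
            obtain ⟨_, hd⟩ := mem_ball_toRP.1 hq
            rw [Set.Finite.mem_toFinset, Set.mem_ofPred_eq]
            exact hd.le
          · exact ⟨∅, by simp, fun γ _ hq => absurd hq.1 hqΩ⟩

lemma hasVolumeEntropy (hΓ : Divides Γ Ω) (hn : 0 < n) {h : ℝ}
    (hh : ∀ o : Ω.Point, Tendsto
      (fun t => Real.log (orbitGrowth (Γ.subgroupOf Ω.Aut) o t) / t) atTop (𝓝 h))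
    {vol : Measure (RP n)} (hvol : IsUniformVolume Ω vol) : HasVolumeEntropy Ω vol (h : EReal) := by
  intro p hp
  obtain ⟨c, C, hc, hcC⟩ := hvol
  -- Positivity of `C` follows from `c ≤ vol ≤ C` on the unit ball at `p`, and is needed for the
  -- logarithm to be real.
  have hC : 0 < C := by
    have h1 := (hcC p hp).1.trans (hcC p hp).2
    exact hc.trans_le (ENNReal.coe_le_coe.1 h1)
  set o := toPoint p hp
  have hop : o.toRP = p := toRP_toPoint hp
  rw [← hop]
  have hG := hΓ.isGeometricAction hn
  obtain ⟨A, a, hA, ha, hupper⟩ := exists_volume_le hΓ hn (fun q hq => (hcC q hq).2) o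
  obtain ⟨K, hK, hlower⟩ := exists_le_volume hΓ hn (fun q hq => (hcC q hq).1) o
  have hCA : 0 < C * A := mul_pos hC (by exact_mod_cast hA)
  have hcK : 0 < c / K := div_pos hc (by exact_mod_cast hK)
  have h1 := (continuous_coe_real_ereal.tendsto h).comp
    (tendsto_const_add_div (tendsto_div_comp_add (hh o) a) (Real.log (C * A : ℝ≥0)))
  have h2 := (continuous_coe_real_ereal.tendsto h).comp
    (tendsto_const_add_div (tendsto_div_comp_add (hh o) (-1)) (Real.log (c / K : ℝ≥0)))
  refine tendsto_of_tendsto_of_tendsto_of_le_of_le' h2 h1 ?_ ?_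
  · filter_upwards [eventually_ge_atTop 1] with r hr
    have h3 := hG.one_le_orbitGrowth o (t := r + -1) (by linarith)
    refine le_log_div ?_ (by linarith) (log_mul_natCast hcK (by omega))
    have h4 := hlower r
    rw [sub_eq_add_neg] at h4
    have hK0 : (K : ℝ≥0) ≠ 0 := by exact_mod_cast hK.ne'
    rw [ENNReal.coe_div hK0, ENNReal.coe_natCast, ENNReal.mul_comm_div, ← mul_div_assoc]
    exact ENNReal.div_le_of_le_mul' h4
  · filter_upwards [eventually_gt_atTop 0] with r hr
    have h3 := hG.one_le_orbitGrowth o (t := r + a) (by linarith)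
    exact log_div_le (hupper r) hr (log_mul_natCast hCA (by omega))

end HilbertGeometry

end

/-! ### The equality of the three growth rates. -/

theorem mainTheorem10 (n : ℕ) (hn : 0 < n) (Ω : HilbertGeometry.ProperlyConvexDomain n)
    (Γ : Subgroup (HilbertGeometry.PSL n)) (hΓ : HilbertGeometry.Divides Γ Ω) :
    ∃ h : ℝ,
      (∀ p ∈ Ω.carrier, HilbertGeometry.criticalExponent Ω Γ p = (h : EReal)) ∧
      (∀ vol : MeasureTheory.Measure (HilbertGeometry.RP n),
        HilbertGeometry.IsUniformVolume Ω vol →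
          HilbertGeometry.HasVolumeEntropy Ω vol (h : EReal)) ∧
      HilbertGeometry.HasTopologicalEntropy (HilbertGeometry.geodesicFlow Γ hΓ.le_aut)
        (h : EReal) := by
  have := HilbertGeometry.ProperlyConvexDomain.isIsometricSMul hn (Γ.subgroupOf Ω.Aut)
  have hG := hΓ.isGeometricAction hn
  obtain ⟨p, hp⟩ := Ω.nonempty
  set o := HilbertGeometry.ProperlyConvexDomain.toPoint p hp
  have : Nonempty Ω.Point := ⟨o⟩
  obtain ⟨h, hh⟩ := hG.exists_tendsto_log_orbitGrowth o
  have hh' := fun o' => hG.tendsto_log_orbitGrowth_of_dist hh o'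
  exact ⟨h, fun q hq => HilbertGeometry.criticalExponent_eq hΓ hn hq (hh' _),
    fun vol hvol => HilbertGeometry.hasVolumeEntropy hΓ hn hh' hvol,
    (HilbertGeometry.isQuotientFlow_geodesicFlow hΓ.le_aut).hasTopologicalEntropy
      (HilbertGeometry.lineSystem_unitLine hn _) hG o hh⟩
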